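/- Let $\Omega\subset\mathbb R^2$ be a bounded domain with $C^2$ boundary, and let $T>0$, $N\in\mathbb N$, $\varepsilon>0$, $\lambda>0$. Let $h_1,\dots,h_N\in C^\infty(\overline\Omega)\cap H_0^1(\Omega)$ be linearly independent (where $C^\infty(\overline\Omega)$ is the space of restrictions to $\overline\Omega$ of $C^\infty$ functions on $\mathbb R^2$), and let $\gamma_0\in W^{2,\infty}([0,1];\overline\Omega)$ (continuous representative). For $u\in L^2(0,T;\mathbb R^N)$ put $\psi_u(t,x)=\sum_{k=1}^N u_k(t)h_k(x)$. Let $J=\begin{pmatrix}0&-1\\1&0\end{pmatrix}$, $\nabla^\perp=J\nabla$, and for $\psi=\psi_u$ consider the state system, in the sense of Carathéodory (integrated in time), for $(t,s)\in[0,T]\times[0,1]$: $$\partial_tX=J\nabla\psi(t,X),\qquad \partial_ta=J\nabla^2\psi(t,X)\,a,\qquad X(0,s)=\gamma_0(s),\quad a(0,s)=\gamma_0'(s).$$ With $\ell_\varepsilon(z)=\sqrt{|z|^2+\varepsilon^2}$ let $$\mathcal J_{\lambda,\varepsilon}(\psi)=-\int_0^1\ell_\varepsilon(a(T,s))\,ds+\frac\lambda2\int_0^T\|\psi(t,\cdot)\|_{L^2(\Omega)}^2\,dt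 .$$ (i) For every $u\in L^2(0,T;\mathbb R^N)$, with $\psi=\psi_u$: $\psi\in L^2(0,T;W^{3,\infty}(\Omega))$ and $\mathbf v=\nabla^\perp\psi\in L^2(0,T;W^{2,\infty}(\Omega;\mathbb R^2))$. For every $x\in\overline\Omega$ the equation $\dot y=\mathbf v(t,y)$, $y(0)=x$, has a unique solution $\Phi_\psi(\cdot\,;x)$ on $[0,T]$ with values in $\overline\Omega$; thus the flow $\Phi_\psi(t;\cdot)$ maps $\overline\Omega$ into itself. Moreover, if the $h_k$ are replaced by any $C^\infty$ extensions to $\mathbb R^2$, every trajectory in $\mathbb R^2$ of the resulting field that starts in $\overline\Omega$ stays in $\overline\Omega$ on $[0,T]$. The state system has a unique solution $(X,a)\in C([0,T]\times[0,1];\overline\Omega\times\mathbb R^2)$. Consequently $\mathcal J_{\lambda,\varepsilon}(\psi_u)$ is well defined, and it depends continuously on $u\in L^2(0,T;\mathbb R^N)$, and equally on $\psi_u$ with respect to the norm of $L^2(0,T;L^2(\Omega))$. (ii) For every $R_u>0$, the functional $\mathcal J_{\lambda,\varepsilon}$ has at least one minimizer on $$\mathcal U_{\rm ad}^{R_u}=\{\psi_u:\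 u\in L^2(0,T;\mathbb R^N),\ \|u\|_{L^2(0,T;\mathbb R^N)}\le R_u\}.$$ -/

import Mathlib

open MeasureTheory Set Filter Topology
open scoped ENNReal ContDiff

noncomputable section

namespace InterfaceControl

/-- The Euclidean plane. -/
abbrev Plane : Type := EuclideanSpace ℝ (Fin 2)

/-! ### Test functions, weak derivatives, Sobolev norms -/

section Sobolev

variable {E F : Type} [NormedAddCommGroup E] [NormedSpace ℝ E] [MeasureSpace E]
  [NormedAddCommGroup F] [NormedSpace ℝ F]

/-- `φ ∈ C_c^∞(Ω)`. -/
def IsTestFunction (Ω : Set E) (φ : E → ℝ) : Prop :=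
  ContDiff ℝ ∞ φ ∧ HasCompactSupport φ ∧ tsupport φ ⊆ Ω

/-- On the open set `Ω`, the function `g` is the weak derivative `∂_{v 0} ⋯ ∂_{v (k-1)} f` of
order `k` in the directions `v 0, …, v (k-1)`:
`∫_Ω f ∂_{v 0} ⋯ ∂_{v (k-1)} φ = (-1)^k ∫_Ω g φ` for all `φ ∈ C_c^∞(Ω)`. -/
def HasWeakDeriv (Ω : Set E) {k : ℕ} (v : Fin k → E) (f g : E → F) : Prop :=
  LocallyIntegrableOn f Ω volume ∧ LocallyIntegrableOn g Ω volume ∧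
    ∀ φ : E → ℝ, IsTestFunction Ω φ →
      ∫ x in Ω, iteratedFDeriv ℝ k φ x v • f x = (-1 : ℝ) ^ k • ∫ x in Ω, φ x • g x

/-- The `W^{m,p}(Ω)` norm, with values in `[0,∞]`: the supremum, over all orders `k ≤ m` and all
directions of length at most one, of the `L^p(Ω)` norm of the weak directional derivative.  Weak
derivatives are a.e. unique; where one does not exist, the infimum is over the empty set and the
norm is `∞`.  On a finite-dimensional space this is equivalent to the norm built from the weak
partial derivatives of order at most `m`. -/
def eSobolevNorm (Ω : Set E) (m : ℕ) (p : ℝ≥0∞) (f : E → F) : ℝ≥0∞ :=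
  ⨆ (k : ℕ) (_ : k ≤ m) (v : Fin k → E) (_ : ∀ i, ‖v i‖ ≤ 1),
    ⨅ (g : E → F) (_ : HasWeakDeriv Ω v f g), eLpNorm g p (volume.restrict Ω)

/-- `f ∈ W^{m,p}(Ω)`. -/
def MemSobolev (Ω : Set E) (m : ℕ) (p : ℝ≥0∞) (f : E → F) : Prop :=
  eSobolevNorm Ω m p f < ⊤

/-- `f ∈ H_0^1(Ω)`: `f` belongs to `H^1(Ω)` and is a limit in `H^1(Ω)` of functions of
`C_c^∞(Ω)`. -/
def MemH10 (Ω : Set E) (f : E → ℝ) : Prop :=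
  MemSobolev Ω 1 2 f ∧
    ∃ φ : ℕ → E → ℝ, (∀ n, IsTestFunction Ω (φ n)) ∧
      Tendsto (fun n => eSobolevNorm Ω 1 2 (f - φ n)) atTop (𝓝 0)

/-- `ψ ∈ L²(0,T; W^{m,∞}(Ω))` in the sense of Bochner: almost everywhere on `(0,T)`, `ψ` is the
limit in `W^{m,∞}(Ω)` of `W^{m,∞}(Ω)`-valued simple functions, and the square of
`t ↦ ‖ψ(t)‖_{W^{m,∞}(Ω)}` has finite integral. -/
def MemL2Sobolev (T : ℝ) (Ω : Set E) (m : ℕ) (ψ : ℝ → E → F) : Prop :=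
  (∃ σ : ℕ → SimpleFunc ℝ (E → F), (∀ n t, MemSobolev Ω m ⊤ (σ n t)) ∧
    ∀ᵐ t ∂(volume.restrict (Ioo 0 T)),
      Tendsto (fun n => eSobolevNorm Ω m ⊤ (ψ t - σ n t)) atTop (𝓝 0)) ∧
  ∫⁻ t in Ioo 0 T, eSobolevNorm Ω m ⊤ (ψ t) ^ 2 < ⊤

end Sobolev

/-! ### The domain and functions smooth up to the boundary -/

/-- A bounded domain (nonempty, open, connected) of the plane with boundary of class `C²`: near
each boundary point, `Ω` is the set `g < 0` for a `C²` function `g` without critical points. -/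
structure IsBoundedC2Domain (Ω : Set Plane) : Prop where
  isOpen : IsOpen Ω
  isConnected : IsConnected Ω
  isBounded : Bornology.IsBounded Ω
  boundary : ∀ x ∈ frontier Ω, ∃ (U : Set Plane) (g : Plane → ℝ), IsOpen U ∧ x ∈ U ∧
    ContDiffOn ℝ 2 g U ∧ (∀ y ∈ U, fderiv ℝ g y ≠ 0) ∧ Ω ∩ U = {y ∈ U | g y < 0}

/-- `g` is a `C^∞` function on the plane that agrees with `f` on the closure of `Ω`. -/
def IsSmoothExtension (Ω : Set Plane) (f g : Plane → ℝ) : Prop :=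
  ContDiff ℝ ∞ g ∧ EqOn g f (closure Ω)

/-- `f ∈ C^∞(closure Ω)`: on the closure of `Ω`, `f` is the restriction of a `C^∞` function on the
plane. -/
def SmoothUpToBoundary (Ω : Set Plane) (f : Plane → ℝ) : Prop :=
  ∃ g, IsSmoothExtension Ω f g

/-! ### Hamiltonian vector field and state system -/

/-- The symplectic matrix `J`, as a linear map of the plane. -/
def J : Plane →L[ℝ] Plane := Matrix.toEuclideanCLM (𝕜 := ℝ) !![0, -1; 1, 0]

/-- `∇^⊥ f = J ∇f` on the set `S` (derivatives taken within `S`). -/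
def perpGrad (S : Set Plane) (f : Plane → ℝ) (x : Plane) : Plane :=
  J (gradientWithin f S x)

/-- `J ∇²f(x) z` on the set `S`; the Hessian `∇²f` is the derivative of the gradient. -/
def perpHess (S : Set Plane) (f : Plane → ℝ) (x z : Plane) : Plane :=
  J (fderivWithin ℝ (gradientWithin f S) S x z)

/-- `y` solves `y' = f(t, y)` on `[0,T]` with `y(0) = y₀`, in the sense of Carathéodory
(equivalently: `y` is absolutely continuous and the equation holds for almost every `t`). -/
def SolvesIVP (T : ℝ) (f : ℝ → Plane → Plane) (y₀ : Plane) (y : ℝ → Plane) : Prop :=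
  ContinuousOn y (Icc 0 T) ∧
  IntervalIntegrable (fun t => f t (y t)) volume 0 T ∧
  ∀ t ∈ Icc 0 T, y t = y₀ + ∫ τ in (0 : ℝ)..t, f τ (y τ)

/-- `(X, a) ∈ C([0,T] × [0,1]; closure Ω × ℝ²)` solves the state system
`∂ₜX = J∇ψ(t,X)`, `∂ₜa = J∇²ψ(t,X) a`, `X(0,s) = γ₀(s)`, `a(0,s) = γ₀'(s)`. -/
structure IsState (Ω : Set Plane) (T : ℝ) (γ₀ : ℝ → Plane) (ψ : ℝ → Plane → ℝ)
    (X a : ℝ → ℝ → Plane) : Prop where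
  continuousOn_X : ContinuousOn (fun p : ℝ × ℝ => X p.1 p.2) (Icc 0 T ×ˢ Icc 0 1)
  continuousOn_a : ContinuousOn (fun p : ℝ × ℝ => a p.1 p.2) (Icc 0 T ×ˢ Icc 0 1)
  mem_closure : ∀ t ∈ Icc 0 T, ∀ s ∈ Icc (0 : ℝ) 1, X t s ∈ closure Ω
  solves_X : ∀ s ∈ Icc (0 : ℝ) 1,
    SolvesIVP T (fun t x => perpGrad (closure Ω) (ψ t) x) (γ₀ s) (fun t => X t s)
  solves_a : ∀ s ∈ Icc (0 : ℝ) 1,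
    SolvesIVP T (fun t z => perpHess (closure Ω) (ψ t) (X t s) z)
      (derivWithin γ₀ (Icc 0 1) s) (fun t => a t s)

/-! ### Controls, stream functions and the cost -/

/-- The space `L²(0,T; ℝ^N)` of controls. -/
abbrev Control (T : ℝ) (N : ℕ) : Type :=
  Lp (EuclideanSpace ℝ (Fin N)) 2 ((volume : Measure ℝ).restrict (Ioo 0 T))

/-- The stream function `ψ(t,x) = ∑ₖ uₖ(t) hₖ(x)`. -/
def streamFunction {T : ℝ} {N : ℕ} (h : Fin N → Plane → ℝ) (u : Control T N) :
    ℝ → Plane → ℝ :=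
  fun t x => ∑ k, u t k * h k x

/-- The admissible set: the stream functions of the controls with `‖u‖_{L²(0,T;ℝ^N)} ≤ R`. -/
def Uad (T : ℝ) {N : ℕ} (h : Fin N → Plane → ℝ) (R : ℝ) : Set (ℝ → Plane → ℝ) :=
  {ψ | ∃ u : Control T N, ‖u‖ ≤ R ∧ ψ = streamFunction h u}

/-- The regularized Euclidean norm `ℓ_ε(z) = √(|z|² + ε²)`. -/
def ell (ε : ℝ) (z : Plane) : ℝ := √(‖z‖ ^ 2 + ε ^ 2)

/-- `-∫₀¹ ℓ_ε(a(T,s)) ds + (λ/2) ∫₀ᵀ ‖ψ(t,·)‖²_{L²(Ω)} dt`. -/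
def costOfState (Ω : Set Plane) (T lam ε : ℝ) (ψ : ℝ → Plane → ℝ) (a : ℝ → ℝ → Plane) : ℝ :=
  -(∫ s in (0 : ℝ)..1, ell ε (a T s)) + lam / 2 * ∫ t in (0 : ℝ)..T, ∫ x in Ω, ψ t x ^ 2

open Classical in
/-- The tangent component `a` of a solution of the state system for `ψ`; the value `0` if there
is no solution. -/
def tangent (Ω : Set Plane) (T : ℝ) (γ₀ : ℝ → Plane) (ψ : ℝ → Plane → ℝ) : ℝ → ℝ → Plane :=
  if H : ∃ p : (ℝ → ℝ → Plane) × (ℝ → ℝ → Plane), IsState Ω T γ₀ ψ p.1 p.2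
  then H.choose.2 else 0

/-- The cost functional `J_{λ,ε}(ψ)`. -/
def cost (Ω : Set Plane) (T : ℝ) (γ₀ : ℝ → Plane) (lam ε : ℝ) (ψ : ℝ → Plane → ℝ) : ℝ :=
  costOfState Ω T lam ε ψ (tangent Ω T γ₀ ψ)

end InterfaceControl

end

noncomputable section

namespace InterfaceControl

/-! ### Absolutely continuous functions and the integral Gronwall inequality -/

/-! Replace each `h k` by a compactly supported smooth extension `g k`. The state equations then
read `y' = W(y) u(t)`: they are linear in the control, with a field `W` that is smooth in the state,
and an `L²` control is integrable in time. Existence, uniqueness and stability follow from a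
weighted contraction (`exists_solvesAffine`) and an integral Gronwall inequality
(`gronwall_integral`).

The closed domain is invariant for the following reason. A function of `H_0^1` that is smooth up to
the boundary vanishes there (`MemH10.eq_zero_of_mem_frontier`), so its gradient is normal to the
boundary and `J∇h` is tangent to it. The squared distance `D` of a trajectory to the closed domain
therefore satisfies `D' ≤ 2K‖u‖D` with `D(0) = 0`, which forces `D = 0`
(`SolvesAffine.mem_of_tangent`).

The right-hand side of the tangent equation, `∇²g(X) a`, is not globally Lipschitz in `(X, a)`. It
is linear in `a`, however, so Gronwall bounds `a` in terms of the control alone. The field can thus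
be cut off at large `a` without changing the solutions in question.

Since the control enters linearly, weak convergence of controls suffices for convergence of states
(`SolvesAffine.tendsto_of_weak`): with the trajectory frozen, the effect of the control is a bounded
linear map into a finite-dimensional space. Hence the length term is weakly sequentially continuous
on bounded sets. The other term is `c‖L u‖²` with `L` bounded and linear, which is convex and so
weakly lower semicontinuous, and balls of `L²` are weakly sequentially compact. The direct method
gives a minimizer.

Weak sequential continuity also yields norm continuity in `u`. Continuity in `ψ` follows because
linear independence makes `c ↦ ∑ cₖ hₖ` injective, hence bounded below on a finite-dimensional
space, so that the controls converge when the stream functions do. -/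

theorem absolutelyContinuousOnInterval_of_dist_le {X Y : Type*} [PseudoMetricSpace X]
    [PseudoMetricSpace Y] {f : ℝ → X} {g : ℝ → Y} {a b : ℝ}
    (hg : AbsolutelyContinuousOnInterval g a b) (C : ℝ)
    (h : ∀ x ∈ uIcc a b, ∀ y ∈ uIcc a b, dist (f x) (f y) ≤ C * dist (g x) (g y)) :
    AbsolutelyContinuousOnInterval f a b := by
  have hC : Tendsto (fun E : ℕ × (ℕ → ℝ × ℝ) =>
      C * ∑ i ∈ Finset.range E.1, dist (g (E.2 i).1) (g (E.2 i).2))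
      (AbsolutelyContinuousOnInterval.totalLengthFilter ⊓
        𝓟 (AbsolutelyContinuousOnInterval.disjWithin a b)) (𝓝 0) := by
    simpa using Tendsto.const_mul C hg
  refine squeeze_zero' (Eventually.of_forall fun E => Finset.sum_nonneg fun _ _ => dist_nonneg)
    ?_ hC
  have hE : ∀ᶠ E in AbsolutelyContinuousOnInterval.totalLengthFilter ⊓
      𝓟 (AbsolutelyContinuousOnInterval.disjWithin a b),
      E ∈ AbsolutelyContinuousOnInterval.disjWithin a b :=
    eventually_inf_principal.mpr (by simp)
  filter_upwards [hE] with E hE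
  rw [Finset.mul_sum]
  exact Finset.sum_le_sum fun i hi => h _ (hE.1 i hi).1 _ (hE.1 i hi).2

/-- The primitive of an integrable vector-valued function is absolutely continuous. -/
theorem absolutelyContinuousOnInterval_integral {E : Type*} [NormedAddCommGroup E]
    [NormedSpace ℝ E] {f : ℝ → E} {a b : ℝ} (hf : IntervalIntegrable f volume a b) :
    AbsolutelyContinuousOnInterval (fun t => ∫ τ in a..t, f τ) a b := by
  -- Increments are dominated by those of the real primitive of `‖f‖`.
  refine absolutelyContinuousOnInterval_of_dist_le
    (hf.norm.absolutelyContinuousOnInterval_intervalIntegral left_mem_uIcc) 1 fun x hx y hy => ?_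
  have hmono : ∀ t ∈ uIcc a b, IntervalIntegrable f volume a t := fun t ht =>
    hf.mono_set (uIcc_subset_uIcc_left ht)
  rw [one_mul, dist_eq_norm, dist_eq_norm,
    intervalIntegral.integral_interval_sub_left (hmono x hx) (hmono y hy),
    intervalIntegral.integral_interval_sub_left (hmono x hx).norm (hmono y hy).norm,
    Real.norm_eq_abs]
  exact intervalIntegral.norm_integral_le_abs_integral_norm

/-- `A` is bounded by some `M` on the interval, and the exponential is Lipschitz with constant `e^M`
on `(-∞, M]`. -/
theorem absolutelyContinuousOnInterval_exp {A : ℝ → ℝ} {a b : ℝ}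
    (hA : AbsolutelyContinuousOnInterval A a b) :
    AbsolutelyContinuousOnInterval (fun t => Real.exp (A t)) a b := by
  obtain ⟨M, hM⟩ := hA.exists_bound
  refine absolutelyContinuousOnInterval_of_dist_le hA (Real.exp M) fun x hx y hy => ?_
  have key : ∀ p ≤ M, ∀ q ≤ M, p ≤ q →
      |Real.exp p - Real.exp q| ≤ Real.exp M * |p - q| := by
    intro p hp q hq hpq
    rw [abs_sub_comm, abs_of_nonneg (by simpa using hpq), abs_sub_comm,
      abs_of_nonneg (by linarith)]
    have h1 : Real.exp p = Real.exp q * Real.exp (p - q) := by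
      rw [← Real.exp_add]; congr 1; ring
    have h2 := Real.add_one_le_exp (p - q)
    have h3 : Real.exp q ≤ Real.exp M := Real.exp_le_exp.mpr hq
    rw [h1]
    have h4 := Real.exp_pos q
    nlinarith
  have hx' : A x ≤ M := (le_abs_self _).trans (hM x hx)
  have hy' : A y ≤ M := (le_abs_self _).trans (hM y hy)
  rw [Real.dist_eq, Real.dist_eq]
  rcases le_total (A x) (A y) with h | h
  · exact key _ hx' _ hy' h
  · rw [abs_sub_comm, abs_sub_comm (A x)]
    exact key _ hy' _ hx' h

/-- `∫₀ᵗ L e^{∫₀^τ L} dτ = e^{∫₀ᵗ L} - 1`. -/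
theorem integral_mul_exp_integral {L : ℝ → ℝ} {T : ℝ} (hL : IntervalIntegrable L volume 0 T) :
    ∫ τ in (0 : ℝ)..T, L τ * Real.exp (∫ σ in (0 : ℝ)..τ, L σ) =
      Real.exp (∫ σ in (0 : ℝ)..T, L σ) - 1 := by
  have hac := absolutelyContinuousOnInterval_exp
    (hL.absolutelyContinuousOnInterval_intervalIntegral (c := 0) (by simp))
  have h := hac.integral_deriv_eq_sub
  simp only [intervalIntegral.integral_same, Real.exp_zero] at h
  rw [← h]
  refine intervalIntegral.integral_congr_ae ?_
  filter_upwards [hL.ae_hasDerivAt_integral] with x hx hx'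
  rw [((hx (uIoc_subset_uIcc hx') 0 (by simp)).exp).deriv, mul_comm]

/-- `L` is only integrable, so the argument runs through absolute continuity: `(r + ∫Lφ) e^{-∫L}` is
absolutely continuous, its derivative `L e^{-∫L} (φ - r - ∫Lφ)` is nonpositive almost everywhere,
and its initial value is `r`. -/
theorem gronwall_integral {L φ : ℝ → ℝ} {T r : ℝ} (hT : 0 ≤ T)
    (hL : IntervalIntegrable L volume 0 T) (hL0 : ∀ t ∈ Icc 0 T, 0 ≤ L t)
    (hφ : ContinuousOn φ (Icc 0 T))
    (h : ∀ t ∈ Icc 0 T, φ t ≤ r + ∫ τ in (0 : ℝ)..t, L τ * φ τ) :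
    ∀ t ∈ Icc 0 T, φ t ≤ r * Real.exp (∫ τ in (0 : ℝ)..t, L τ) := by
  intro t ht
  have ht' : uIcc 0 t ⊆ Icc 0 T := by
    rw [uIcc_of_le ht.1]; exact Icc_subset_Icc le_rfl ht.2
  have hTt : uIcc 0 t ⊆ uIcc 0 T := by rwa [uIcc_of_le hT]
  have hLt := hL.mono_set hTt
  have hLφ : IntervalIntegrable (fun τ => L τ * φ τ) volume 0 t :=
    hLt.mul_continuousOn (hφ.mono ht')
  have hR := hLφ.absolutelyContinuousOnInterval_intervalIntegral (c := 0) (by simp)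
  have hA := hLt.absolutelyContinuousOnInterval_intervalIntegral (c := 0) (by simp)
  have hE := absolutelyContinuousOnInterval_exp hA.neg
  have hconst : AbsolutelyContinuousOnInterval (fun _ : ℝ => r) 0 t :=
    absolutelyContinuousOnInterval_of_dist_le hA 0 (by simp)
  have hP := (hconst.add hR).mul hE
  have hFTC := hP.integral_deriv_eq_sub
  have hle : (∫ x in (0 : ℝ)..t, deriv
      (((fun _ : ℝ => r) + fun x => ∫ v in (0 : ℝ)..x, L v * φ v) *
        fun t => Real.exp ((-fun x => ∫ v in (0 : ℝ)..x, L v) t)) x) ≤ ∫ x in (0 : ℝ)..t, 0 := by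
    refine intervalIntegral.integral_mono_ae_restrict ht.1 hP.intervalIntegrable_deriv (by simp) ?_
    have hmem : ∀ᵐ x ∂volume.restrict (Icc 0 t), x ∈ Icc 0 t :=
      ae_restrict_mem measurableSet_Icc
    filter_upwards [hmem, ae_restrict_of_ae hLφ.ae_hasDerivAt_integral,
      ae_restrict_of_ae hLt.ae_hasDerivAt_integral] with x hx h1 h2
    rw [← uIcc_of_le ht.1] at hx
    have h1' := h1 hx 0 (by simp)
    have h2' := h2 hx 0 (by simp)
    have h3 := (((hasDerivAt_const x r).add h1').mul h2'.neg.exp)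
    rw [h3.deriv]
    have hx0 := ht' hx
    have h4 := mul_le_mul_of_nonneg_left (h x hx0) (hL0 x hx0)
    simp only [Pi.add_apply, Pi.neg_apply, zero_add]
    have h5 := Real.exp_pos (-∫ v in (0 : ℝ)..x, L v)
    nlinarith
  rw [hFTC] at hle
  simp only [Pi.mul_apply, Pi.add_apply, Pi.neg_apply, intervalIntegral.integral_same,
    intervalIntegral.integral_zero, neg_zero, Real.exp_zero, add_zero, mul_one] at hle
  have h6 := h t ht
  rw [Real.exp_neg] at hle
  have h7 := Real.exp_pos (∫ v in (0 : ℝ)..t, L v)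
  have h8 : (r + ∫ v in (0 : ℝ)..t, L v * φ v) * (Real.exp (∫ v in (0 : ℝ)..t, L v))⁻¹ ≤ r := by
    linarith
  rw [← div_eq_mul_inv, div_le_iff₀ h7] at h8
  linarith

/-! ### Carathéodory theory of control-affine systems `y' = W(y) u(t)` -/

section Caratheodory

variable {E V : Type*} [NormedAddCommGroup E] [NormedSpace ℝ E]
  [NormedAddCommGroup V] [NormedSpace ℝ V]

/-- `y` is a Carathéodory solution of `y' = W(y) u(t)`, `y(0) = y₀` on `[0,T]`. -/
structure SolvesAffine (T : ℝ) (u : ℝ → V) (W : E → V →L[ℝ] E) (y₀ : E) (y : ℝ → E) : Prop where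
  continuousOn : ContinuousOn y (Icc 0 T)
  eq_integral : ∀ t ∈ Icc 0 T, y t = y₀ + ∫ τ in (0 : ℝ)..t, W (y τ) (u τ)

theorem intervalIntegrable_apply {F : Type*} [NormedAddCommGroup F] [NormedSpace ℝ F]
    {T : ℝ} {u : ℝ → V} {A : ℝ → V →L[ℝ] F} (hT : 0 ≤ T)
    (hu : IntervalIntegrable u volume 0 T) (hA : ContinuousOn A (Icc 0 T)) :
    IntervalIntegrable (fun τ => A τ (u τ)) volume 0 T := by
  obtain ⟨M, hM⟩ := isCompact_Icc.exists_bound_of_continuousOn hA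
  rw [intervalIntegrable_iff_integrableOn_Ioc_of_le hT] at hu ⊢
  have hAm : AEStronglyMeasurable A (volume.restrict (Ioc 0 T)) :=
    hA.aestronglyMeasurable_of_subset_isCompact isCompact_Icc measurableSet_Ioc
      Ioc_subset_Icc_self
  refine Integrable.mono' (hu.norm.const_mul M)
    (isBoundedBilinearMap_apply.continuous.comp_aestronglyMeasurable (hAm.prodMk hu.1)) ?_
  filter_upwards [ae_restrict_mem measurableSet_Ioc] with τ hτ
  exact (A τ).le_of_opNorm_le (hM τ (Ioc_subset_Icc_self hτ)) _

theorem _root_.IntervalIntegrable.mono_Icc {F : Type*} [NormedAddCommGroup F] {f : ℝ → F} {T t : ℝ}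
    (hf : IntervalIntegrable f volume 0 T) (ht : t ∈ Icc 0 T) :
    IntervalIntegrable f volume 0 t :=
  hf.mono_set (by
    rw [uIcc_of_le ht.1, uIcc_of_le (ht.1.trans ht.2)]; exact Icc_subset_Icc le_rfl ht.2)

namespace SolvesAffine

variable {T : ℝ} {u : ℝ → V} {W : E → V →L[ℝ] E} {y₀ z₀ : E} {y z : ℝ → E}

theorem intervalIntegrable (h : SolvesAffine T u W y₀ y) (hT : 0 ≤ T)
    (hu : IntervalIntegrable u volume 0 T) (hW : Continuous W) :
    IntervalIntegrable (fun τ => W (y τ) (u τ)) volume 0 T :=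
  intervalIntegrable_apply hT hu (hW.comp_continuousOn h.continuousOn)

theorem apply_zero (h : SolvesAffine T u W y₀ y) (hT : 0 ≤ T) : y 0 = y₀ := by
  simpa using h.eq_integral 0 ⟨le_rfl, hT⟩

theorem norm_sub_le {K : NNReal} (hy : SolvesAffine T u W y₀ y) (hz : SolvesAffine T u W z₀ z)
    (hT : 0 ≤ T) (hu : IntervalIntegrable u volume 0 T) (hW : LipschitzWith K W) :
    ∀ t ∈ Icc 0 T, ‖y t - z t‖ ≤ ‖y₀ - z₀‖ * Real.exp (∫ τ in (0 : ℝ)..t, K * ‖u τ‖) := by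
  have hL : IntervalIntegrable (fun τ => K * ‖u τ‖) volume 0 T := hu.norm.const_mul _
  refine gronwall_integral hT hL (fun t _ => by positivity)
    (hy.continuousOn.sub hz.continuousOn).norm fun t ht => ?_
  rw [hy.eq_integral t ht, hz.eq_integral t ht, add_sub_add_comm,
    ← intervalIntegral.integral_sub
      ((hy.intervalIntegrable hT hu hW.continuous).mono_Icc ht)
      ((hz.intervalIntegrable hT hu hW.continuous).mono_Icc ht)]
  refine (norm_add_le _ _).trans (add_le_add le_rfl ?_)
  refine intervalIntegral.norm_integral_le_of_norm_le ht.1 (Eventually.of_forall fun τ _ => ?_)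
    ((hL.mul_continuousOn (by
      rw [uIcc_of_le hT]
      exact (hy.continuousOn.sub hz.continuousOn).norm)).mono_Icc ht)
  rw [← sub_apply]
  refine (ContinuousLinearMap.le_opNorm _ _).trans ?_
  have := hW.norm_sub_le (y τ) (z τ)
  calc ‖W (y τ) - W (z τ)‖ * ‖u τ‖ ≤ (K * ‖y τ - z τ‖) * ‖u τ‖ := by gcongr
    _ = K * ‖u τ‖ * ‖y τ - z τ‖ := by ring

theorem eqOn {K : NNReal} (hy : SolvesAffine T u W y₀ y) (hz : SolvesAffine T u W y₀ z)
    (hT : 0 ≤ T) (hu : IntervalIntegrable u volume 0 T) (hW : LipschitzWith K W) :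
    EqOn y z (Icc 0 T) := fun t ht => by
  simpa [sub_eq_zero] using hy.norm_sub_le hz hT hu hW t ht

/-- The solution depends continuously on time and initial value. -/
theorem continuousOn_prod {K : NNReal} {S : Type*} [TopologicalSpace S] {Y : ℝ → S → E}
    {Y₀ : S → E} {s : Set S} (hY : ∀ σ ∈ s, SolvesAffine T u W (Y₀ σ) (fun t => Y t σ))
    (hT : 0 ≤ T) (hu : IntervalIntegrable u volume 0 T) (hW : LipschitzWith K W)
    (hY₀ : ContinuousOn Y₀ s) :
    ContinuousOn (fun p : ℝ × S => Y p.1 p.2) (Icc 0 T ×ˢ s) := by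
  rintro ⟨t₀, s₀⟩ ⟨ht₀, hs₀⟩
  have hL : IntervalIntegrable (fun τ => K * ‖u τ‖) volume 0 T := hu.norm.const_mul _
  set C := Real.exp (∫ τ in (0 : ℝ)..T, K * ‖u τ‖) with hC
  have hfst : Tendsto (Prod.fst : ℝ × S → ℝ) (𝓝[Icc 0 T ×ˢ s] (t₀, s₀)) (𝓝[Icc 0 T] t₀) :=
    tendsto_nhdsWithin_of_tendsto_nhds_of_eventually_within _
      (continuous_fst.continuousWithinAt) (eventually_mem_nhdsWithin.mono fun p hp => hp.1)
  have hsnd : Tendsto (Prod.snd : ℝ × S → S) (𝓝[Icc 0 T ×ˢ s] (t₀, s₀)) (𝓝[s] s₀) :=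
    tendsto_nhdsWithin_of_tendsto_nhds_of_eventually_within _
      (continuous_snd.continuousWithinAt) (eventually_mem_nhdsWithin.mono fun p hp => hp.2)
  have h1 : Tendsto (fun p : ℝ × S => ‖Y₀ p.2 - Y₀ s₀‖ * C + ‖Y p.1 s₀ - Y t₀ s₀‖)
      (𝓝[Icc 0 T ×ˢ s] (t₀, s₀)) (𝓝 0) := by
    have ha := (tendsto_iff_norm_sub_tendsto_zero.mp ((hY₀ s₀ hs₀).tendsto.comp hsnd)).mul_const C
    have hb := tendsto_iff_norm_sub_tendsto_zero.mp
      (((hY s₀ hs₀).continuousOn t₀ ht₀).tendsto.comp hfst)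
    simpa using ha.add hb
  refine tendsto_iff_norm_sub_tendsto_zero.mpr (squeeze_zero' (Eventually.of_forall fun _ =>
    norm_nonneg _) ?_ h1)
  filter_upwards [self_mem_nhdsWithin] with p hp
  have h2 := (hY p.2 hp.2).norm_sub_le (hY s₀ hs₀) hT hu hW p.1 hp.1
  have h3 : Real.exp (∫ τ in (0 : ℝ)..p.1, K * ‖u τ‖) ≤ C := by
    refine Real.exp_le_exp.mpr (intervalIntegral.integral_mono_interval le_rfl hp.1.1 hp.1.2
      (Eventually.of_forall fun τ => by positivity) hL)
  calc ‖Y p.1 p.2 - Y t₀ s₀‖ ≤ ‖Y p.1 p.2 - Y p.1 s₀‖ + ‖Y p.1 s₀ - Y t₀ s₀‖ :=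
        norm_sub_le_norm_sub_add_norm_sub _ _ _
    _ ≤ _ := by gcongr; exact h2.trans (by gcongr)

end SolvesAffine

/-- A single contraction covers all of `[0,T]`. With `A = 2K∫‖u‖`, the unknown is written `y = e^A
z`; the weight makes the Picard map for `z` a contraction in the sup metric, because `e^{-A(t)} ∫₀ᵗ
K‖u‖e^A = (1 - e^{-A(t)})/2 ≤ 1/2`. -/
theorem exists_solvesAffine [CompleteSpace E] {T : ℝ} {u : ℝ → V} {W : E → V →L[ℝ] E} {K : NNReal}
    (hT : 0 ≤ T) (hu : IntervalIntegrable u volume 0 T) (hW : LipschitzWith K W) (y₀ : E) :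
    ∃ y, SolvesAffine T u W y₀ y := by
  set L : ℝ → ℝ := fun τ => 2 * (K * ‖u τ‖) with hLdef
  have hL : IntervalIntegrable L volume 0 T := (hu.norm.const_mul _).const_mul _
  set A : ℝ → ℝ := fun t => ∫ τ in (0 : ℝ)..t, L τ with hAdef
  have hAc : ContinuousOn A (Icc 0 T) := by
    have := intervalIntegral.continuousOn_primitive_interval' hL (left_mem_uIcc)
    rwa [uIcc_of_le hT] at this
  have hint : ∀ z : C(Icc 0 T, E), IntervalIntegrable
      (fun τ => W (Real.exp (A τ) • IccExtend hT z τ) (u τ)) volume 0 T := fun z =>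
    intervalIntegrable_apply hT hu (hW.continuous.comp_continuousOn
      ((Real.continuous_exp.comp_continuousOn hAc).smul
        (z.continuous.Icc_extend' (h := hT)).continuousOn))
  let G : C(Icc 0 T, E) → C(Icc 0 T, E) := fun z =>
    ⟨fun t => Real.exp (-A t) •
      (y₀ + ∫ τ in (0 : ℝ)..t, W (Real.exp (A τ) • IccExtend hT z τ) (u τ)), by
      refine ContinuousOn.domRestrict (f := fun t : ℝ => Real.exp (-A t) •
        (y₀ + ∫ τ in (0 : ℝ)..t, W (Real.exp (A τ) • IccExtend hT z τ) (u τ))) ?_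
      have := intervalIntegral.continuousOn_primitive_interval' (hint z) (left_mem_uIcc)
      rw [uIcc_of_le hT] at this
      exact (Real.continuous_exp.comp_continuousOn hAc.neg).smul (continuousOn_const.add this)⟩
  have hGapp : ∀ (z : C(Icc 0 T, E)) (t : ℝ) (ht : t ∈ Icc 0 T), G z ⟨t, ht⟩ =
      Real.exp (-A t) • (y₀ + ∫ τ in (0 : ℝ)..t, W (Real.exp (A τ) • IccExtend hT z τ) (u τ)) :=
    fun _ _ _ => rfl
  have hG : ContractingWith (1 / 2) G := by
    refine ⟨by norm_num, LipschitzWith.of_dist_le_mul fun z w => ?_⟩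
    rw [ContinuousMap.dist_le (by positivity)]
    rintro ⟨t, ht⟩
    rw [hGapp, hGapp, dist_smul₀, dist_add_left, dist_eq_norm, ← intervalIntegral.integral_sub
      ((hint z).mono_Icc ht) ((hint w).mono_Icc ht)]
    have hint2 := (hL.mono_Icc ht).mul_continuousOn
      (g := fun τ => Real.exp (A τ)) (by
        rw [uIcc_of_le ht.1]
        exact (Real.continuous_exp.comp_continuousOn hAc).mono (Icc_subset_Icc le_rfl ht.2))
    have h1 : ‖∫ τ in (0 : ℝ)..t, (W (Real.exp (A τ) • IccExtend hT z τ) (u τ) -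
        W (Real.exp (A τ) • IccExtend hT w τ) (u τ))‖ ≤
        ∫ τ in (0 : ℝ)..t, (1 / 2 * dist z w) * (L τ * Real.exp (A τ)) := by
      refine intervalIntegral.norm_integral_le_of_norm_le ht.1
        (Eventually.of_forall fun τ _ => ?_) (hint2.const_mul _)
      rw [← sub_apply]
      refine (ContinuousLinearMap.le_opNorm _ _).trans ?_
      have h2 := hW.norm_sub_le (Real.exp (A τ) • IccExtend hT z τ)
        (Real.exp (A τ) • IccExtend hT w τ)
      rw [← smul_sub, norm_smul, Real.norm_of_nonneg (Real.exp_pos _).le,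
        ← dist_eq_norm (IccExtend hT z τ)] at h2
      have h3 : dist (IccExtend hT z τ) (IccExtend hT w τ) ≤ dist z w :=
        ContinuousMap.dist_apply_le_dist _
      calc _ ≤ (K * (Real.exp (A τ) * dist z w)) * ‖u τ‖ := by
            gcongr; exact h2.trans (by gcongr)
        _ = _ := by rw [hLdef]; ring
    rw [intervalIntegral.integral_const_mul, integral_mul_exp_integral (hL.mono_Icc ht)] at h1
    change _ * _ ≤ _
    rw [Real.norm_of_nonneg (Real.exp_pos _).le]
    calc _ ≤ Real.exp (-A t) * (1 / 2 * dist z w * (Real.exp (A t) - 1)) := by gcongr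
      _ = 1 / 2 * dist z w * (1 - Real.exp (-A t)) := by
          have : Real.exp (-A t) * Real.exp (A t) = 1 := by rw [← Real.exp_add]; simp
          linear_combination (1 / 2 * dist z w) * this
      _ ≤ 1 / 2 * dist z w * 1 := by gcongr; linarith [Real.exp_pos (-A t)]
      _ = _ := by simp
  have hne : Nonempty C(Icc 0 T, E) := ⟨0⟩
  set z := hG.fixedPoint
  have hz : G z = z := hG.fixedPoint_isFixedPt
  have hz' : ∀ t ∈ Icc 0 T, Real.exp (A t) • IccExtend hT z t =
      y₀ + ∫ τ in (0 : ℝ)..t, W (Real.exp (A τ) • IccExtend hT z τ) (u τ) := fun t ht => by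
    have : IccExtend hT z t = G z ⟨t, ht⟩ := by rw [hz, IccExtend_of_mem hT z ht]
    rw [this, hGapp, smul_smul, ← Real.exp_add, add_neg_cancel, Real.exp_zero, one_smul]
  exact ⟨fun t => Real.exp (A t) • IccExtend hT z t,
    (Real.continuous_exp.comp_continuousOn hAc).smul
        (z.continuous.Icc_extend' (h := hT)).continuousOn, hz'⟩

end Caratheodory

/-! ### Stability of solutions under weak convergence of controls. -/

section WeakStability

/-- The Cauchy–Schwarz inequality for integrals of nonnegative functions. -/
theorem integral_mul_le_sqrt_mul_sqrt {α : Type*} [MeasurableSpace α] {μ : Measure α}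
    {f g : α → ℝ} (hf0 : 0 ≤ᵐ[μ] f) (hg0 : 0 ≤ᵐ[μ] g) (hf : MemLp f 2 μ) (hg : MemLp g 2 μ) :
    ∫ x, f x * g x ∂μ ≤ √(∫ x, f x ^ 2 ∂μ) * √(∫ x, g x ^ 2 ∂μ) := by
  have h := integral_mul_le_Lp_mul_Lq_of_nonneg (Real.HolderConjugate.two_two) hf0 hg0
    (by simpa using hf) (by simpa using hg)
  simpa [Real.sqrt_eq_rpow] using h

theorem intervalIntegrable_of_lp {V : Type*} [NormedAddCommGroup V] {T : ℝ} (hT : 0 ≤ T)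
    (u : Lp V 2 (volume.restrict (Ioo 0 T))) :
    IntervalIntegrable u volume 0 T := by
  rw [intervalIntegrable_iff_integrableOn_Ioo_of_le hT]
  exact (Lp.memLp u).integrable one_le_two

variable {E V : Type*} [NormedAddCommGroup E] [NormedSpace ℝ E]
  [NormedAddCommGroup V] [InnerProductSpace ℝ V] {T : ℝ}

theorem norm_sq_eq_integral {α : Type*} [MeasurableSpace α] {μ : Measure α} (u : Lp V 2 μ) :
    ‖u‖ ^ 2 = ∫ t, ‖u t‖ ^ 2 ∂μ := by
  rw [← real_inner_self_eq_norm_sq, L2.inner_def]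
  simp only [real_inner_self_eq_norm_sq]

theorem intervalIntegral_eq_setIntegral_Ioo {F : Type*} [NormedAddCommGroup F] [NormedSpace ℝ F]
    (hT : 0 ≤ T) (f : ℝ → F) : ∫ t in (0 : ℝ)..T, f t = ∫ t in Ioo 0 T, f t := by
  rw [intervalIntegral.integral_of_le hT, integral_Ioc_eq_integral_Ioo]

theorem integral_norm_le_of_lp (hT : 0 ≤ T) (u : Lp V 2 (volume.restrict (Ioo 0 T))) :
    ∫ t in (0 : ℝ)..T, ‖u t‖ ≤ √T * ‖u‖ := by
  rw [intervalIntegral_eq_setIntegral_Ioo hT]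
  have h := integral_mul_le_sqrt_mul_sqrt (μ := volume.restrict (Ioo 0 T)) (f := fun _ => 1)
    (g := fun t => ‖u t‖) (Eventually.of_forall fun _ => zero_le_one)
    (Eventually.of_forall fun _ => norm_nonneg _) (memLp_const 1) (Lp.memLp u).norm
  rw [← norm_sq_eq_integral, Real.sqrt_sq (norm_nonneg _)] at h
  simpa [hT] using h

theorem ae_mem_uIoc_of_ae_restrict_Ioo {p : ℝ → Prop} {t : ℝ} (ht : t ∈ Icc 0 T)
    (h : ∀ᵐ τ ∂volume.restrict (Ioo 0 T), p τ) : ∀ᵐ τ, τ ∈ uIoc 0 t → p τ := by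
  rw [restrict_Ioo_eq_restrict_Ioc, ae_restrict_iff' measurableSet_Ioc] at h
  filter_upwards [h] with τ hτ hτ'
  rw [uIoc_of_le ht.1] at hτ'
  exact hτ ⟨hτ'.1, hτ'.2.trans ht.2⟩

theorem norm_integral_apply_le {A : ℝ → V →L[ℝ] E} {M : ℝ} (hT : 0 ≤ T)
    (hM0 : 0 ≤ M) (hM : ∀ t ∈ Icc 0 T, ‖A t‖ ≤ M) {t : ℝ} (ht : t ∈ Icc 0 T)
    (u : Lp V 2 (volume.restrict (Ioo 0 T))) :
    ‖∫ τ in (0 : ℝ)..t, A τ (u τ)‖ ≤ M * √T * ‖u‖ := by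
  have hu := (intervalIntegrable_of_lp hT u).norm.const_mul M
  calc _ ≤ ∫ τ in (0 : ℝ)..t, M * ‖u τ‖ :=
        intervalIntegral.norm_integral_le_of_norm_le ht.1 (Eventually.of_forall fun τ hτ =>
          (A τ).le_of_opNorm_le (hM τ ⟨hτ.1.le, hτ.2.trans ht.2⟩) _) (hu.mono_Icc ht)
    _ ≤ ∫ τ in (0 : ℝ)..T, M * ‖u τ‖ :=
        intervalIntegral.integral_mono_interval le_rfl ht.1 ht.2
          (Eventually.of_forall fun τ => by positivity) hu
    _ ≤ _ := by
        rw [intervalIntegral.integral_const_mul, mul_assoc]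
        exact mul_le_mul_of_nonneg_left (integral_norm_le_of_lp hT u) hM0

/-- The continuous linear map `u ↦ ∫₀ᵗ A(τ) u(τ) dτ` on `L²`. -/
theorem exists_clm_integral_apply {A : ℝ → V →L[ℝ] E} (hT : 0 ≤ T) (hA : ContinuousOn A (Icc 0 T))
    {t : ℝ} (ht : t ∈ Icc 0 T) :
    ∃ Λ : Lp V 2 (volume.restrict (Ioo 0 T)) →L[ℝ] E,
      ∀ u, Λ u = ∫ τ in (0 : ℝ)..t, A τ (u τ) := by
  obtain ⟨M, hM⟩ := isCompact_Icc.exists_bound_of_continuousOn hA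
  have hM0 : 0 ≤ M := (norm_nonneg _).trans (hM t ht)
  have hint : ∀ u : Lp V 2 (volume.restrict (Ioo 0 T)),
      IntervalIntegrable (fun τ => A τ (u τ)) volume 0 t := fun u =>
    (intervalIntegrable_apply hT (intervalIntegrable_of_lp hT u) hA).mono_Icc ht
  refine ⟨LinearMap.mkContinuous
    { toFun := fun u => ∫ τ in (0 : ℝ)..t, A τ (u τ)
      map_add' := fun u v => ?_
      map_smul' := fun c u => ?_ } (M * √T)
    fun u => norm_integral_apply_le hT hM0 hM ht u, fun u => rfl⟩
  · rw [← intervalIntegral.integral_add (hint u) (hint v)]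
    refine intervalIntegral.integral_congr_ae ?_
    filter_upwards [ae_mem_uIoc_of_ae_restrict_Ioo ht (Lp.coeFn_add u v)] with τ h1 h2
    rw [h1 h2, Pi.add_apply, map_add]
  · rw [RingHom.id_apply, ← intervalIntegral.integral_smul]
    refine intervalIntegral.integral_congr_ae ?_
    filter_upwards [ae_mem_uIoc_of_ae_restrict_Ioo ht (Lp.coeFn_smul c u)] with τ h1 h2
    rw [h1 h2, Pi.smul_apply, map_smul]

/-- In finite dimension it is enough to test against the coordinate functionals of a basis. -/
theorem tendsto_of_forall_clm [FiniteDimensional ℝ E] {x : ℕ → E} {a : E}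
    (h : ∀ ℓ : E →L[ℝ] ℝ, Tendsto (fun n => ℓ (x n)) atTop (𝓝 (ℓ a))) :
    Tendsto x atTop (𝓝 a) := by
  let b := Module.finBasis ℝ E
  have h1 : Tendsto (fun n => ∑ i, b.repr (x n) i • b i) atTop (𝓝 (∑ i, b.repr a i • b i)) :=
    tendsto_finsetSum _ fun i _ => (h (b.coord i).toContinuousLinearMap).smul_const _
  simpa only [b.sum_repr] using h1

/-- Solutions of control-affine systems depend continuously on the control in the weak
topology of `L²`. -/
theorem SolvesAffine.tendsto_of_weak [FiniteDimensional ℝ E] {W : E → V →L[ℝ] E} {K : NNReal}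
    (hT : 0 ≤ T) (hW : LipschitzWith K W) {u : Lp V 2 (volume.restrict (Ioo 0 T))}
    {w : ℕ → Lp V 2 (volume.restrict (Ioo 0 T))} {R : ℝ} (hR : ∀ n, ‖w n‖ ≤ R)
    (hweak : ∀ ℓ : Lp V 2 (volume.restrict (Ioo 0 T)) →L[ℝ] ℝ,
      Tendsto (fun n => ℓ (w n)) atTop (𝓝 (ℓ u)))
    {y₀ : E} {y : ℝ → E} {ys : ℕ → ℝ → E} (hy : SolvesAffine T u W y₀ y)
    (hys : ∀ n, SolvesAffine T (w n) W y₀ (ys n)) :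
    ∀ t ∈ Icc 0 T, Tendsto (fun n => ys n t) atTop (𝓝 (y t)) := by
  have hA : ContinuousOn (fun τ => W (y τ)) (Icc 0 T) :=
    hW.continuous.comp_continuousOn hy.continuousOn
  obtain ⟨M, hM⟩ := isCompact_Icc.exists_bound_of_continuousOn hA
  have hM0 : 0 ≤ M := (norm_nonneg _).trans (hM 0 ⟨le_rfl, hT⟩)
  have hui := intervalIntegrable_of_lp hT u
  have hwi := fun n => intervalIntegrable_of_lp hT (w n)
  have hAu := intervalIntegrable_apply hT hui hA
  have hAw := fun n => intervalIntegrable_apply hT (hwi n) hA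
  -- The error from changing the control while the trajectory stays frozen at `y`. At each fixed
  -- time it is a bounded linear map applied to `w n - u`, so weak convergence sends it to zero.
  set r : ℕ → ℝ → E := fun n t =>
    (∫ τ in (0 : ℝ)..t, W (y τ) (w n τ)) - ∫ τ in (0 : ℝ)..t, W (y τ) (u τ) with hr
  have hr0 : ∀ t ∈ Icc 0 T, Tendsto (fun n => r n t) atTop (𝓝 0) := fun t ht => by
    obtain ⟨Λ, hΛ⟩ := exists_clm_integral_apply hT hA ht
    have : Tendsto (fun n => Λ (w n)) atTop (𝓝 (Λ u)) :=
      tendsto_of_forall_clm fun ℓ => hweak (ℓ.comp Λ)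
    simp only [hΛ] at this
    simpa [hr] using this.sub_const (∫ τ in (0 : ℝ)..t, W (y τ) (u τ))
  have hrb : ∀ n, ∀ t ∈ Icc 0 T, ‖r n t‖ ≤ M * √T * R + M * √T * ‖u‖ := fun n t ht =>
    (_root_.norm_sub_le _ _).trans (add_le_add ((norm_integral_apply_le hT hM0 hM ht (w n)).trans
      (by gcongr; exact hR n)) (norm_integral_apply_le hT hM0 hM ht u))
  have hrc : ∀ n, ContinuousOn (r n) (Icc 0 T) := fun n => by
    have h1 := intervalIntegral.continuousOn_primitive_interval' hAu left_mem_uIcc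
    have h2 := intervalIntegral.continuousOn_primitive_interval' (hAw n) left_mem_uIcc
    rw [uIcc_of_le hT] at h1 h2
    exact h2.sub h1
  set d : ℕ → ℝ → ℝ := fun n t => ‖ys n t - y t‖ with hd
  have hdc : ∀ n, ContinuousOn (d n) (Icc 0 T) := fun n =>
    ((hys n).continuousOn.sub hy.continuousOn).norm
  have hL : ∀ n, IntervalIntegrable (fun τ => K * ‖w n τ‖) volume 0 T := fun n =>
    (hwi n).norm.const_mul _
  have hLd : ∀ n, IntervalIntegrable (fun τ => K * ‖w n τ‖ * d n τ) volume 0 T := fun n =>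
    (hL n).mul_continuousOn (by rw [uIcc_of_le hT]; exact hdc n)
  have hLr : ∀ n, IntervalIntegrable (fun τ => K * ‖w n τ‖ * ‖r n τ‖) volume 0 T := fun n =>
    (hL n).mul_continuousOn (by rw [uIcc_of_le hT]; exact (hrc n).norm)
  -- The forcing `‖r n t‖` in `d ≤ ‖r‖ + φ` varies with time. Gronwall is therefore applied to `φ`,
  -- which satisfies `φ ≤ ρ + ∫ K‖w‖φ` with a constant `ρ`.
  set φ : ℕ → ℝ → ℝ := fun n t => ∫ τ in (0 : ℝ)..t, K * ‖w n τ‖ * d n τ with hφ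
  have hφc : ∀ n, ContinuousOn (φ n) (Icc 0 T) := fun n => by
    have h1 := intervalIntegral.continuousOn_primitive_interval' (hLd n) left_mem_uIcc
    rwa [uIcc_of_le hT] at h1
  have hLφ : ∀ n, IntervalIntegrable (fun τ => K * ‖w n τ‖ * φ n τ) volume 0 T := fun n =>
    (hL n).mul_continuousOn (by rw [uIcc_of_le hT]; exact hφc n)
  have hdφ : ∀ n, ∀ t ∈ Icc 0 T, d n t ≤ ‖r n t‖ + φ n t := fun n t ht => by
    have h1 := ((hys n).intervalIntegrable hT (hwi n) hW.continuous).mono_Icc ht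
    have h2 := (hAw n).mono_Icc ht
    have h3 : ys n t - y t = r n t +
        ∫ τ in (0 : ℝ)..t, (W (ys n τ) (w n τ) - W (y τ) (w n τ)) := by
      rw [intervalIntegral.integral_sub h1 h2, (hys n).eq_integral t ht, hy.eq_integral t ht]
      simp only [hr]
      abel
    simp only [hd, h3]
    refine (norm_add_le _ _).trans (add_le_add le_rfl ?_)
    refine intervalIntegral.norm_integral_le_of_norm_le ht.1
      (Eventually.of_forall fun τ _ => ?_) ((hLd n).mono_Icc ht)
    rw [← sub_apply]
    refine (ContinuousLinearMap.le_opNorm _ _).trans ?_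
    have := hW.norm_sub_le (ys n τ) (y τ)
    calc _ ≤ (K * ‖ys n τ - y τ‖) * ‖w n τ‖ := by gcongr
      _ = _ := by ring
  set ρ : ℕ → ℝ := fun n => ∫ τ in (0 : ℝ)..T, K * ‖w n τ‖ * ‖r n τ‖ with hρ
  have hρ0 : ∀ n, 0 ≤ ρ n := fun n =>
    intervalIntegral.integral_nonneg hT fun τ _ => by positivity
  have hφle : ∀ n, ∀ t ∈ Icc 0 T, φ n t ≤ ρ n * Real.exp (K * (√T * R)) := fun n t ht => by
    have h1 := gronwall_integral (r := ρ n) hT (hL n) (fun τ _ => by positivity) (hφc n)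
      (fun t ht => ?_) t ht
    · refine h1.trans ?_
      gcongr
      · exact hρ0 n
      · calc _ ≤ ∫ τ in (0 : ℝ)..T, K * ‖w n τ‖ :=
              intervalIntegral.integral_mono_interval le_rfl ht.1 ht.2
                (Eventually.of_forall fun τ => by positivity) (hL n)
          _ ≤ _ := by
              rw [intervalIntegral.integral_const_mul]
              gcongr
              exact (integral_norm_le_of_lp hT (w n)).trans (by gcongr; exact hR n)
    · calc φ n t ≤ ∫ τ in (0 : ℝ)..t, (K * ‖w n τ‖ * ‖r n τ‖ + K * ‖w n τ‖ * φ n τ) := by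
            refine intervalIntegral.integral_mono_on ht.1 ((hLd n).mono_Icc ht)
              (((hLr n).add (hLφ n)).mono_Icc ht) fun τ hτ => ?_
            rw [← mul_add]
            exact mul_le_mul_of_nonneg_left (hdφ n τ ⟨hτ.1, hτ.2.trans ht.2⟩) (by positivity)
        _ = (∫ τ in (0 : ℝ)..t, K * ‖w n τ‖ * ‖r n τ‖) +
              ∫ τ in (0 : ℝ)..t, K * ‖w n τ‖ * φ n τ :=
            intervalIntegral.integral_add ((hLr n).mono_Icc ht) ((hLφ n).mono_Icc ht)
        _ ≤ _ := by
            refine add_le_add ?_ le_rfl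
            exact intervalIntegral.integral_mono_interval le_rfl ht.1 ht.2
              (Eventually.of_forall fun τ => by positivity) (hLr n)
  -- The convergence of `r n` is only pointwise in time. Its uniform bound upgrades it to
  -- convergence in `L²`, and Cauchy–Schwarz against `‖w n‖ ≤ R` then gives `ρ n → 0`.
  have hr2 : Tendsto (fun n => ∫ τ in Ioo 0 T, ‖r n τ‖ ^ 2) atTop (𝓝 0) := by
    rw [show 𝓝 (0 : ℝ) = 𝓝 (∫ τ in Ioo 0 T, (0 : ℝ)) by simp]
    refine tendsto_integral_of_dominated_convergence
      (fun _ => (M * √T * R + M * √T * ‖u‖) ^ 2) (fun n => ?_) (integrable_const _) (fun n => ?_) ?_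
    · exact (((hrc n).norm.pow 2).mono Ioo_subset_Icc_self).aestronglyMeasurable measurableSet_Ioo
    · filter_upwards [ae_restrict_mem measurableSet_Ioo] with τ hτ
      rw [norm_pow, norm_norm]
      gcongr
      exact hrb n τ (Ioo_subset_Icc_self hτ)
    · filter_upwards [ae_restrict_mem measurableSet_Ioo] with τ hτ
      simpa using (hr0 τ (Ioo_subset_Icc_self hτ)).norm.pow 2
  have hρlim : Tendsto ρ atTop (𝓝 0) := by
    have h1 : Tendsto (fun n => K * (R * √(∫ τ in Ioo 0 T, ‖r n τ‖ ^ 2))) atTop (𝓝 0) := by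
      simpa using ((hr2.sqrt).const_mul R).const_mul (K : ℝ)
    refine squeeze_zero hρ0 (fun n => ?_) h1
    simp only [hρ, mul_assoc]
    rw [intervalIntegral.integral_const_mul, intervalIntegral_eq_setIntegral_Ioo hT]
    refine mul_le_mul_of_nonneg_left ?_ K.coe_nonneg
    have hrm : MemLp (fun τ => ‖r n τ‖) 2 (volume.restrict (Ioo 0 T)) :=
      MemLp.of_bound
        (((hrc n).norm.mono Ioo_subset_Icc_self).aestronglyMeasurable measurableSet_Ioo)
        (M * √T * R + M * √T * ‖u‖) (by
          filter_upwards [ae_restrict_mem measurableSet_Ioo] with τ hτ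
          rw [norm_norm]
          exact hrb n τ (Ioo_subset_Icc_self hτ))
    have h2 := integral_mul_le_sqrt_mul_sqrt (μ := volume.restrict (Ioo 0 T))
      (f := fun t => ‖w n t‖) (g := fun t => ‖r n t‖) (Eventually.of_forall fun _ => norm_nonneg _)
      (Eventually.of_forall fun _ => norm_nonneg _) (Lp.memLp (w n)).norm hrm
    rw [← norm_sq_eq_integral, Real.sqrt_sq (norm_nonneg _)] at h2
    exact h2.trans (by gcongr; exact hR n)
  intro t ht
  refine tendsto_iff_norm_sub_tendsto_zero.mpr (squeeze_zero (fun _ => norm_nonneg _)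
    (fun n => (hdφ n t ht).trans (add_le_add le_rfl (hφle n t ht))) ?_)
  simpa using (hr0 t ht).norm.add (hρlim.mul_const (Real.exp (K * (√T * R))))

end WeakStability

/-! ### Invariance of closed sets under tangent fields. -/

section Invariance

variable {E V : Type*} [NormedAddCommGroup V] [NormedSpace ℝ V]

theorem SolvesAffine.absolutelyContinuousOnInterval [NormedAddCommGroup E] [NormedSpace ℝ E]
    {T : ℝ} {u : ℝ → V} {W : E → V →L[ℝ] E} {y₀ : E} {y : ℝ → E} (h : SolvesAffine T u W y₀ y)
    (hT : 0 ≤ T) (hu : IntervalIntegrable u volume 0 T) (hW : Continuous W) :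
    AbsolutelyContinuousOnInterval y 0 T := by
  refine absolutelyContinuousOnInterval_of_dist_le
    (absolutelyContinuousOnInterval_integral (h.intervalIntegrable hT hu hW)) 1 fun s hs t ht => ?_
  rw [uIcc_of_le hT] at hs ht
  rw [h.eq_integral s hs, h.eq_integral t ht, dist_add_left, one_mul]

variable [NormedAddCommGroup E] [InnerProductSpace ℝ E] [ProperSpace E]

/-- A closed set is invariant under a control-affine system whose fields are orthogonal, at each
point `p` of the set, to the proximal normals at `p`. -/
theorem SolvesAffine.mem_of_tangent {T : ℝ} {u : ℝ → V} {W : E → V →L[ℝ] E} {K : NNReal}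
    {y₀ : E} {y : ℝ → E} {C : Set E} (h : SolvesAffine T u W y₀ y)
    (hu : IntervalIntegrable u volume 0 T) (hW : LipschitzWith K W)
    (hC : IsClosed C)
    (htan : ∀ x, ∀ p ∈ C, (∀ q ∈ C, dist x p ≤ dist x q) → ∀ c, inner ℝ (x - p) (W p c) = 0)
    (hy₀ : y₀ ∈ C) : ∀ t ∈ Icc 0 T, y t ∈ C := by
  intro t₁ ht₁
  have hT : 0 ≤ T := ht₁.1.trans ht₁.2
  have hCne : C.Nonempty := ⟨y₀, hy₀⟩
  have hyac := h.absolutelyContinuousOnInterval hT hu hW.continuous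
  set D : ℝ → ℝ := fun t => Metric.infDist (y t) C ^ 2 with hD
  have hDcont : ContinuousOn D (Icc 0 T) :=
    ((Metric.continuous_infDist_pt C).comp_continuousOn h.continuousOn).pow 2
  have hDac : AbsolutelyContinuousOnInterval D 0 T := by
    obtain ⟨B, hB⟩ := isCompact_Icc.exists_bound_of_continuousOn
      ((Metric.continuous_infDist_pt C).comp_continuousOn h.continuousOn)
    refine absolutelyContinuousOnInterval_of_dist_le hyac (2 * B) fun s hs t ht => ?_
    rw [uIcc_of_le hT] at hs ht
    have hs' := hB s hs
    have ht' := hB t ht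
    rw [Function.comp_apply, Real.norm_of_nonneg Metric.infDist_nonneg] at hs' ht'
    rw [Real.dist_eq, hD, sq_sub_sq, abs_mul, ← Real.dist_eq]
    have h1 : dist (Metric.infDist (y s) C) (Metric.infDist (y t) C) ≤ dist (y s) (y t) := by
      simpa using (Metric.lipschitz_infDist_pt C).dist_le_mul (y s) (y t)
    refine mul_le_mul ?_ h1 dist_nonneg
      (by linarith [Metric.infDist_nonneg (s := C) (x := y s)])
    rw [abs_of_nonneg (add_nonneg Metric.infDist_nonneg Metric.infDist_nonneg)]
    linarith
  have hL : IntervalIntegrable (fun τ => 2 * (K * ‖u τ‖)) volume 0 T :=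
    (hu.norm.const_mul _).const_mul _
  have hD0 : D 0 = 0 := by
    simp [hD, h.apply_zero hT, Metric.infDist_zero_of_mem hy₀]
  have hder : ∀ᵐ t, t ∈ Ioo 0 T → deriv D t ≤ 2 * (K * ‖u t‖) * D t := by
    filter_upwards [(h.intervalIntegrable hT hu hW.continuous).ae_hasDerivAt_integral,
      hDac.ae_differentiableAt] with t h1 h2 ht
    have htI : t ∈ uIcc 0 T := by rw [uIcc_of_le hT]; exact Ioo_subset_Icc_self ht
    have hnhds : Icc 0 T ∈ 𝓝 t := Icc_mem_nhds ht.1 ht.2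
    have hy' : HasDerivAt y (W (y t) (u t)) t := by
      have h3 := (h1 htI 0 (by simp)).const_add y₀
      refine h3.congr_of_eventuallyEq ?_
      filter_upwards [hnhds] with s hs using h.eq_integral s hs
    have hD' := (h2 htI).hasDerivAt
    obtain ⟨p, hpC, hp⟩ := hC.exists_infDist_eq_dist hCne (y t)
    -- Touching argument: with the nearest point `p` of `y t` frozen, `‖y s - p‖² - D s` is
    -- nonnegative and vanishes at `s = t`. So `D' = 2⟨y - p, W(y) u⟩`, with no differentiability of
    -- the distance function in space.
    have hmin : IsLocalMin (fun s => ‖y s - p‖ ^ 2 - D s) t := by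
      refine Eventually.of_forall fun s => ?_
      have h4 : D t = ‖y t - p‖ ^ 2 := by rw [hD, ← dist_eq_norm, ← hp]
      have h5 : D s ≤ ‖y s - p‖ ^ 2 := by
        rw [← dist_eq_norm]
        exact pow_le_pow_left₀ Metric.infDist_nonneg (Metric.infDist_le_dist_of_mem hpC) 2
      simp only [h4, sub_self]
      linarith
    have h6 := hmin.hasDerivAt_eq_zero ((hy'.sub_const p).norm_sq.sub hD')
    -- Tangency allows `W p` to be subtracted for free, and the Lipschitz bound on `W (y t) - W p`
    -- produces the second factor `‖y t - p‖`.
    have h7 := htan (y t) p hpC (fun q hq => hp ▸ Metric.infDist_le_dist_of_mem hq) (u t)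
    have h8 : inner ℝ (y t - p) (W (y t) (u t)) = inner ℝ (y t - p) ((W (y t) - W p) (u t)) := by
      rw [sub_apply, inner_sub_right, h7, sub_zero]
    have h9 : inner ℝ (y t - p) ((W (y t) - W p) (u t)) ≤ K * ‖u t‖ * D t := by
      have h10 := hW.norm_sub_le (y t) p
      calc _ ≤ ‖y t - p‖ * ‖(W (y t) - W p) (u t)‖ := real_inner_le_norm _ _
        _ ≤ ‖y t - p‖ * (‖W (y t) - W p‖ * ‖u t‖) := by
            gcongr; exact ContinuousLinearMap.le_opNorm _ _
        _ ≤ ‖y t - p‖ * ((K * ‖y t - p‖) * ‖u t‖) := by gcongr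
        _ = K * ‖u t‖ * D t := by
            simp only [hD, hp, dist_eq_norm]; ring
    linarith
  have hgr := gronwall_integral (r := 0) hT hL (fun _ _ => by positivity) hDcont (fun t ht => ?_)
    t₁ ht₁
  · have h1 : D t₁ = 0 := le_antisymm (by simpa using hgr) (sq_nonneg _)
    exact (hC.mem_iff_infDist_zero hCne).mpr (pow_eq_zero_iff two_ne_zero |>.mp h1)
  · have hsub : uIcc 0 t ⊆ uIcc 0 T := by
      rw [uIcc_of_le hT, uIcc_of_le ht.1]; exact Icc_subset_Icc le_rfl ht.2
    have hFTC := (hDac.mono hsub).integral_deriv_eq_sub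
    rw [hD0, sub_zero] at hFTC
    rw [zero_add, ← hFTC]
    refine intervalIntegral.integral_mono_ae_restrict ht.1 (hDac.mono hsub).intervalIntegrable_deriv
      ((hL.mul_continuousOn (by rwa [uIcc_of_le hT])).mono_Icc ht) ?_
    rw [← restrict_Ioo_eq_restrict_Icc]
    filter_upwards [ae_restrict_of_ae hder, ae_restrict_mem measurableSet_Ioo] with τ h1 h2
    exact h1 ⟨h2.1, h2.2.trans_le ht.2⟩

end Invariance

/-! ### Geometry of the boundary -/

section Geometry

theorem eventually_neg_of_hasDerivAt {φ : ℝ → ℝ} {c : ℝ} (h : HasDerivAt φ c 0) (h0 : φ 0 = 0)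
    (hc : c < 0) : ∀ᶠ t in 𝓝[>] 0, φ t < 0 := by
  have h1 := (hasDerivAt_iff_tendsto_slope.mp h).mono_left
    (nhdsWithin_mono 0 (s := Ioi 0) fun t (ht : 0 < t) => ht.ne')
  filter_upwards [h1.eventually (gt_mem_nhds hc), self_mem_nhdsWithin] with t ht ht'
  rw [slope_def_field, h0, sub_zero, sub_zero] at ht
  exact (div_neg_iff.mp ht).resolve_left (fun h => lt_asymm h.2 ht') |>.1

/-- Expand `‖x - p‖² ≤ ‖x - p - t w‖²`, divide by `t` and let `t → 0+`. -/
theorem inner_sub_nonpos_of_nearest {E : Type*} [NormedAddCommGroup E] [InnerProductSpace ℝ E]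
    {C : Set E} {x p w : E} (hp : ∀ q ∈ C, dist x p ≤ dist x q)
    (hw : ∀ᶠ t in 𝓝[>] (0 : ℝ), p + t • w ∈ C) : inner ℝ (x - p) w ≤ 0 := by
  have h1 : Tendsto (fun t : ℝ => t * ‖w‖ ^ 2 / 2) (𝓝[>] 0) (𝓝 0) := by
    have : Continuous fun t : ℝ => t * ‖w‖ ^ 2 / 2 := by fun_prop
    simpa using (this.tendsto 0).mono_left nhdsWithin_le_nhds
  refine ge_of_tendsto h1 ?_
  filter_upwards [hw, self_mem_nhdsWithin] with t ht ht0
  have h2 := pow_le_pow_left₀ dist_nonneg (hp _ ht) 2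
  rw [dist_eq_norm, dist_eq_norm, ← sub_sub, norm_sub_sq_real (x - p), inner_smul_right, norm_smul,
    mul_pow, Real.norm_eq_abs, sq_abs] at h2
  have ht0' : (0 : ℝ) < t := ht0
  have h3 : t * inner ℝ (x - p) w ≤ t * (t * ‖w‖ ^ 2 / 2) := by nlinarith
  exact le_of_mul_le_mul_left h3 ht0'

theorem inner_J_self (x : Plane) : inner ℝ x (J x) = 0 := by
  have h : J x = !₂[-x 1, x 0] := by
    ext i
    rw [J, Matrix.ofLp_toEuclideanCLM]
    fin_cases i <;> simp [Matrix.mulVec, dotProduct, Fin.sum_univ_two]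
  rw [h]
  simp [PiLp.inner_apply, Fin.sum_univ_two]
  ring

variable {Ω : Set Plane}

/-- The normal vector at a boundary point, and the properties of it which are used below. -/
theorem IsBoundedC2Domain.exists_normal (hΩ : IsBoundedC2Domain Ω) {x : Plane}
    (hx : x ∈ frontier Ω) : ∃ n : Plane, n ≠ 0 ∧
      (∀ v, inner ℝ n v < 0 → ∀ᶠ t in 𝓝[>] (0 : ℝ), x + t • v ∈ Ω) ∧
      (∀ v, 0 < inner ℝ n v → ∀ᶠ t in 𝓝[>] (0 : ℝ), x + t • v ∉ closure Ω) ∧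
      (∀ f : Plane → ℝ, ContDiff ℝ 1 f → (∀ q ∈ frontier Ω, f q = 0) →
        ∃ c : ℝ, gradient f x = c • n) := by
  obtain ⟨U, g, hU, hxU, hg, hg', hUΩ⟩ := hΩ.boundary x hx
  have hgat : ∀ q ∈ U, ContDiffAt ℝ 2 g q := fun q hq => hg.contDiffAt (hU.mem_nhds hq)
  have hdiff : ∀ q ∈ U, DifferentiableAt ℝ g q := fun q hq =>
    (hgat q hq).differentiableAt (by norm_num)
  have hmemΩ : ∀ q ∈ U, (q ∈ Ω ↔ g q < 0) := fun q hq => by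
    constructor
    · intro h
      have : q ∈ Ω ∩ U := ⟨h, hq⟩
      rw [hUΩ] at this
      exact this.2
    · intro h
      have : q ∈ {y ∈ U | g y < 0} := ⟨hq, h⟩
      rw [← hUΩ] at this
      exact this.1
  have hpos : ∀ q ∈ U, 0 < g q → q ∉ closure Ω := fun q hq h hcl => by
    have h1 : ∀ᶠ z in 𝓝 q, z ∈ U ∧ 0 < g z :=
      (hU.eventually_mem hq).and ((hdiff q hq).continuousAt.eventually (lt_mem_nhds h))
    obtain ⟨z, hzΩ, hzU, hz⟩ := ((mem_closure_iff_frequently.mp hcl).and_eventually h1).exists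
    exact lt_asymm hz ((hmemΩ z hzU).mp hzΩ)
  have hzero : ∀ q ∈ U, q ∈ frontier Ω → g q = 0 := fun q hq h => by
    rw [hΩ.isOpen.frontier_eq] at h
    refine le_antisymm (not_lt.mp fun h0 => hpos q hq h0 h.1) (not_lt.mp fun h0 =>
      h.2 ((hmemΩ q hq).mpr h0))
  have hline : ∀ q ∈ U, ∀ v, ∀ᶠ t in 𝓝[>] (0 : ℝ), q + t • v ∈ U := fun q hq v => by
    have : Continuous fun t : ℝ => q + t • v := by fun_prop
    refine (this.tendsto 0).eventually (hU.eventually_mem (by simpa using hq)) |>.filter_mono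
      nhdsWithin_le_nhds
  have hlinederiv : ∀ q ∈ U, ∀ v, HasDerivAt (fun t : ℝ => g (q + t • v)) (fderiv ℝ g q v) 0 :=
    fun q hq v => by
      have h1 : HasDerivAt (fun t : ℝ => q + t • v) v 0 := by
        simpa using ((hasDerivAt_id (0 : ℝ)).smul_const v).const_add q
      have h2 : HasFDerivAt g (fderiv ℝ g q) (q + (0 : ℝ) • v) := by
        simpa using (hdiff q hq).hasFDerivAt
      exact h2.comp_hasDerivAt (0 : ℝ) h1
  have hneg : ∀ q ∈ U, g q = 0 → ∀ v, fderiv ℝ g q v < 0 →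
      ∀ᶠ t in 𝓝[>] (0 : ℝ), q + t • v ∈ Ω := fun q hq hq0 v hv => by
    filter_upwards [hline q hq v, eventually_neg_of_hasDerivAt (hlinederiv q hq v)
      (by simpa using hq0) hv] with t h1 h2 using (hmemΩ _ h1).mpr h2
  -- As `dg ≠ 0`, some direction decreases `g` and so enters `Ω`. Hence the zero level of `g` in `U`
  -- consists of boundary points, which the Lagrange multiplier argument below requires.
  have hfr : ∀ q ∈ U, g q = 0 → q ∈ frontier Ω := fun q hq hq0 => by
    rw [hΩ.isOpen.frontier_eq]
    refine ⟨?_, fun h => ((hmemΩ q hq).mp h).ne hq0⟩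
    obtain ⟨v, hv⟩ : ∃ v, fderiv ℝ g q v < 0 := by
      obtain ⟨v, hv⟩ := DFunLike.ne_iff.mp (hg' q hq)
      rcases lt_or_gt_of_ne hv with h | h
      · exact ⟨v, h⟩
      · exact ⟨-v, by simpa using h⟩
    have h1 : Tendsto (fun t : ℝ => q + t • v) (𝓝[>] 0) (𝓝 q) := by
      have : Continuous fun t : ℝ => q + t • v := by fun_prop
      simpa using (this.tendsto 0).mono_left nhdsWithin_le_nhds
    exact mem_closure_of_tendsto h1 (hneg q hq hq0 v hv)
  have hx0 := hzero x hxU hx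
  have hinner : ∀ v, inner ℝ (gradient g x) v = fderiv ℝ g x v := fun v => by
    simp [gradient]
  refine ⟨gradient g x, ?_, fun v hv => hneg x hxU hx0 v (hinner v ▸ hv), fun v hv => ?_,
    fun f hf hf0 => ?_⟩
  · simpa [gradient] using hg' x hxU
  · rw [hinner] at hv
    have h1 : HasDerivAt (fun t : ℝ => -g (x + t • v)) (-fderiv ℝ g x v) 0 :=
      (hlinederiv x hxU v).neg
    filter_upwards [hline x hxU v, eventually_neg_of_hasDerivAt h1
      (by simpa using hx0) (by linarith)] with t h2 h3
    exact hpos _ h2 (by linarith)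
  -- Near `x` the function `f` vanishes on the level set of `g`, so `x` is a constrained extremum
  -- and `∇f` is a multiple of `∇g`. The multiplier of `f` cannot be zero because `dg ≠ 0`.
  · have hext : IsLocalExtrOn f {z | g z = g x} x := by
      left
      have : ∀ᶠ z in 𝓝[{z | g z = g x}] x, f x ≤ f z := by
        filter_upwards [self_mem_nhdsWithin, mem_nhdsWithin_of_mem_nhds (hU.mem_nhds hxU)]
          with z hz hzU
        rw [hf0 x hx, hf0 z (hfr z hzU (by rw [← hx0]; exact hz))]
      exact this
    obtain ⟨a, b, hab, h⟩ := hext.exists_multipliers_of_hasStrictFDerivAt_1d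
      ((hgat x hxU).hasStrictFDerivAt (by norm_num))
      (hf.contDiffAt.hasStrictFDerivAt (by norm_num))
    have hb : b ≠ 0 := by
      rintro rfl
      have ha : a ≠ 0 := by rintro rfl; exact hab rfl
      rw [zero_smul, add_zero, smul_eq_zero] at h
      exact h.elim ha (hg' x hxU)
    refine ⟨-(b⁻¹ * a), ?_⟩
    have h1 : fderiv ℝ f x = -(b⁻¹ * a) • fderiv ℝ g x := by
      rw [neg_smul, mul_smul, eq_neg_of_add_eq_zero_left h, smul_neg, neg_neg, smul_smul,
        inv_mul_cancel₀ hb, one_smul]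
    simp [gradient, h1]

/-- At a boundary point the tangent cone contains the open half-plane of directions entering `Ω`,
and an open set spans. Consequently derivatives within `closure Ω` are those of any smooth
extension, even on the boundary. -/
theorem IsBoundedC2Domain.uniqueDiffOn (hΩ : IsBoundedC2Domain Ω) :
    UniqueDiffOn ℝ (closure Ω) := by
  intro x hx
  by_cases hxΩ : x ∈ Ω
  · exact (hΩ.isOpen.uniqueDiffWithinAt hxΩ).mono subset_closure
  · obtain ⟨n, hn, hin, -, -⟩ := hΩ.exists_normal (x := x)
      (by rw [hΩ.isOpen.frontier_eq]; exact ⟨hx, hxΩ⟩)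
    refine ⟨?_, subset_closure hx⟩
    have hsub : {v : Plane | inner ℝ n v < 0} ⊆ tangentConeAt ℝ (closure Ω) x := fun v hv => by
      have h0 : Tendsto (fun t : ℝ => t • v) (𝓝[>] 0) (𝓝 0) := by
        have : Continuous fun t : ℝ => t • v := by fun_prop
        simpa using (this.tendsto 0).mono_left nhdsWithin_le_nhds
      refine mem_tangentConeAt_of_seq (𝓝[>] (0 : ℝ)) (fun t => t⁻¹) (fun t => t • v) h0
        ((hin v hv).mono fun t ht => subset_closure ht) ?_
      refine tendsto_const_nhds.congr' ?_
      filter_upwards [self_mem_nhdsWithin] with t ht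
      rw [smul_smul, inv_mul_cancel₀ (ne_of_gt ht), one_smul]
    have hopen : IsOpen {v : Plane | inner ℝ n v < 0} :=
      isOpen_lt (by fun_prop) continuous_const
    have htop : Submodule.span ℝ (tangentConeAt ℝ (closure Ω) x) = ⊤ := by
      refine Submodule.eq_top_of_nonempty_interior' _ ⟨-n, ?_⟩
      refine interior_mono (hsub.trans Submodule.subset_span) ?_
      rw [hopen.interior_eq]
      have := norm_pos_iff.mpr hn
      simpa using by positivity
    rw [htop]
    exact dense_univ

/-- If `f` vanishes on the boundary, then `J∇f` is orthogonal to all proximal normals. -/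
theorem IsBoundedC2Domain.inner_J_gradient_eq_zero (hΩ : IsBoundedC2Domain Ω) {f : Plane → ℝ}
    (hf : ContDiff ℝ 1 f) (hf0 : ∀ q ∈ frontier Ω, f q = 0) {x p : Plane} (hpΩ : p ∈ closure Ω)
    (hp : ∀ q ∈ closure Ω, dist x p ≤ dist x q) : inner ℝ (x - p) (J (gradient f p)) = 0 := by
  have key : ∀ v, (∀ᶠ t in 𝓝[>] (0 : ℝ), p + t • v ∈ Ω) → inner ℝ (x - p) v ≤ 0 := fun v hv =>
    inner_sub_nonpos_of_nearest hp (hv.mono fun t ht => subset_closure ht)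
  by_cases hpo : p ∈ Ω
  · have h : ∀ v : Plane, inner ℝ (x - p) v ≤ 0 := fun v => by
      refine key v ?_
      have : Continuous fun t : ℝ => p + t • v := by fun_prop
      exact (this.tendsto 0).eventually (hΩ.isOpen.eventually_mem (by simpa using hpo))
        |>.filter_mono nhdsWithin_le_nhds
    have h1 := h (-J (gradient f p))
    rw [inner_neg_right] at h1
    exact le_antisymm (h _) (by linarith)
  · obtain ⟨n, hn, hin, -, hgrad⟩ := hΩ.exists_normal (x := p)
      (by rw [hΩ.isOpen.frontier_eq]; exact ⟨hpΩ, hpo⟩)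
    obtain ⟨c, hc⟩ := hgrad f hf hf0
    -- A tangential `v` need not point into `Ω`, but `v - δ n` does for every `δ > 0`; then `δ → 0`.
    -- Applying this to both signs of `J∇f`, which is orthogonal to `n`, gives equality.
    have h : ∀ v : Plane, inner ℝ n v = 0 → inner ℝ (x - p) v ≤ 0 := fun v hv => by
      have h1 : Tendsto (fun δ : ℝ => δ * inner ℝ (x - p) n) (𝓝[>] 0) (𝓝 0) := by
        have : Continuous fun δ : ℝ => δ * inner ℝ (x - p) n := by fun_prop
        simpa using (this.tendsto 0).mono_left nhdsWithin_le_nhds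
      refine ge_of_tendsto h1 ?_
      filter_upwards [self_mem_nhdsWithin] with δ hδ
      have hδ' : (0 : ℝ) < δ := hδ
      have h2 := key (v - δ • n) (hin _ (by
        rw [inner_sub_right, hv, inner_smul_right, real_inner_self_eq_norm_sq, zero_sub]
        have := norm_pos_iff.mpr hn
        have : 0 < δ * ‖n‖ ^ 2 := by positivity
        linarith))
      rw [inner_sub_right, inner_smul_right] at h2
      linarith
    have h0 : inner ℝ n (J (gradient f p)) = 0 := by
      rw [hc, map_smul, inner_smul_right, inner_J_self, mul_zero]
    have h1 := h (-J (gradient f p)) (by rw [inner_neg_right, h0, neg_zero])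
    rw [inner_neg_right] at h1
    exact le_antisymm (h _ h0) (by linarith)

end Geometry

/-! ### Weak derivatives -/

section Calculus

variable {E F : Type*} [NormedAddCommGroup E] [NormedSpace ℝ E]
  [NormedAddCommGroup F] [NormedSpace ℝ F]

theorem contDiff_iteratedFDeriv_apply {f : E → F} (hf : ContDiff ℝ ∞ f) {k : ℕ} (v : Fin k → E) :
    ContDiff ℝ ∞ (fun x => iteratedFDeriv ℝ k f x v) :=
  (ContinuousMultilinearMap.apply ℝ (fun _ : Fin k => E) F v).contDiff.comp
    (hf.iteratedFDeriv_right (by norm_cast))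

theorem iteratedFDeriv_fderiv_apply {f : E → F} (hf : ContDiff ℝ ∞ f) (k : ℕ) (x w : E)
    (m : Fin k → E) :
    iteratedFDeriv ℝ k (fun y => fderiv ℝ f y w) x m =
      iteratedFDeriv ℝ k (fun y => fderiv ℝ f y) x m w := by
  have h1 : ContDiff ℝ ∞ (fun y => fderiv ℝ f y) := hf.fderiv_right (by simp)
  have h2 := (ContinuousLinearMap.apply ℝ F w).iteratedFDeriv_comp_left (x := x) (i := k)
    h1.contDiffAt (by exact_mod_cast le_top)
  have h3 : (ContinuousLinearMap.apply ℝ F w ∘ fun y => fderiv ℝ f y) =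
    fun y => fderiv ℝ f y w := rfl
  rw [h3] at h2
  rw [h2]
  rfl

theorem IsTestFunction.iteratedFDeriv_apply {E : Type} [NormedAddCommGroup E]
    [NormedSpace ℝ E] {Ω : Set E} {φ : E → ℝ} (h : IsTestFunction Ω φ)
    {k : ℕ} (v : Fin k → E) : IsTestFunction Ω (fun x => iteratedFDeriv ℝ k φ x v) := by
  have hsub : Function.support (fun x => iteratedFDeriv ℝ k φ x v) ⊆ tsupport φ := fun x hx => by
    by_contra hx'
    have : iteratedFDeriv ℝ k φ x = 0 :=
      image_eq_zero_of_notMem_tsupport fun h => hx' (tsupport_iteratedFDeriv_subset k h)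
    exact hx (by simp [this])
  exact ⟨contDiff_iteratedFDeriv_apply h.1 v, h.2.1.mono' hsub,
    (closure_minimal hsub (isClosed_tsupport φ)).trans h.2.2⟩

end Calculus

section WeakDeriv

variable {E F : Type} [NormedAddCommGroup E] [NormedSpace ℝ E] [MeasureSpace E]
  [NormedAddCommGroup F] [NormedSpace ℝ F]

theorem setIntegral_smul_testFunction {Ω : Set E} {f : E → F} {φ : E → ℝ}
    (hφ : IsTestFunction Ω φ) : ∫ x in Ω, φ x • f x = ∫ x, φ x • f x := by
  refine setIntegral_eq_integral_of_forall_compl_eq_zero fun x hx => ?_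
  rw [image_eq_zero_of_notMem_tsupport fun h => hx (hφ.2.2 h), zero_smul]

variable [BorelSpace E]

theorem LocallyIntegrableOn.integrable_smul_testFunction {Ω : Set E} {f : E → F}
    (hf : LocallyIntegrableOn f Ω volume) {φ : E → ℝ} (hφ : IsTestFunction Ω φ) :
    Integrable (fun x => φ x • f x) volume := by
  have hK : IsCompact (tsupport φ) := hφ.2.1
  have h1 : IntegrableOn (fun x => φ x • f x) (tsupport φ) volume :=
    (hf.integrableOn_compact_subset hφ.2.2 hK).continuousOn_smul hφ.1.continuous.continuousOn hK
  refine (integrableOn_iff_integrable_of_support_subset ?_).mp h1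
  exact (Function.support_smul_subset_left _ _).trans (subset_tsupport φ)

variable [FiniteDimensional ℝ E]

/-- The fundamental lemma of the calculus of variations, applied to `g - g'`. -/
theorem HasWeakDeriv.ae_eq [CompleteSpace F] {Ω : Set E} (hΩ : IsOpen Ω) {k : ℕ} {v : Fin k → E}
    {f g g' : E → F} (h : HasWeakDeriv Ω v f g) (h' : HasWeakDeriv Ω v f g') :
    g =ᵐ[volume.restrict Ω] g' := by
  have hsub : LocallyIntegrableOn (fun x => g x - g' x) Ω volume := h.2.1.sub h'.2.1
  have hae := hΩ.ae_eq_zero_of_integral_contDiff_smul_eq_zero hsub fun φ h1 h2 h3 => by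
    have hφ : IsTestFunction Ω φ := ⟨h1, h2, h3⟩
    have h4 := (h.2.2 φ hφ).symm.trans (h'.2.2 φ hφ)
    have h5 : ((-1 : ℝ) ^ k) ≠ 0 := pow_ne_zero _ (by norm_num)
    have h6 := smul_right_injective F h5 h4
    rw [setIntegral_smul_testFunction hφ, setIntegral_smul_testFunction hφ] at h6
    simp only [smul_sub]
    rw [integral_sub (LocallyIntegrableOn.integrable_smul_testFunction h.2.1 hφ)
      (LocallyIntegrableOn.integrable_smul_testFunction h'.2.1 hφ), h6, sub_self]
  rw [Filter.EventuallyEq, ae_restrict_iff' hΩ.measurableSet]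
  filter_upwards [hae] with x hx hxΩ using sub_eq_zero.mp (hx hxΩ)

variable [(volume : Measure E).IsAddHaarMeasure]

/-- Repeated integration by parts. -/
theorem integral_iteratedFDeriv_smul {φ : E → ℝ} (hφ : ContDiff ℝ ∞ φ) (hφc : HasCompactSupport φ)
    {k : ℕ} (v : Fin k → E) {f : E → F} (hf : ContDiff ℝ ∞ f) :
    ∫ x, iteratedFDeriv ℝ k φ x v • f x =
      (-1 : ℝ) ^ k • ∫ x, φ x • iteratedFDeriv ℝ k f x (v ∘ Fin.rev) := by
  induction k generalizing f with
  | zero => simp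
  | succ k ih =>
    have hint : ∀ {φ : E → ℝ} {f : E → F}, Continuous φ → HasCompactSupport φ → Continuous f →
        Integrable (fun x => φ x • f x) volume := fun h1 h2 h3 =>
      (h1.smul h3).integrable_of_hasCompactSupport h2.smul_right
    -- The outermost direction `v 0` is the first to move onto `f`, where it ends up innermost. This
    -- is the origin of `Fin.rev`, and no symmetry of higher derivatives is needed.
    set Ψ : E → ℝ := fun x => iteratedFDeriv ℝ k φ x (Fin.tail v) with hΨ
    have hΨt : IsTestFunction univ Ψ :=
      IsTestFunction.iteratedFDeriv_apply ⟨hφ, hφc, subset_univ _⟩ _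
    have hf' : ContDiff ℝ ∞ (fun y => fderiv ℝ f y (v 0)) :=
      (hf.fderiv_right (m := ∞) (by simp)).clm_apply contDiff_const
    have h1 : ∀ x, iteratedFDeriv ℝ (k + 1) φ x v = fderiv ℝ Ψ x (v 0) := fun x => by
      rw [iteratedFDeriv_succ_apply_left, hΨ, fderiv_continuousMultilinear_apply_const_apply]
      exact ((hφ.iteratedFDeriv_right (m := ∞) (i := k) (by norm_cast)).differentiable
        (by simp)).differentiableAt
    have hΨd : Continuous (fun x => fderiv ℝ Ψ x (v 0)) :=
      ((hΨt.1.fderiv_right (m := ∞) (by simp)).clm_apply contDiff_const).continuous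
    have hΨdc : HasCompactSupport (fun x => fderiv ℝ Ψ x (v 0)) :=
      (hΨt.2.1.fderiv_apply ℝ (v 0))
    have h2 := integral_smul_fderiv_eq_neg_fderiv_smul_of_integrable (μ := volume) (f := Ψ) (g := f)
      (v := v 0) (hint hΨd hΨdc hf.continuous) (hint hΨt.1.continuous hΨt.2.1 hf'.continuous)
      (hint hΨt.1.continuous hΨt.2.1 hf.continuous)
      (fun x _ => (hΨt.1.differentiable (by simp)).differentiableAt)
      (fun x _ => (hf.differentiable (by simp)).differentiableAt)
    have h3 := ih (Fin.tail v) hf'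
    simp only [h1]
    rw [← neg_eq_iff_eq_neg.mpr h2, h3, pow_succ, mul_neg_one, neg_smul]
    congr 3
    ext x
    rw [iteratedFDeriv_succ_apply_right, iteratedFDeriv_fderiv_apply hf]
    congr 2
    · congr 1
      ext i
      simp [Fin.init, Fin.tail, Fin.rev_castSucc]
    · simp

theorem hasWeakDeriv_of_contDiff {Ω : Set E} (hΩ : IsOpen Ω) {f g : E → F} (hg : ContDiff ℝ ∞ g)
    (hfg : EqOn f g Ω) {k : ℕ} (v : Fin k → E) :
    HasWeakDeriv Ω v f (fun x => iteratedFDeriv ℝ k g x (v ∘ Fin.rev)) := by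
  have hgk : Continuous (fun x => iteratedFDeriv ℝ k g x (v ∘ Fin.rev)) :=
    (contDiff_iteratedFDeriv_apply hg _).continuous
  refine ⟨?_, hgk.locallyIntegrable.locallyIntegrableOn _, fun φ hφ => ?_⟩
  · refine (hg.continuous.locallyIntegrable.locallyIntegrableOn Ω).congr ?_
    exact (ae_restrict_mem hΩ.measurableSet).mono fun x hx => (hfg hx).symm
  · rw [setIntegral_congr_fun hΩ.measurableSet
      (g := fun x => iteratedFDeriv ℝ k φ x v • g x) (fun x hx => by simp only [hfg hx]),
      setIntegral_smul_testFunction (hφ.iteratedFDeriv_apply v), setIntegral_smul_testFunction hφ]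
    exact integral_iteratedFDeriv_smul hφ.1 hφ.2.1 v hg

end WeakDeriv

/-! ### Sobolev norms of smooth functions -/

section SobolevSmooth

variable {E F : Type} [NormedAddCommGroup E] [NormedSpace ℝ E] [MeasureSpace E]
  [NormedAddCommGroup F] [NormedSpace ℝ F] [BorelSpace E] [FiniteDimensional ℝ E]
  [(volume : Measure E).IsAddHaarMeasure] {Ω : Set E}

/-- By almost everywhere uniqueness, all weak derivatives in the infimum have the same `L^p` norm as
the classical one. -/
theorem eLpNorm_iteratedFDeriv_le_eSobolevNorm [CompleteSpace F] (hΩ : IsOpen Ω) {f g : E → F}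
    (hg : ContDiff ℝ ∞ g) (hfg : EqOn f g Ω) {k m : ℕ} (hk : k ≤ m) (p : ℝ≥0∞) (v : Fin k → E)
    (hv : ∀ i, ‖v i‖ ≤ 1) :
    eLpNorm (fun x => iteratedFDeriv ℝ k g x (v ∘ Fin.rev)) p (volume.restrict Ω) ≤
      eSobolevNorm Ω m p f := by
  refine le_trans ?_ (le_iSup₂_of_le k hk (le_iSup₂_of_le v hv le_rfl))
  refine le_iInf₂ fun g' hg' => ?_
  rw [eLpNorm_congr_ae (HasWeakDeriv.ae_eq hΩ (hasWeakDeriv_of_contDiff hΩ hg hfg v) hg')]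

theorem eSobolevNorm_top_le (hΩ : IsOpen Ω) {f g : E → F} (hg : ContDiff ℝ ∞ g)
    (hfg : EqOn f g Ω) {m : ℕ} {C : ℝ}
    (hC : ∀ k ≤ m, ∀ x ∈ Ω, ‖iteratedFDeriv ℝ k g x‖ ≤ C) :
    eSobolevNorm Ω m ⊤ f ≤ ENNReal.ofReal C := by
  refine iSup₂_le fun k hk => iSup₂_le fun v hv => ?_
  refine iInf₂_le_of_le _ (hasWeakDeriv_of_contDiff hΩ hg hfg v) ?_
  rw [eLpNorm_exponent_top]
  refine eLpNormEssSup_le_of_ae_bound ?_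
  filter_upwards [ae_restrict_mem hΩ.measurableSet] with x hx
  refine ((iteratedFDeriv ℝ k g x).le_opNorm _).trans ?_
  calc _ ≤ ‖iteratedFDeriv ℝ k g x‖ * 1 := by
        gcongr
        exact Finset.prod_le_one (fun _ _ => norm_nonneg _) fun i _ => hv _
    _ ≤ C := by rw [mul_one]; exact hC k hk x hx

/-- On a bounded open set, the `W^{m,∞}` norm of a linear combination of smooth functions is
controlled by the coefficients. -/
theorem exists_eSobolevNorm_sum_le (hΩ : IsOpen Ω) (hΩb : Bornology.IsBounded Ω) {N : ℕ}
    {G : Fin N → E → F} (hG : ∀ i, ContDiff ℝ ∞ (G i)) (m : ℕ) :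
    ∃ C : ℝ, ∀ (c : EuclideanSpace ℝ (Fin N)) (f : E → F),
      EqOn f (fun x => ∑ i, c i • G i x) Ω →
      eSobolevNorm Ω m ⊤ f ≤ ENNReal.ofReal (C * ‖c‖) := by
  have hK : IsCompact (closure Ω) := hΩb.isCompact_closure
  have hbd : ∀ (i : Fin N) (k : ℕ), ∃ B : ℝ, 0 ≤ B ∧
      ∀ x ∈ Ω, ‖iteratedFDeriv ℝ k (G i) x‖ ≤ B := fun i k => by
    obtain ⟨B, hB⟩ := hK.exists_bound_of_continuousOn
      ((hG i).continuous_iteratedFDeriv (m := k) (by exact_mod_cast le_top)).continuousOn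
    exact ⟨max B 0, le_max_right _ _, fun x hx =>
      (hB x (subset_closure hx)).trans (le_max_left _ _)⟩
  choose B hB0 hB using hbd
  refine ⟨∑ i, ∑ k ∈ Finset.range (m + 1), B i k, fun c f hf => ?_⟩
  refine eSobolevNorm_top_le hΩ (ContDiff.sum fun i _ => (hG i).const_smul (c i)) hf
    fun k hk x hx => ?_
  have h1 : iteratedFDeriv ℝ k (fun x => ∑ i, c i • G i x) x =
      ∑ i, c i • iteratedFDeriv ℝ k (G i) x := by
    rw [iteratedFDeriv_fun_sum_apply fun i _ =>
      (((hG i).const_smul (c i)).of_le (by exact_mod_cast le_top)).contDiffAt]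
    refine Finset.sum_congr rfl fun i _ => ?_
    exact iteratedFDeriv_const_smul_apply ((hG i).of_le (by exact_mod_cast le_top)).contDiffAt
  rw [h1, Finset.sum_mul]
  refine (norm_sum_le _ _).trans (Finset.sum_le_sum fun i _ => ?_)
  rw [norm_smul, mul_comm]
  refine mul_le_mul ?_ (PiLp.norm_apply_le c i) (norm_nonneg _)
    (Finset.sum_nonneg fun k _ => hB0 i k)
  exact (hB i k x hx).trans (Finset.single_le_sum (f := fun k => B i k) (fun k _ => hB0 i k)
    (Finset.mem_range.mpr (by omega)))

/-- Time-dependent linear combinations of smooth functions with coefficients in `L²(0,T)` belong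
to `L²(0,T;W^{m,∞}(Ω))`. -/
theorem memL2Sobolev_sum (hΩ : IsOpen Ω) (hΩb : Bornology.IsBounded Ω) {T : ℝ} {N : ℕ}
    {G : Fin N → E → F} (hG : ∀ i, ContDiff ℝ ∞ (G i)) (m : ℕ) (u : Control T N)
    {ψ : ℝ → E → F} (hψ : ∀ t, EqOn (ψ t) (fun x => ∑ i, u t i • G i x) Ω) :
    MemL2Sobolev T Ω m ψ := by
  obtain ⟨C, hC⟩ := exists_eSobolevNorm_sum_le hΩ hΩb hG m
  have hu := Lp.stronglyMeasurable u
  -- Simple approximations of `u` are pushed through the linear map `c ↦ ∑ cᵢ Gᵢ`; the `W^{m,∞}`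
  -- error is then at most a constant times the error in `u`.
  refine ⟨⟨fun n => (hu.approx n).map (fun c x => ∑ i, c i • G i x), fun n t => ?_,
    Eventually.of_forall fun t => ?_⟩, ?_⟩
  · exact (hC (hu.approx n t) _ fun x _ => rfl).trans_lt ENNReal.ofReal_lt_top
  · have h1 : Tendsto (fun n => ENNReal.ofReal (C * ‖u t - hu.approx n t‖)) atTop (𝓝 0) := by
      have h2 := (tendsto_iff_norm_sub_tendsto_zero.mp (hu.tendsto_approx t)).const_mul C
      rw [mul_zero] at h2
      simpa [norm_sub_rev] using ENNReal.tendsto_ofReal h2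
    refine tendsto_of_tendsto_of_tendsto_of_le_of_le tendsto_const_nhds h1 (fun _ => zero_le)
      fun n => hC (u t - hu.approx n t) _ fun x hx => ?_
    simp only [Pi.sub_apply, SimpleFunc.map_apply, hψ t hx, ← Finset.sum_sub_distrib, ← sub_smul,
      PiLp.sub_apply]
  · have h1 : Integrable (fun t => (C * ‖u t‖) ^ 2) (volume.restrict (Ioo 0 T)) :=
      ((Lp.memLp u).norm.const_mul C).integrable_sq
    refine lt_of_le_of_lt (lintegral_mono fun t => ?_) h1.lintegral_lt_top
    calc eSobolevNorm Ω m ⊤ (ψ t) ^ 2 ≤ ENNReal.ofReal (C * ‖u t‖) ^ 2 := by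
          gcongr; exact hC (u t) _ (hψ t)
      _ ≤ ENNReal.ofReal |C * ‖u t‖| ^ 2 := by gcongr; exact le_abs_self _
      _ = _ := by rw [← ENNReal.ofReal_pow (abs_nonneg _), sq_abs]

end SobolevSmooth

/-! ### Functions of `H_0^1` which are smooth up to the boundary vanish on the boundary -/

section Trace

variable {Ω : Set Plane} {h g : Plane → ℝ}

theorem enorm_integral_mul_le {α : Type*} [MeasurableSpace α] {μ : Measure α} {f g : α → ℝ}
    (hf : AEStronglyMeasurable f μ) (hg : AEStronglyMeasurable g μ) :
    ‖∫ x, f x * g x ∂μ‖ₑ ≤ eLpNorm f 2 μ * eLpNorm g 2 μ := by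
  refine (enorm_integral_le_lintegral_enorm _).trans ?_
  rw [← eLpNorm_one_eq_lintegral_enorm]
  have h : eLpNorm (f • g) 1 μ ≤ eLpNorm f 2 μ * eLpNorm g 2 μ :=
    eLpNorm_smul_le_mul_eLpNorm hg hf
  exact h

/-- Integration by parts for functions of `H_0^1`, without boundary term. -/
theorem MemH10.integral_fderiv_eq_zero (hΩ : IsOpen Ω) (hh : MemH10 Ω h)
    (hg : IsSmoothExtension Ω h g) {f : Plane → ℝ} (hf : ContDiff ℝ ∞ f)
    (hfc : HasCompactSupport f) (e : Plane) (he : ‖e‖ ≤ 1) :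
    ∫ x in Ω, (g x * fderiv ℝ f x e + fderiv ℝ g x e * f x) = 0 := by
  obtain ⟨-, φ, hφ, hlim⟩ := hh
  have hf' : ContDiff ℝ ∞ (fun x => fderiv ℝ f x e) :=
    (hf.fderiv_right (m := ∞) (by simp)).clm_apply contDiff_const
  have hf'c : HasCompactSupport (fun x => fderiv ℝ f x e) := hfc.fderiv_apply ℝ e
  have hC : ∀ {η : Plane → ℝ}, ContDiff ℝ ∞ η → HasCompactSupport η →
      eLpNorm η 2 (volume.restrict Ω) < ⊤ := fun h1 h2 =>
    ((h1.continuous.memLp_of_hasCompactSupport h2).restrict Ω).eLpNorm_lt_top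
  have hint : ∀ {f₁ f₂ : Plane → ℝ}, Continuous f₁ → Continuous f₂ → HasCompactSupport f₂ →
      Integrable (fun x => f₁ x * f₂ x) volume := fun h1 h2 h3 =>
    (h1.mul h2).integrable_of_hasCompactSupport h3.mul_left
  have hder : ∀ {η : Plane → ℝ}, ContDiff ℝ ∞ η → Continuous (fun x => fderiv ℝ η x e) :=
    fun h1 => ((h1.fderiv_right (m := ∞) (by simp)).clm_apply contDiff_const).continuous
  -- The integral vanishes when `g` is replaced by the test function `φ n`. It therefore equals the
  -- same integral for `g - φ n`, which Cauchy–Schwarz bounds by the `H^1` distance.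
  have hbound : ∀ n, ‖∫ x in Ω, (g x * fderiv ℝ f x e + fderiv ℝ g x e * f x)‖ₑ ≤
      eSobolevNorm Ω 1 2 (h - φ n) * (eLpNorm (fun x => fderiv ℝ f x e) 2 (volume.restrict Ω) +
        eLpNorm f 2 (volume.restrict Ω)) := fun n => by
    set d : Plane → ℝ := g - φ n with hd
    have hdsm : ContDiff ℝ ∞ d := hg.1.sub (hφ n).1
    have heq : EqOn (h - φ n) d Ω := fun x hx => by
      simp [hd, hg.2 (subset_closure hx)]
    have h0 := eLpNorm_iteratedFDeriv_le_eSobolevNorm hΩ hdsm heq (m := 1) (Nat.zero_le 1) 2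
      (fun _ => 0) (by simp)
    have h1 := eLpNorm_iteratedFDeriv_le_eSobolevNorm hΩ hdsm heq (m := 1) le_rfl 2
      (fun _ => e) (fun _ => he)
    simp only [iteratedFDeriv_zero_apply] at h0
    simp only [iteratedFDeriv_one_apply, Function.comp_apply] at h1
    have hzero : ∫ x in Ω, (φ n x * fderiv ℝ f x e + fderiv ℝ (φ n) x e * f x) = 0 := by
      rw [setIntegral_eq_integral_of_forall_compl_eq_zero fun x hx => ?_, integral_add
        (by simpa only [mul_comm] using hint hf'.continuous (hφ n).1.continuous (hφ n).2.1)
        (hint (hder (hφ n).1) hf.continuous hfc)]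
      · have h2 := integral_mul_fderiv_eq_neg_fderiv_mul_of_integrable (μ := volume) (f := φ n)
          (g := f) (v := e) (hint (hder (hφ n).1) hf.continuous hfc)
          (hint (hφ n).1.continuous hf'.continuous hf'c)
          (hint (hφ n).1.continuous hf.continuous hfc)
          (fun x _ => ((hφ n).1.differentiable (by simp)).differentiableAt)
          (fun x _ => (hf.differentiable (by simp)).differentiableAt)
        rw [h2, neg_add_cancel]
      · have hx' : x ∉ tsupport (φ n) := fun h => hx ((hφ n).2.2 h)
        have h3 : fderiv ℝ (φ n) x = 0 :=
          image_eq_zero_of_notMem_tsupport fun h => hx' (tsupport_fderiv_subset ℝ h)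
        simp [image_eq_zero_of_notMem_tsupport hx', h3]
    have hsplit : ∫ x in Ω, (g x * fderiv ℝ f x e + fderiv ℝ g x e * f x) =
        (∫ x in Ω, d x * fderiv ℝ f x e) + ∫ x in Ω, fderiv ℝ d x e * f x := by
      have hφint : IntegrableOn
          (fun x => φ n x * fderiv ℝ f x e + fderiv ℝ (φ n) x e * f x) Ω volume :=
        ((hint (hφ n).1.continuous hf'.continuous hf'c).add
          (hint (hder (hφ n).1) hf.continuous hfc)).integrableOn
      have hgint : IntegrableOn
          (fun x => g x * fderiv ℝ f x e + fderiv ℝ g x e * f x) Ω volume :=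
        ((hint hg.1.continuous hf'.continuous hf'c).add
          (hint (hder hg.1) hf.continuous hfc)).integrableOn
      rw [← integral_add (hint hdsm.continuous hf'.continuous hf'c).integrableOn
        (hint (hder hdsm) hf.continuous hfc).integrableOn, ← sub_zero (∫ x in Ω, _), ← hzero,
        ← integral_sub hgint hφint]
      refine integral_congr_ae (Eventually.of_forall fun x => ?_)
      have h4 : fderiv ℝ d x = fderiv ℝ g x - fderiv ℝ (φ n) x :=
        fderiv_sub (hg.1.differentiable (by simp)).differentiableAt
          ((hφ n).1.differentiable (by simp)).differentiableAt
      beta_reduce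
      rw [h4, sub_apply, hd, Pi.sub_apply]
      ring
    rw [hsplit, mul_add]
    refine (enorm_add_le _ _).trans (add_le_add ?_ ?_)
    · refine (enorm_integral_mul_le hdsm.continuous.aestronglyMeasurable
        hf'.continuous.aestronglyMeasurable).trans ?_
      gcongr
    · refine (enorm_integral_mul_le (hder hdsm).aestronglyMeasurable
        hf.continuous.aestronglyMeasurable).trans ?_
      gcongr
  have hlim' := ENNReal.Tendsto.mul_const (b := eLpNorm (fun x => fderiv ℝ f x e) 2
    (volume.restrict Ω) + eLpNorm f 2 (volume.restrict Ω)) hlim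
    (Or.inr (ENNReal.add_ne_top.mpr ⟨(hC hf' hf'c).ne, (hC hf hfc).ne⟩))
  rw [zero_mul] at hlim'
  have := ge_of_tendsto' hlim' hbound
  simpa using this

/-- If all integrals `∫_Ω ∂_e f` vanish for smooth `f` with compact support in a convex open set,
then this set cannot meet both `Ω` and the exterior of `Ω`. -/
theorem exists_integral_fderiv_ne_zero (hΩ : IsOpen Ω) (hΩb : Bornology.IsBounded Ω) {B : Set Plane}
    (hB : IsOpen B) (hBc : Convex ℝ B) {p q : Plane} (hpB : p ∈ B) (hqB : q ∈ B) (hp : p ∈ Ω)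
    (hq : q ∉ closure Ω) :
    ∃ f : Plane → ℝ, ContDiff ℝ ∞ f ∧ HasCompactSupport f ∧ tsupport f ⊆ B ∧
      ∫ x in Ω, fderiv ℝ f x (q - p) ≠ 0 := by
  -- Slide a bump `f` from `p` to `q` along `w = q - p`. By convexity its translates stay supported
  -- in `B`, so `t ↦ ∫_Ω f(x - t w)` has zero derivative on `[0,1]`. Yet it is positive at `t = 0`,
  -- where the bump sits inside `Ω`, and zero at `t = 1`, where it sits outside.
  by_contra! hcon
  obtain ⟨r₁, hr₁, hr₁'⟩ := Metric.isOpen_iff.mp (hΩ.inter hB) p ⟨hp, hpB⟩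
  obtain ⟨r₂, hr₂, hr₂'⟩ := Metric.isOpen_iff.mp (isClosed_closure.isOpen_compl.inter hB) q
    ⟨hq, hqB⟩
  set r := min r₁ r₂ / 2 with hr
  have hrpos : 0 < r := by positivity
  have hrr₁ : r < r₁ := (half_lt_self (lt_min hr₁ hr₂)).trans_le (min_le_left _ _)
  have hrr₂ : r < r₂ := (half_lt_self (lt_min hr₁ hr₂)).trans_le (min_le_right _ _)
  let b : ContDiffBump p := ⟨r / 2, r, half_pos hrpos, half_lt_self hrpos⟩
  set f : Plane → ℝ := fun x => b x with hf
  have hfsm : ContDiff ℝ ∞ f := b.contDiff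
  have hfc : HasCompactSupport f := b.hasCompactSupport
  have hfs : tsupport f = Metric.closedBall p r := b.tsupport_eq
  set w := q - p with hw
  have htrans : ∀ t : ℝ, ContDiff ℝ ∞ (fun x => f (x - t • w)) := fun t =>
    hfsm.comp (contDiff_id.sub contDiff_const)
  have hsupp : ∀ t : ℝ, tsupport (fun x => f (x - t • w)) ⊆ Metric.closedBall (p + t • w) r :=
    fun t => by
      refine closure_minimal (fun x hx => ?_) Metric.isClosed_closedBall
      have h1 : x - t • w ∈ tsupport f := subset_tsupport f hx
      rw [hfs, Metric.mem_closedBall, dist_eq_norm] at h1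
      rw [Metric.mem_closedBall, dist_eq_norm]
      convert h1 using 2
      abel
  have hball : ∀ t ∈ Icc (0 : ℝ) 1, Metric.closedBall (p + t • w) r ⊆ B := fun t ht x hx => by
    have h1 : p + (x - (p + t • w)) ∈ B := by
      refine (hr₁' ?_).2
      rw [Metric.mem_closedBall, dist_eq_norm] at hx
      rw [Metric.mem_ball, dist_eq_norm, add_sub_cancel_left]
      exact hx.trans_lt hrr₁
    have h2 : q + (x - (p + t • w)) ∈ B := by
      refine (hr₂' ?_).2
      rw [Metric.mem_closedBall, dist_eq_norm] at hx
      rw [Metric.mem_ball, dist_eq_norm, add_sub_cancel_left]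
      exact hx.trans_lt hrr₂
    have h3 := hBc h1 h2 (sub_nonneg.mpr ht.2) ht.1 (sub_add_cancel 1 t)
    convert h3 using 1
    rw [hw]
    module
  have hder : ∀ t x, HasDerivAt (fun t : ℝ => f (x - t • w)) (-(fderiv ℝ f (x - t • w) w)) t :=
    fun t x => by
      have h1 : HasDerivAt (fun t : ℝ => x - t • w) (-w) t := by
        simpa using ((hasDerivAt_id t).smul_const w).const_sub x
      have h2 := ((hfsm.differentiable (by simp)).differentiableAt (x := x - t • w)).hasFDerivAt
      have h3 := h2.comp_hasDerivAt t h1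
      rw [map_neg] at h3
      exact h3
  have hfw : Continuous (fun x => fderiv ℝ f x w) :=
    ((hfsm.fderiv_right (m := ∞) (by simp)).clm_apply contDiff_const).continuous
  obtain ⟨M, hM⟩ := (hfc.fderiv_apply ℝ w).exists_bound_of_continuous hfw
  have hfin : IsFiniteMeasure (volume.restrict Ω) :=
    ⟨by simpa using hΩb.measure_lt_top⟩
  have hQ : ∀ t, HasDerivAt (fun t : ℝ => ∫ x in Ω, f (x - t • w))
      (∫ x in Ω, -(fderiv ℝ f (x - t • w) w)) t := fun t => by
    refine (hasDerivAt_integral_of_dominated_loc_of_deriv_le (bound := fun _ => M)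
      (F' := fun t x => -(fderiv ℝ f (x - t • w) w)) univ_mem
      (Eventually.of_forall fun t => (htrans t).continuous.aestronglyMeasurable) ?_ ?_ ?_
      (integrable_const _) (Eventually.of_forall fun x t _ => hder t x)).2
    · refine ((htrans t).continuous.integrable_of_hasCompactSupport ?_).integrableOn
      exact (isCompact_closedBall _ _).of_isClosed_subset (isClosed_tsupport _) (hsupp t)
    · exact (hfw.comp (by fun_prop : Continuous fun x : Plane => x - t • w)).neg
        |>.aestronglyMeasurable
    · exact Eventually.of_forall fun x t _ => by rw [norm_neg]; exact hM _
  have hQ0 : ∀ t ∈ Icc (0 : ℝ) 1, ∫ x in Ω, -(fderiv ℝ f (x - t • w) w) = 0 := fun t ht => by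
    have h1 := hcon (fun x => f (x - t • w)) (htrans t)
      ((isCompact_closedBall _ _).of_isClosed_subset (isClosed_tsupport _) (hsupp t))
      ((hsupp t).trans (hball t ht))
    rw [integral_neg, neg_eq_zero, ← h1]
    refine integral_congr_ae (Eventually.of_forall fun x => ?_)
    simp only [fderiv_comp_sub]
  have hconst : (∫ x in Ω, f (x - (1 : ℝ) • w)) = ∫ x in Ω, f (x - (0 : ℝ) • w) := by
    refine constant_of_has_deriv_right_zero (f := fun t : ℝ => ∫ x in Ω, f (x - t • w))
      (a := 0) (b := 1) (fun t _ => (hQ t).continuousAt.continuousWithinAt)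
      (fun t ht => ?_) 1 ⟨zero_le_one, le_rfl⟩
    have h1 := (hQ t).hasDerivWithinAt (s := Ici t)
    rwa [hQ0 t (Ico_subset_Icc_self ht)] at h1
  have hone : (∫ x in Ω, f (x - (1 : ℝ) • w)) = 0 := by
    refine setIntegral_eq_zero_of_forall_eq_zero fun x hx => ?_
    by_contra hne
    have h1 := hsupp 1 (subset_tsupport (fun x => f (x - (1 : ℝ) • w)) hne)
    rw [one_smul, hw, add_sub_cancel] at h1
    exact (hr₂' (Metric.closedBall_subset_ball hrr₂ h1)).1 (subset_closure hx)
  have hpos : 0 < ∫ x in Ω, f (x - (0 : ℝ) • w) := by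
    simp only [zero_smul, sub_zero]
    rw [setIntegral_pos_iff_support_of_nonneg_ae (Eventually.of_forall fun x => b.nonneg)
      ((hfsm.continuous.integrable_of_hasCompactSupport hfc).integrableOn)]
    have h1 : Function.support f = Metric.ball p r := b.support_eq
    rw [h1, inter_eq_left.mpr fun x hx => (hr₁' (Metric.ball_subset_ball hrr₁.le hx)).1]
    exact Metric.measure_ball_pos volume p hrpos
  rw [hone] at hconst
  exact hpos.ne hconst

/-- A function of `H_0^1(Ω)` which is smooth up to the boundary vanishes on the boundary. -/
theorem MemH10.eq_zero_of_mem_frontier (hΩ : IsBoundedC2Domain Ω) (hh : MemH10 Ω h)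
    (hg : IsSmoothExtension Ω h g) {x : Plane} (hx : x ∈ frontier Ω) : g x = 0 := by
  by_contra hgx
  obtain ⟨r, hr, hrg⟩ := Metric.eventually_nhds_iff_ball.mp
    (hg.1.continuous.continuousAt.eventually_ne hgx)
  -- The cap `1/2` ensures `‖q - p‖ ≤ 1` below, as `MemH10.integral_fderiv_eq_zero` demands of its
  -- direction.
  set ρ := min r (1 / 2) with hρ
  have hρpos : 0 < ρ := by positivity
  have hnhds : Metric.ball x ρ ∈ 𝓝 x := Metric.ball_mem_nhds x hρpos
  obtain ⟨n, hn, hin, hout, -⟩ := hΩ.exists_normal hx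
  have hline : ∀ v : Plane, ∀ᶠ t in 𝓝[>] (0 : ℝ), x + t • v ∈ Metric.ball x ρ := fun v => by
    have : Continuous fun t : ℝ => x + t • v := by fun_prop
    exact ((this.tendsto 0).mono_left nhdsWithin_le_nhds).eventually_mem
      (by rwa [zero_smul, add_zero])
  have hnn : 0 < inner ℝ n n := by
    rw [real_inner_self_eq_norm_sq]
    have := norm_pos_iff.mpr hn
    positivity
  obtain ⟨t₁, ht₁, ht₁'⟩ := ((hin (-n) (by rw [inner_neg_right]; linarith)).and (hline _)).exists
  obtain ⟨t₂, ht₂, ht₂'⟩ := ((hout n hnn).and (hline _)).exists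
  set p := x + t₁ • (-n)
  set q := x + t₂ • n
  have hpq : ‖q - p‖ ≤ 1 := by
    rw [← dist_eq_norm]
    have h1 := Metric.mem_ball.mp ht₁'
    have h2 := Metric.mem_ball.mp ht₂'
    have h3 : ρ ≤ 1 / 2 := min_le_right _ _
    linarith [dist_triangle_right q p x]
  obtain ⟨f, hf, hfc, hfs, hne⟩ := exists_integral_fderiv_ne_zero hΩ.isOpen hΩ.isBounded
    Metric.isOpen_ball (convex_ball x ρ) ht₁' ht₂' ht₁ ht₂
  -- On the ball containing the support of `f`, `g` has no zeros, so `f / g` is an admissible test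
  -- function. The identity for `H_0^1` applied to it becomes `∫_Ω ∂(g · f/g) = ∫_Ω ∂f = 0`, against
  -- the choice of `f`.
  have hdivsm : ContDiff ℝ ∞ (fun y => f y / g y) := contDiff_iff_contDiffAt.mpr fun y => by
    by_cases hy : y ∈ tsupport f
    · exact hf.contDiffAt.div hg.1.contDiffAt
        (hrg y (Metric.ball_subset_ball (min_le_left _ _) (hfs hy)))
    · refine (contDiffAt_const (c := (0 : ℝ))).congr_of_eventuallyEq ?_
      filter_upwards [(isClosed_tsupport f).isOpen_compl.mem_nhds hy] with z hz
      rw [image_eq_zero_of_notMem_tsupport hz, zero_div]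
  have hdivc : HasCompactSupport (fun y => f y / g y) := hfc.mono fun y hy hfy =>
    hy (by simp [hfy])
  refine hne ?_
  rw [← hh.integral_fderiv_eq_zero hΩ.isOpen hg hdivsm hdivc (q - p) hpq]
  refine integral_congr_ae (Eventually.of_forall fun y => ?_)
  have h1 : f = fun y => g y * (f y / g y) := by
    ext z
    by_cases hz : z ∈ tsupport f
    · rw [mul_div_cancel₀ _ (hrg z (Metric.ball_subset_ball (min_le_left _ _) (hfs hz)))]
    · rw [image_eq_zero_of_notMem_tsupport hz, zero_div, mul_zero]
  have h2 := fderiv_fun_mul (hg.1.differentiable (by simp)).differentiableAt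
    (hdivsm.differentiable (by simp)).differentiableAt (x := y)
  rw [← h1] at h2
  simp only [h2, add_apply, smul_apply, smul_eq_mul]
  ring

end Trace

/-! ### Functions of class `W^{2,∞}` on the unit interval -/

section Interval

theorem IsTestFunction.deriv {φ : ℝ → ℝ} {I : Set ℝ} (h : IsTestFunction I φ) :
    IsTestFunction I (deriv φ) := by
  have h1 := h.iteratedFDeriv_apply (fun _ : Fin 1 => (1 : ℝ))
  simpa [iteratedFDeriv_one_apply] using h1

theorem IsTestFunction.apply_eq_zero {φ : ℝ → ℝ} {I : Set ℝ} (h : IsTestFunction I φ) {t : ℝ}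
    (ht : t ∉ I) : φ t = 0 :=
  image_eq_zero_of_notMem_tsupport fun h' => ht (h.2.2 h')

theorem IsTestFunction.integral_eq {φ : ℝ → ℝ} (h : IsTestFunction (Ioo 0 1) φ) :
    ∫ t in (0 : ℝ)..1, φ t = ∫ t, φ t := by
  rw [intervalIntegral_eq_setIntegral_Ioo zero_le_one]
  exact setIntegral_eq_integral_of_forall_compl_eq_zero fun t ht => h.apply_eq_zero ht

/-- A test function on `(0,1)` with vanishing integral has a primitive which is a test function. -/
theorem IsTestFunction.exists_primitive {θ : ℝ → ℝ} (h : IsTestFunction (Ioo 0 1) θ)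
    (h0 : ∫ t, θ t = 0) : ∃ φ, IsTestFunction (Ioo 0 1) φ ∧ _root_.deriv φ = θ := by
  set φ : ℝ → ℝ := fun t => ∫ τ in (0 : ℝ)..t, θ τ with hφ
  have hder : ∀ t, HasDerivAt φ (θ t) t := fun t =>
    intervalIntegral.integral_hasDerivAt_right (h.1.continuous.intervalIntegrable _ _)
      (h.1.continuous.stronglyMeasurableAtFilter _ _) h.1.continuous.continuousAt
  have hderiv : _root_.deriv φ = θ := funext fun t => (hder t).deriv
  obtain ⟨a, b, ha, hb, hab⟩ : ∃ a b : ℝ, 0 < a ∧ b < 1 ∧ tsupport θ ⊆ Icc a b := by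
    rcases (tsupport θ).eq_empty_or_nonempty with he | hne
    · exact ⟨1 / 2, 1 / 2, by norm_num, by norm_num, by simp [he]⟩
    · have hc : IsCompact (tsupport θ) := h.2.1
      exact ⟨sInf (tsupport θ), sSup (tsupport θ), (h.2.2 (hc.sInf_mem hne)).1,
        (h.2.2 (hc.sSup_mem hne)).2, fun t ht => ⟨csInf_le hc.bddBelow ht, le_csSup hc.bddAbove ht⟩⟩
  have hzero : ∀ t, t ∉ Icc a b → θ t = 0 := fun t ht =>
    image_eq_zero_of_notMem_tsupport fun h' => ht (hab h')
  have hsupp : Function.support φ ⊆ Icc a b := fun t ht => by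
    by_contra hcon
    apply ht
    rcases lt_or_ge t a with hta | hta
    · refine intervalIntegral.integral_zero_ae (Eventually.of_forall fun τ hτ => hzero τ fun h' => ?_)
      rcases le_total 0 t with h1 | h1
      · rw [uIoc_of_le h1] at hτ; linarith [hτ.2, h'.1]
      · rw [uIoc_of_ge h1] at hτ; linarith [hτ.2, h'.1]
    · have htb : b < t := not_le.mp fun h1 => hcon ⟨hta, h1⟩
      have h1 : φ t = (∫ τ in (0 : ℝ)..1, θ τ) + ∫ τ in (1 : ℝ)..t, θ τ :=
        (intervalIntegral.integral_add_adjacent_intervals (h.1.continuous.intervalIntegrable _ _)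
          (h.1.continuous.intervalIntegrable _ _)).symm
      rw [h1, h.integral_eq, h0, zero_add]
      refine intervalIntegral.integral_zero_ae (Eventually.of_forall fun τ hτ => hzero τ fun h' => ?_)
      rcases le_total 1 t with h1 | h1
      · rw [uIoc_of_le h1] at hτ; linarith [hτ.1, h'.2]
      · rw [uIoc_of_ge h1] at hτ; linarith [hτ.1, h'.2]
  refine ⟨φ, ⟨?_, ?_, ?_⟩, hderiv⟩
  · rw [contDiff_infty_iff_deriv]
    exact ⟨fun t => (hder t).differentiableAt, hderiv ▸ h.1⟩
  · exact HasCompactSupport.of_support_subset_isCompact isCompact_Icc hsupp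
  · exact (closure_minimal hsupp isClosed_Icc).trans (Icc_subset_Ioo ha hb)

variable {F : Type} [NormedAddCommGroup F] [NormedSpace ℝ F] [CompleteSpace F]

/-- With `G` the primitive, `φ G - ∫(φ' G + φ g)` is absolutely continuous with derivative zero
almost everywhere, hence constant; `φ` vanishes at both endpoints. -/
theorem integral_deriv_smul_primitive {g : ℝ → F} (hg : IntervalIntegrable g volume 0 1)
    {φ : ℝ → ℝ} (hφ : IsTestFunction (Ioo 0 1) φ) :
    ∫ t in (0 : ℝ)..1, deriv φ t • (∫ τ in (0 : ℝ)..t, g τ) = -∫ t in (0 : ℝ)..1, φ t • g t := by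
  set G : ℝ → F := fun t => ∫ τ in (0 : ℝ)..t, g τ with hG
  have hGac : AbsolutelyContinuousOnInterval G 0 1 := absolutelyContinuousOnInterval_integral hg
  have h1 : IntervalIntegrable (fun t => deriv φ t • G t) volume 0 1 :=
    ((hφ.deriv.1.continuous.continuousOn).smul hGac.continuousOn).intervalIntegrable
  have h2 : IntervalIntegrable (fun t => φ t • g t) volume 0 1 :=
    hg.continuousOn_smul hφ.1.continuous.continuousOn
  have hφac : AbsolutelyContinuousOnInterval φ 0 1 :=
    (hφ.1.contDiffOn.of_le (by simp)).absolutelyContinuousOnInterval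
  have hac := (hφac.smul hGac).sub (absolutelyContinuousOnInterval_integral (h1.add h2))
  obtain ⟨C, hC⟩ := hac.const_of_ae_hasDerivAt_zero (by
    filter_upwards [hg.ae_hasDerivAt_integral, (h1.add h2).ae_hasDerivAt_integral] with t h3 h4 ht
    have h5 := ((hφ.1.differentiable (by simp)).differentiableAt (x := t)).hasDerivAt.smul
      (h3 ht 0 left_mem_uIcc)
    convert h5.sub (h4 ht 0 left_mem_uIcc) using 1
    abel)
  have h6 := hC 0 left_mem_uIcc
  have h7 := hC 1 right_mem_uIcc
  simp only [Pi.sub_apply, Pi.smul_apply', hφ.apply_eq_zero (t := 0) (by simp),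
    hφ.apply_eq_zero (t := 1) (by simp), zero_smul, intervalIntegral.integral_same, sub_zero,
    zero_sub] at h6 h7
  rw [← h6, neg_eq_zero] at h7
  have h8 := intervalIntegral.integral_add h1 h2
  exact eq_neg_of_add_eq_zero_left (h8 ▸ h7)

/-- The fundamental theorem of calculus for weak derivatives. -/
theorem HasWeakDeriv.exists_ae_eq_primitive {f g : ℝ → F}
    (h : HasWeakDeriv (Ioo (0 : ℝ) 1) (fun _ : Fin 1 => (1 : ℝ)) f g)
    (hf : IntervalIntegrable f volume 0 1) (hg : IntervalIntegrable g volume 0 1) :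
    ∃ c, ∀ᵐ t, t ∈ Ioo (0 : ℝ) 1 → f t = c + ∫ τ in (0 : ℝ)..t, g τ := by
  set D : ℝ → F := fun t => f t - ∫ τ in (0 : ℝ)..t, g τ with hD
  have hGac := absolutelyContinuousOnInterval_integral hg
  have hDi : IntervalIntegrable D volume 0 1 := hf.sub hGac.continuousOn.intervalIntegrable
  have hsm : ∀ {φ : ℝ → ℝ} {k : ℝ → F}, IsTestFunction (Ioo 0 1) φ →
      IntervalIntegrable k volume 0 1 → IntervalIntegrable (fun t => φ t • k t) volume 0 1 :=
    fun h1 h2 => h2.continuousOn_smul h1.1.continuous.continuousOn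
  have hD0 : ∀ φ, IsTestFunction (Ioo 0 1) φ → ∫ t in (0 : ℝ)..1, deriv φ t • D t = 0 :=
    fun φ hφ => by
      have h1 := h.2.2 φ hφ
      simp only [iteratedFDeriv_one_apply, fderiv_apply_one_eq_deriv, pow_one,
        ← intervalIntegral_eq_setIntegral_Ioo (zero_le_one' ℝ)] at h1
      simp only [hD, smul_sub]
      rw [intervalIntegral.integral_sub (hsm hφ.deriv hf)
        (hsm hφ.deriv hGac.continuousOn.intervalIntegrable), h1,
        integral_deriv_smul_primitive hg hφ]
      simp
  -- Du Bois-Reymond: `D` has zero weak derivative. For a test function `ψ`, the difference `ψ -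
  -- (∫ψ) η` has zero integral, so it is the derivative of a test function and `D` annihilates it.
  -- Hence `∫ ψ (D - c) = 0` with `c = ∫ η D`.
  obtain ⟨η, hη, hη1⟩ : ∃ η, IsTestFunction (Ioo (0 : ℝ) 1) η ∧ ∫ t, η t = 1 := by
    let b : ContDiffBump (1 / 2 : ℝ) := ⟨1 / 8, 1 / 4, by norm_num, by norm_num⟩
    refine ⟨b.normed volume, ⟨b.contDiff_normed, b.hasCompactSupport_normed, ?_⟩,
      b.integral_normed⟩
    rw [b.tsupport_normed_eq, Real.closedBall_eq_Icc]
    exact Icc_subset_Ioo (by norm_num) (by norm_num)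
  set c := ∫ t in (0 : ℝ)..1, η t • D t with hc
  have hloc : LocallyIntegrableOn (fun t => D t - c) (Ioo (0 : ℝ) 1) volume := by
    refine IntegrableOn.locallyIntegrableOn ?_
    rw [← intervalIntegrable_iff_integrableOn_Ioo_of_le zero_le_one]
    exact hDi.sub intervalIntegrable_const
  refine ⟨c, ?_⟩
  have hae := isOpen_Ioo.ae_eq_zero_of_integral_contDiff_smul_eq_zero hloc fun ψ h1 h2 h3 => by
    have hψ : IsTestFunction (Ioo (0 : ℝ) 1) ψ := ⟨h1, h2, h3⟩
    set m := ∫ t, ψ t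
    have hθ : IsTestFunction (Ioo (0 : ℝ) 1) (fun t => ψ t - m * η t) := by
      have hsub : Function.support (fun t => ψ t - m * η t) ⊆ tsupport ψ ∪ tsupport η :=
        fun t ht => by
          by_contra hcon
          rw [mem_union, not_or] at hcon
          exact ht (by simp [image_eq_zero_of_notMem_tsupport hcon.1,
            image_eq_zero_of_notMem_tsupport hcon.2])
      refine ⟨hψ.1.sub (contDiff_const.mul hη.1), ?_, ?_⟩
      · exact HasCompactSupport.of_support_subset_isCompact
          (IsCompact.union hψ.2.1 hη.2.1) hsub
      · exact (closure_minimal hsub ((isClosed_tsupport _).union (isClosed_tsupport _))).trans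
          (union_subset hψ.2.2 hη.2.2)
    obtain ⟨φ, hφ, hφθ⟩ := hθ.exists_primitive (by
      rw [integral_sub (hψ.1.continuous.integrable_of_hasCompactSupport hψ.2.1)
        ((hη.1.continuous.integrable_of_hasCompactSupport hη.2.1).const_mul m),
        integral_const_mul, hη1, mul_one, sub_self])
    have h4 := hD0 φ hφ
    rw [hφθ] at h4
    have h5 : ∀ t, (ψ t - m * η t) • D t = ψ t • D t - m • (η t • D t) := fun t => by
      rw [sub_smul, mul_smul]
    simp only [h5] at h4
    have hmη : IntervalIntegrable (fun t => m • (η t • D t)) volume 0 1 := (hsm hη hDi).smul m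
    rw [intervalIntegral.integral_sub (hsm hψ hDi) hmη,
      intervalIntegral.integral_smul, ← hc, sub_eq_zero] at h4
    rw [← setIntegral_smul_testFunction hψ, ← intervalIntegral_eq_setIntegral_Ioo zero_le_one]
    simp only [smul_sub]
    rw [intervalIntegral.integral_sub (hsm hψ hDi) (hsm hψ intervalIntegrable_const), h4,
      intervalIntegral.integral_smul_const, hψ.integral_eq, sub_self]
  filter_upwards [hae] with t ht htI
  have h1 := ht htI
  rw [hD] at h1
  rw [sub_eq_zero, sub_eq_iff_eq_add] at h1
  exact h1

/-- A function in `W^{2,∞}(0,1)` is continuously differentiable up to the boundary. -/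
theorem MemSobolev.continuousOn_derivWithin {γ : ℝ → F} (hγ : ContinuousOn γ (Icc 0 1))
    (h : MemSobolev (Ioo (0 : ℝ) 1) 2 ⊤ γ) :
    ContinuousOn (derivWithin γ (Icc 0 1)) (Icc 0 1) := by
  have hex : ∀ k ≤ 2, ∃ g, HasWeakDeriv (Ioo (0 : ℝ) 1) (fun _ : Fin k => (1 : ℝ)) γ g ∧
      IntervalIntegrable g volume 0 1 := fun k hk => by
    have h1 : (⨅ (g : ℝ → F) (_ : HasWeakDeriv (Ioo (0 : ℝ) 1) (fun _ : Fin k => (1 : ℝ)) γ g),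
        eLpNorm g ⊤ (volume.restrict (Ioo 0 1))) < ⊤ :=
      lt_of_le_of_lt (by
        have hv : ∀ i : Fin k, ‖(fun _ : Fin k => (1 : ℝ)) i‖ ≤ 1 := fun _ => norm_one.le
        exact le_trans (le_iSup₂_of_le _ hv le_rfl) (le_iSup₂_of_le k hk le_rfl)) h
    simp only [iInf_lt_iff] at h1
    obtain ⟨g, hg, hg'⟩ := h1
    refine ⟨g, hg, ?_⟩
    rw [intervalIntegrable_iff_integrableOn_Ioo_of_le zero_le_one]
    exact MemLp.integrable le_top ⟨hg.2.1.aestronglyMeasurable, hg'⟩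
  obtain ⟨g₁, hg₁, hg₁i⟩ := hex 1 one_le_two
  obtain ⟨g₂, hg₂, hg₂i⟩ := hex 2 le_rfl
  -- Testing the first-order identity with `φ'` in place of `φ` shows that the second weak
  -- derivative of `γ` is the first weak derivative of `g₁`.
  have hg₁₂ : HasWeakDeriv (Ioo (0 : ℝ) 1) (fun _ : Fin 1 => (1 : ℝ)) g₁ g₂ := by
    refine ⟨hg₁.2.1, hg₂.2.1, fun φ hφ => ?_⟩
    have h1 := hg₁.2.2 _ hφ.deriv
    have h2 := hg₂.2.2 φ hφ
    simp only [← iteratedDeriv_eq_iteratedFDeriv, iteratedDeriv_succ,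
      iteratedDeriv_zero, pow_one, neg_smul, one_smul, even_two, Even.neg_pow, one_pow] at h1 h2 ⊢
    rw [← h2, h1, neg_neg]
  obtain ⟨c₁, hc₁⟩ := hg₁₂.exists_ae_eq_primitive hg₁i hg₂i
  obtain ⟨c₀, hc₀⟩ := hg₁.exists_ae_eq_primitive
    (by rw [← uIcc_of_le zero_le_one] at hγ; exact hγ.intervalIntegrable) hg₁i
  have hG : ContinuousOn (fun t => c₁ + ∫ τ in (0 : ℝ)..t, g₂ τ) (Icc 0 1) := by
    have h1 := (absolutelyContinuousOnInterval_integral hg₂i).continuousOn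
    rw [uIcc_of_le zero_le_one] at h1
    exact continuousOn_const.add h1
  -- The constant continuation beyond `[0,1]` makes the primitive differentiable on both sides at
  -- the endpoints too.
  set G : ℝ → F := IccExtend zero_le_one ((Icc (0 : ℝ) 1).domRestrict
    fun t => c₁ + ∫ τ in (0 : ℝ)..t, g₂ τ) with hGdef
  have hGc : Continuous G := Continuous.Icc_extend' hG.domRestrict
  have hG' : ∀ t ∈ Icc (0 : ℝ) 1, G t = c₁ + ∫ τ in (0 : ℝ)..t, g₂ τ := fun t ht => by
    rw [hGdef, IccExtend_of_mem _ _ ht, domRestrict_apply]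
  have hder : ∀ t, HasDerivAt (fun t => c₀ + ∫ τ in (0 : ℝ)..t, G τ) (G t) t := fun t =>
    (intervalIntegral.integral_hasDerivAt_right (hGc.intervalIntegrable _ _)
      (hGc.stronglyMeasurableAtFilter _ _) hGc.continuousAt).const_add c₀
  have heq : EqOn γ (fun t => c₀ + ∫ τ in (0 : ℝ)..t, G τ) (Icc 0 1) := by
    -- Continuity of both sides turns almost everywhere equality into equality on the closed
    -- interval.
    refine Measure.eqOn_Icc_of_ae_eq volume zero_ne_one ?_ hγ
      (fun t _ => (hder t).continuousAt.continuousWithinAt)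
    rw [Filter.EventuallyEq, ← restrict_Ioo_eq_restrict_Icc, ae_restrict_iff' measurableSet_Ioo]
    filter_upwards [hc₀] with t ht htI
    rw [ht htI]
    congr 1
    refine intervalIntegral.integral_congr_ae ?_
    filter_upwards [hc₁] with τ hτ hτI
    rw [uIoc_of_le htI.1.le] at hτI
    have hτ' : τ ∈ Ioo (0 : ℝ) 1 := ⟨hτI.1, hτI.2.trans_lt htI.2⟩
    rw [hτ hτ', hG' τ (Ioo_subset_Icc_self hτ')]
  refine hGc.continuousOn.congr fun t ht => ?_
  exact ((hder t).hasDerivWithinAt.congr heq (heq ht)).derivWithin (uniqueDiffOn_Icc_zero_one t ht)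

end Interval

/-! ### Control-affine fields with finitely many controls -/

section AffineField

variable {E : Type*} [NormedAddCommGroup E] [NormedSpace ℝ E] {N : ℕ}

/-- The control-affine field `y ↦ (c ↦ ∑ₖ cₖ wₖ(y))`. -/
def affineField (w : Fin N → E → E) (y : E) : EuclideanSpace ℝ (Fin N) →L[ℝ] E :=
  ∑ k, (EuclideanSpace.proj k : EuclideanSpace ℝ (Fin N) →L[ℝ] ℝ).smulRight (w k y)

theorem affineField_apply (w : Fin N → E → E) (y : E) (c : EuclideanSpace ℝ (Fin N)) :
    affineField w y c = ∑ k, c k • w k y := by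
  simp [affineField, sum_apply]

theorem exists_lipschitzWith_affineField {w : Fin N → E → E}
    (hw : ∀ k, ∃ K, LipschitzWith K (w k)) : ∃ K, LipschitzWith K (affineField w) := by
  choose K hK using hw
  refine ⟨∑ k, K k, LipschitzWith.of_dist_le_mul fun y z => ?_⟩
  rw [dist_eq_norm]
  refine ContinuousLinearMap.opNorm_le_bound _ (by positivity) fun c => ?_
  rw [sub_apply, affineField_apply, affineField_apply, ← Finset.sum_sub_distrib,
    NNReal.coe_sum, Finset.sum_mul, Finset.sum_mul]
  refine (norm_sum_le _ _).trans (Finset.sum_le_sum fun k _ => ?_)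
  rw [← smul_sub, norm_smul, mul_comm, ← dist_eq_norm]
  exact mul_le_mul ((hK k).dist_le_mul y z) (PiLp.norm_apply_le c k) (norm_nonneg _) (by positivity)

end AffineField

/-! ### The Hamiltonian fields of smooth stream functions -/

section Fields

variable {Ω : Set Plane} {N : ℕ}

theorem ContDiff.gradient {f : Plane → ℝ} (hf : ContDiff ℝ ∞ f) : ContDiff ℝ ∞ (gradient f) := by
  rw [contDiff_euclidean]
  intro i
  have h1 : (fun x => _root_.gradient f x i) =
      fun x => fderiv ℝ f x (EuclideanSpace.single i 1) := by
    ext x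
    have h2 : inner ℝ (_root_.gradient f x) (EuclideanSpace.single i (1 : ℝ)) =
      fderiv ℝ f x (EuclideanSpace.single i 1) := by simp [_root_.gradient]
    rw [← h2, EuclideanSpace.inner_single_right]
    simp
  rw [h1]
  exact (hf.fderiv_right (m := ∞) (by simp)).clm_apply contDiff_const

theorem HasCompactSupport.gradient {f : Plane → ℝ} (hf : HasCompactSupport f) :
    HasCompactSupport (gradient f) :=
  (hf.fderiv ℝ).mono fun x hx hx' => hx (by simp [_root_.gradient, hx'])

theorem gradient_sum_mul {g : Fin N → Plane → ℝ} (hg : ∀ k, ContDiff ℝ ∞ (g k)) (c : Fin N → ℝ)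
    (x : Plane) : gradient (fun x => ∑ k, c k * g k x) x = ∑ k, c k • gradient (g k) x := by
  have h1 : fderiv ℝ (fun x => ∑ k, c k * g k x) x = ∑ k, c k • fderiv ℝ (g k) x := by
    rw [fderiv_fun_sum fun k _ =>
      (((hg k).differentiable (by simp)).differentiableAt).const_mul (c k)]
    exact Finset.sum_congr rfl fun k _ =>
      fderiv_const_mul ((hg k).differentiable (by simp)).differentiableAt (c k)
  simp [gradient, h1, map_sum]

/-- The field `x ↦ (c ↦ ∑ₖ cₖ J∇gₖ(x))`. -/
def velocity (g : Fin N → Plane → ℝ) : Plane → EuclideanSpace ℝ (Fin N) →L[ℝ] Plane :=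
  affineField fun k x => J (gradient (g k) x)

theorem velocity_apply (g : Fin N → Plane → ℝ) (x : Plane) (c : EuclideanSpace ℝ (Fin N)) :
    velocity g x c = ∑ k, c k • J (gradient (g k) x) := affineField_apply _ _ _

/-- A smooth field of compact support is globally Lipschitz; this is why the extensions are cut off.
-/
theorem exists_lipschitzWith_velocity {g : Fin N → Plane → ℝ} (hg : ∀ k, ContDiff ℝ ∞ (g k))
    (hgc : ∀ k, HasCompactSupport (g k)) : ∃ K, LipschitzWith K (velocity g) :=
  exists_lipschitzWith_affineField fun k =>
    ContDiff.lipschitzWith_of_hasCompactSupport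
      ((HasCompactSupport.gradient (hgc k)).comp_left (map_zero J))
      (J.contDiff.comp (ContDiff.gradient (hg k))) (by simp)

theorem perpGrad_univ_streamFunction {T : ℝ} {g : Fin N → Plane → ℝ}
    (hg : ∀ k, ContDiff ℝ ∞ (g k)) (u : Control T N) (t : ℝ) (x : Plane) :
    perpGrad univ (streamFunction g u t) x = velocity g x (u t) := by
  have h1 : gradientWithin (streamFunction g u t) univ x = ∑ k, u t k • gradient (g k) x := by
    rw [← gradient_sum_mul hg, gradientWithin, gradient, fderivWithin_univ]
    rfl
  rw [perpGrad, h1, velocity_apply, map_sum]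
  simp

theorem gradientWithin_streamFunction (hΩ : IsBoundedC2Domain Ω) {T : ℝ} {h g : Fin N → Plane → ℝ}
    (hg : ∀ k, IsSmoothExtension Ω (h k) (g k)) (u : Control T N) (t : ℝ) {x : Plane}
    (hx : x ∈ closure Ω) : gradientWithin (streamFunction h u t) (closure Ω) x =
      ∑ k, u t k • gradient (g k) x := by
  have heq : EqOn (streamFunction h u t) (fun x => ∑ k, u t k * g k x) (closure Ω) := fun y hy => by
    simp only [streamFunction, (hg _).2 hy]
  rw [← gradient_sum_mul fun k => (hg k).1, gradientWithin, gradient, fderivWithin_congr heq (heq hx),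
    DifferentiableAt.fderivWithin _ (hΩ.uniqueDiffOn x hx)]
  exact (ContDiff.differentiable (n := ∞)
    (ContDiff.sum fun k _ => contDiff_const.mul (hg k).1) (by simp)).differentiableAt

theorem perpGrad_streamFunction (hΩ : IsBoundedC2Domain Ω) {T : ℝ} {h g : Fin N → Plane → ℝ}
    (hg : ∀ k, IsSmoothExtension Ω (h k) (g k)) (u : Control T N) (t : ℝ) {x : Plane}
    (hx : x ∈ closure Ω) :
    perpGrad (closure Ω) (streamFunction h u t) x = velocity g x (u t) := by
  rw [perpGrad, gradientWithin_streamFunction hΩ hg u t hx, velocity_apply, map_sum]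
  simp

theorem perpHess_streamFunction (hΩ : IsBoundedC2Domain Ω) {T : ℝ} {h g : Fin N → Plane → ℝ}
    (hg : ∀ k, IsSmoothExtension Ω (h k) (g k)) (u : Control T N) (t : ℝ) {x : Plane}
    (hx : x ∈ closure Ω) (z : Plane) :
    perpHess (closure Ω) (streamFunction h u t) x z =
      ∑ k, u t k • J (fderiv ℝ (gradient (g k)) x z) := by
  have heq : EqOn (gradientWithin (streamFunction h u t) (closure Ω))
      (fun x => ∑ k, u t k • gradient (g k) x) (closure Ω) := fun y hy =>
    gradientWithin_streamFunction hΩ hg u t hy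
  have hd : ∀ k, DifferentiableAt ℝ (gradient (g k)) x := fun k =>
    ((ContDiff.gradient (hg k).1).differentiable (by simp)).differentiableAt
  have h1 : HasFDerivAt (fun x => ∑ k, u t k • gradient (g k) x)
      (∑ k, u t k • fderiv ℝ (gradient (g k)) x) x :=
    HasFDerivAt.fun_sum fun k _ => (hd k).hasFDerivAt.const_smul (u t k)
  rw [perpHess, fderivWithin_congr heq (heq hx),
    h1.hasFDerivWithinAt.fderivWithin (hΩ.uniqueDiffOn x hx)]
  simp [sum_apply, map_sum]

/-! ### Cut-off -/

theorem exists_compactSupport_eqOn_ball {f : Plane → ℝ} (hf : ContDiff ℝ ∞ f) {R : ℝ}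
    (hR : 0 < R) :
    ∃ f' : Plane → ℝ, ContDiff ℝ ∞ f' ∧ HasCompactSupport f' ∧ EqOn f' f (Metric.ball 0 R) := by
  let b : ContDiffBump (0 : Plane) := ⟨R, R + 1, hR, by linarith⟩
  refine ⟨fun x => b x * f x, b.contDiff.mul hf, b.hasCompactSupport.mul_right, fun x hx => ?_⟩
  simp only [b.one_of_mem_closedBall (Metric.ball_subset_closedBall hx), one_mul]

theorem IsBoundedC2Domain.exists_ball (hΩ : IsBoundedC2Domain Ω) :
    ∃ R, 0 < R ∧ closure Ω ⊆ Metric.ball 0 R := by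
  obtain ⟨R, hR⟩ := (Metric.isBounded_iff_subset_ball 0).mp hΩ.isBounded.closure
  exact ⟨max R 1, by positivity, hR.trans (Metric.ball_subset_ball (le_max_left _ _))⟩

theorem exists_compactSupport_extension (hΩ : IsBoundedC2Domain Ω) {h : Fin N → Plane → ℝ}
    (hh : ∀ k, SmoothUpToBoundary Ω (h k)) :
    ∃ g : Fin N → Plane → ℝ, (∀ k, IsSmoothExtension Ω (h k) (g k)) ∧
      ∀ k, HasCompactSupport (g k) := by
  obtain ⟨R, hR, hΩR⟩ := hΩ.exists_ball
  have : ∀ k, ∃ g, IsSmoothExtension Ω (h k) g ∧ HasCompactSupport g := fun k => by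
    obtain ⟨f, hf, hfh⟩ := hh k
    obtain ⟨g, hg, hgc, hgf⟩ := exists_compactSupport_eqOn_ball hf hR
    exact ⟨g, ⟨hg, fun x hx => (hgf (hΩR hx)).trans (hfh hx)⟩, hgc⟩
  choose g hg hgc using this
  exact ⟨g, hg, hgc⟩

/-! ### Invariance of the closed domain -/

theorem solvesAffine_velocity_mem_closure (hΩ : IsBoundedC2Domain Ω) {h g : Fin N → Plane → ℝ}
    (hg : ∀ k, IsSmoothExtension Ω (h k) (g k)) (hgc : ∀ k, HasCompactSupport (g k))
    (hh : ∀ k, MemH10 Ω (h k)) {T : ℝ} {u : ℝ → EuclideanSpace ℝ (Fin N)}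
    (hu : IntervalIntegrable u volume 0 T) {x : Plane} (hx : x ∈ closure Ω) {y : ℝ → Plane}
    (hy : SolvesAffine T u (velocity g) x y) : ∀ t ∈ Icc 0 T, y t ∈ closure Ω := by
  obtain ⟨K, hK⟩ := exists_lipschitzWith_velocity (fun k => (hg k).1) hgc
  refine hy.mem_of_tangent hu hK isClosed_closure (fun x p hp hnear c => ?_) hx
  rw [velocity_apply, inner_sum]
  refine Finset.sum_eq_zero fun k _ => ?_
  rw [inner_smul_right, hΩ.inner_J_gradient_eq_zero ((hg k).1.of_le (by simp))
    (fun q hq => (hh k).eq_zero_of_mem_frontier hΩ (hg k) hq) hp hnear, mul_zero]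

theorem SolvesIVP.solvesAffine {T : ℝ} {f : ℝ → Plane → Plane} {y₀ : Plane} {y : ℝ → Plane}
    (h : SolvesIVP T f y₀ y) {u : ℝ → EuclideanSpace ℝ (Fin N)}
    {W : Plane → EuclideanSpace ℝ (Fin N) →L[ℝ] Plane}
    (hf : ∀ t ∈ Icc 0 T, f t (y t) = W (y t) (u t)) : SolvesAffine T u W y₀ y := by
  refine ⟨h.1, fun t ht => ?_⟩
  rw [h.2.2 t ht]
  congr 1
  refine intervalIntegral.integral_congr fun τ hτ => ?_
  rw [uIcc_of_le ht.1] at hτ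
  exact hf τ ⟨hτ.1, hτ.2.trans ht.2⟩

theorem SolvesAffine.solvesIVP {T : ℝ} (hT : 0 ≤ T) {f : ℝ → Plane → Plane} {y₀ : Plane}
    {y : ℝ → Plane} {u : ℝ → EuclideanSpace ℝ (Fin N)} (hu : IntervalIntegrable u volume 0 T)
    {W : Plane → EuclideanSpace ℝ (Fin N) →L[ℝ] Plane} (hW : Continuous W)
    (h : SolvesAffine T u W y₀ y) (hf : ∀ t ∈ Icc 0 T, f t (y t) = W (y t) (u t)) :
    SolvesIVP T f y₀ y := by
  refine ⟨h.continuousOn, ?_, fun t ht => ?_⟩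
  · refine IntervalIntegrable.congr (fun t ht => ?_) (h.intervalIntegrable hT hu hW)
    rw [uIoc_of_le hT] at ht
    exact (hf t (Ioc_subset_Icc_self ht)).symm
  · rw [h.eq_integral t ht]
    congr 1
    refine intervalIntegral.integral_congr fun τ hτ => ?_
    rw [uIcc_of_le ht.1] at hτ
    exact (hf τ ⟨hτ.1, hτ.2.trans ht.2⟩).symm

/-- Trajectories of smooth extensions of the velocity field do not leave the closed domain. -/
theorem solvesIVP_univ_mem_closure (hΩ : IsBoundedC2Domain Ω) {h g : Fin N → Plane → ℝ}
    (hg : ∀ k, IsSmoothExtension Ω (h k) (g k)) (hh : ∀ k, MemH10 Ω (h k)) {T T' : ℝ}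
    (hT' : T' ∈ Icc 0 T) (u : Control T N) {x : Plane} (hx : x ∈ closure Ω) {y : ℝ → Plane}
    (hy : SolvesIVP T' (fun t => perpGrad univ (streamFunction g u t)) x y) :
    ∀ t ∈ Icc 0 T', y t ∈ closure Ω := by
  obtain ⟨R₁, hR₁, hΩR⟩ := hΩ.exists_ball
  obtain ⟨R₂, hR₂⟩ := isCompact_Icc.exists_bound_of_continuousOn hy.1
  -- An arbitrary extension `g` need not give a globally Lipschitz field. The ball of radius `R`
  -- contains the closed domain and the whole trajectory, so cutting `g` off outside it leaves the
  -- equation along `y` unchanged.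
  set R := max R₁ (R₂ + 1) with hR
  have hRpos : 0 < R := lt_max_of_lt_left hR₁
  have hcut := fun k => exists_compactSupport_eqOn_ball (hg k).1 hRpos
  choose g' hg' hgc' hgg' using hcut
  have hext : ∀ k, IsSmoothExtension Ω (h k) (g' k) := fun k =>
    ⟨hg' k, fun z hz => (hgg' k (Metric.ball_subset_ball (le_max_left _ _) (hΩR hz))).trans
      ((hg k).2 hz)⟩
  have hT0 : 0 ≤ T := hT'.1.trans hT'.2
  refine solvesAffine_velocity_mem_closure hΩ hext hgc' hh
    ((intervalIntegrable_of_lp hT0 u).mono_Icc hT') hx (hy.solvesAffine fun t ht => ?_)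
  rw [perpGrad_univ_streamFunction (fun k => (hg k).1), velocity_apply, velocity_apply]
  refine Finset.sum_congr rfl fun k _ => ?_
  have hmem : y t ∈ Metric.ball (0 : Plane) R := by
    rw [mem_ball_zero_iff]
    exact ((hR₂ t ht).trans_lt (lt_add_one _)).trans_le (le_max_right _ _)
  have hev : g' k =ᶠ[𝓝 (y t)] g k :=
    (hgg' k).eventuallyEq_of_mem (Metric.isOpen_ball.mem_nhds hmem)
  rw [gradient, gradient, hev.fderiv_eq]

/-- The flow of the velocity field on the closed domain. -/
theorem exists_flow (hΩ : IsBoundedC2Domain Ω) {h : Fin N → Plane → ℝ}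
    (hs : ∀ k, SmoothUpToBoundary Ω (h k)) (hh : ∀ k, MemH10 Ω (h k)) {T : ℝ} (hT : 0 ≤ T)
    (u : Control T N) :
    ∃ Φ : ℝ → Plane → Plane,
      (∀ x ∈ closure Ω,
        SolvesIVP T (fun t => perpGrad (closure Ω) (streamFunction h u t)) x (fun t => Φ t x)) ∧
      (∀ t ∈ Icc 0 T, MapsTo (Φ t) (closure Ω) (closure Ω)) ∧
      (∀ x ∈ closure Ω, ∀ y : ℝ → Plane,
        SolvesIVP T (fun t => perpGrad (closure Ω) (streamFunction h u t)) x y →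
        (∀ t ∈ Icc 0 T, y t ∈ closure Ω) → ∀ t ∈ Icc 0 T, y t = Φ t x) := by
  obtain ⟨g, hg, hgc⟩ := exists_compactSupport_extension hΩ hs
  obtain ⟨K, hK⟩ := exists_lipschitzWith_velocity (fun k => (hg k).1) hgc
  have hu := intervalIntegrable_of_lp hT u
  choose Y hY using fun x => exists_solvesAffine hT hu hK x
  have hmem := fun x (hx : x ∈ closure Ω) =>
    solvesAffine_velocity_mem_closure hΩ hg hgc hh hu hx (hY x)
  refine ⟨fun t x => Y x t, fun x hx => ?_, fun t ht x hx => hmem x hx t ht,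
    fun x hx y hy hyΩ => ?_⟩
  · exact (hY x).solvesIVP hT hu hK.continuous fun t ht =>
      perpGrad_streamFunction hΩ hg u t (hmem x hx t ht)
  · exact (hy.solvesAffine fun t ht => perpGrad_streamFunction hΩ hg u t (hyΩ t ht)).eqOn
      (hY x) hT hu hK

end Fields

/-! ### The state system -/

section State

variable {Ω : Set Plane} {N : ℕ}

/-- The field of the state system, cut off in the tangent component. -/
def stateField (g : Fin N → Plane → ℝ) (b : ContDiffBump (0 : Plane)) :
    Plane × Plane → EuclideanSpace ℝ (Fin N) →L[ℝ] Plane × Plane :=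
  affineField fun k p => b p.2 • (J (gradient (g k) p.1), J (fderiv ℝ (gradient (g k)) p.1 p.2))

theorem stateField_apply_fst (g : Fin N → Plane → ℝ) (b : ContDiffBump (0 : Plane))
    (p : Plane × Plane) (c : EuclideanSpace ℝ (Fin N)) :
    (stateField g b p c).1 = b p.2 • velocity g p.1 c := by
  rw [stateField, affineField_apply, Prod.fst_sum, velocity_apply, Finset.smul_sum]
  exact Finset.sum_congr rfl fun k _ => smul_comm _ _ _

theorem stateField_apply_snd (g : Fin N → Plane → ℝ) (b : ContDiffBump (0 : Plane))
    (p : Plane × Plane) (c : EuclideanSpace ℝ (Fin N)) :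
    (stateField g b p c).2 = b p.2 • ∑ k, c k • J (fderiv ℝ (gradient (g k)) p.1 p.2) := by
  rw [stateField, affineField_apply, Prod.snd_sum, Finset.smul_sum]
  exact Finset.sum_congr rfl fun k _ => smul_comm _ _ _

/-- The `X`-derivative of `∇²g(X) a` grows with `a`, so the uncut field is not globally Lipschitz.
The factor `b(a)` on both components gives the whole field compact support in `(X, a)`. -/
theorem exists_lipschitzWith_stateField {g : Fin N → Plane → ℝ} (hg : ∀ k, ContDiff ℝ ∞ (g k))
    (hgc : ∀ k, HasCompactSupport (g k)) (b : ContDiffBump (0 : Plane)) :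
    ∃ K, LipschitzWith K (stateField g b) := by
  refine exists_lipschitzWith_affineField fun k => ?_
  have hgrad := ContDiff.gradient (hg k)
  have hD : ContDiff ℝ ∞ (fun p : Plane × Plane => fderiv ℝ (gradient (g k)) p.1 p.2) :=
    ((hgrad.fderiv_right (m := ∞) (by simp)).comp contDiff_fst).clm_apply contDiff_snd
  have hsm : ContDiff ℝ ∞ (fun p : Plane × Plane => b p.2 •
      (J (gradient (g k) p.1), J (fderiv ℝ (gradient (g k)) p.1 p.2))) :=
    (b.contDiff.comp contDiff_snd).smul
      ((J.contDiff.comp (hgrad.comp contDiff_fst)).prodMk (J.contDiff.comp hD))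
  refine ContDiff.lipschitzWith_of_hasCompactSupport ?_ hsm (by simp)
  have hgc' := HasCompactSupport.gradient (hgc k)
  refine HasCompactSupport.of_support_subset_isCompact
    (IsCompact.prod hgc' b.hasCompactSupport) fun p hp => ⟨?_, ?_⟩
  · by_contra hcon
    refine hp ?_
    have h1 : fderiv ℝ (gradient (g k)) p.1 = 0 :=
      image_eq_zero_of_notMem_tsupport fun h => hcon (tsupport_fderiv_subset ℝ h)
    simp [image_eq_zero_of_notMem_tsupport hcon, h1]
  · by_contra hcon
    exact hp (by simp [image_eq_zero_of_notMem_tsupport hcon])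

/-- `C` does not depend on the cut-off `b`, since `0 ≤ b ≤ 1`. The a priori bound on `a` is thus
available before the radius of `b` is fixed. -/
theorem exists_norm_stateField_snd_le {g : Fin N → Plane → ℝ} (hg : ∀ k, ContDiff ℝ ∞ (g k))
    (hgc : ∀ k, HasCompactSupport (g k)) : ∃ C : ℝ, 0 ≤ C ∧
      ∀ (b : ContDiffBump (0 : Plane)) p c, ‖(stateField g b p c).2‖ ≤ C * ‖c‖ * ‖p.2‖ := by
  have : ∀ k, ∃ C, ∀ x, ‖fderiv ℝ (gradient (g k)) x‖ ≤ C := fun k =>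
    ((HasCompactSupport.gradient (hgc k)).fderiv ℝ).exists_bound_of_continuous
      (((ContDiff.gradient (hg k)).fderiv_right (m := ∞) (by simp)).continuous)
  choose C hC using this
  have hC0 : ∀ k, 0 ≤ C k := fun k => (norm_nonneg _).trans (hC k 0)
  refine ⟨∑ k, ‖J‖ * C k, Finset.sum_nonneg fun k _ => mul_nonneg (norm_nonneg _) (hC0 k),
    fun b p c => ?_⟩
  rw [stateField_apply_snd, norm_smul, Real.norm_of_nonneg b.nonneg]
  refine (mul_le_of_le_one_left (norm_nonneg _) b.le_one).trans ?_
  rw [Finset.sum_mul, Finset.sum_mul]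
  refine (norm_sum_le _ _).trans (Finset.sum_le_sum fun k _ => ?_)
  rw [norm_smul]
  calc ‖c k‖ * ‖J (fderiv ℝ (gradient (g k)) p.1 p.2)‖
      ≤ ‖c‖ * (‖J‖ * (C k * ‖p.2‖)) := by
        gcongr
        · exact PiLp.norm_apply_le c k
        · refine (J.le_opNorm _).trans ?_
          gcongr
          exact (ContinuousLinearMap.le_opNorm _ _).trans (by gcongr; exact hC k _)
    _ = _ := by ring

theorem intervalIntegral_fst {f : ℝ → Plane × Plane} {a b : ℝ}
    (hf : IntervalIntegrable f volume a b) : (∫ t in a..b, f t).1 = ∫ t in a..b, (f t).1 :=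
  ((ContinuousLinearMap.fst ℝ Plane Plane).intervalIntegral_comp_comm hf).symm

theorem intervalIntegral_snd {f : ℝ → Plane × Plane} {a b : ℝ}
    (hf : IntervalIntegrable f volume a b) : (∫ t in a..b, f t).2 = ∫ t in a..b, (f t).2 :=
  ((ContinuousLinearMap.snd ℝ Plane Plane).intervalIntegral_comp_comm hf).symm

/-- A priori bound for the tangent component. -/
theorem norm_snd_le_of_solvesAffine {g : Fin N → Plane → ℝ} {b : ContDiffBump (0 : Plane)}
    (hcont : Continuous (stateField g b)) {C : ℝ} (hC0 : 0 ≤ C)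
    (hC : ∀ p c, ‖(stateField g b p c).2‖ ≤ C * ‖c‖ * ‖p.2‖) {T : ℝ} (hT : 0 ≤ T)
    {u : ℝ → EuclideanSpace ℝ (Fin N)} (hu : IntervalIntegrable u volume 0 T)
    {Y₀ : Plane × Plane} {Y : ℝ → Plane × Plane} (hY : SolvesAffine T u (stateField g b) Y₀ Y) :
    ∀ t ∈ Icc 0 T, ‖(Y t).2‖ ≤ ‖Y₀.2‖ * Real.exp (C * ∫ τ in (0 : ℝ)..T, ‖u τ‖) := by
  intro t ht
  have hL : IntervalIntegrable (fun τ => C * ‖u τ‖) volume 0 T := hu.norm.const_mul _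
  have hYc : ContinuousOn (fun t => ‖(Y t).2‖) (Icc 0 T) :=
    (continuous_snd.comp_continuousOn hY.continuousOn).norm
  refine (gronwall_integral (r := ‖Y₀.2‖) hT hL (fun t _ => by positivity) hYc
    (fun t ht => ?_) t ht).trans ?_
  · rw [hY.eq_integral t ht, Prod.snd_add,
      intervalIntegral_snd ((hY.intervalIntegrable hT hu hcont).mono_Icc ht)]
    refine (norm_add_le _ _).trans (add_le_add le_rfl ?_)
    exact intervalIntegral.norm_integral_le_of_norm_le ht.1
      (Eventually.of_forall fun τ _ => hC _ _)
      ((hL.mul_continuousOn (by rwa [uIcc_of_le hT])).mono_Icc ht)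
  · rw [← intervalIntegral.integral_const_mul]
    gcongr
    exact intervalIntegral.integral_mono_interval le_rfl ht.1 ht.2
      (Eventually.of_forall fun τ => by positivity) hL

variable {h g : Fin N → Plane → ℝ} {T : ℝ} {γ₀ : ℝ → Plane} {u : Control T N}
  {X a : ℝ → ℝ → Plane}

/-- Transfers uniqueness, bounds and stability from the globally Lipschitz cut-off system to states:
along a state the cut-off equals `1`, and on the closed domain the extensions have the derivatives
of `h`. -/
theorem IsState.solvesAffine (hΩ : IsBoundedC2Domain Ω)
    (hg : ∀ k, IsSmoothExtension Ω (h k) (g k)) (hX : IsState Ω T γ₀ (streamFunction h u) X a)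
    {b : ContDiffBump (0 : Plane)} (hb : ∀ t ∈ Icc 0 T, ∀ s ∈ Icc (0 : ℝ) 1, ‖a t s‖ ≤ b.rIn) :
    ∀ s ∈ Icc (0 : ℝ) 1, SolvesAffine T u (stateField g b) (γ₀ s, derivWithin γ₀ (Icc 0 1) s)
      (fun t => (X t s, a t s)) := by
  intro s hs
  have hXs := hX.solves_X s hs
  have has := hX.solves_a s hs
  refine ⟨hXs.1.prodMk has.1, fun t ht => ?_⟩
  have h1 : ∀ τ ∈ uIcc 0 t, stateField g b (X τ s, a τ s) (u τ) =
      (perpGrad (closure Ω) (streamFunction h u τ) (X τ s),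
        perpHess (closure Ω) (streamFunction h u τ) (X τ s) (a τ s)) := fun τ hτ => by
    rw [uIcc_of_le ht.1] at hτ
    have hτ' : τ ∈ Icc 0 T := ⟨hτ.1, hτ.2.trans ht.2⟩
    have hmem := hX.mem_closure τ hτ' s hs
    have hb1 : b (a τ s) = 1 :=
      b.one_of_mem_closedBall (by rw [mem_closedBall_zero_iff]; exact hb τ hτ' s hs)
    ext1
    · rw [stateField_apply_fst, perpGrad_streamFunction hΩ hg u τ hmem, hb1, one_smul]
    · rw [stateField_apply_snd, perpHess_streamFunction hΩ hg u τ hmem, hb1, one_smul]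
  rw [intervalIntegral.integral_congr h1]
  have h2 := IntervalIntegrable.mono_Icc hXs.2.1 ht
  have h3 := IntervalIntegrable.mono_Icc has.2.1 ht
  have h4 : IntervalIntegrable (fun τ => (perpGrad (closure Ω) (streamFunction h u τ) (X τ s),
      perpHess (closure Ω) (streamFunction h u τ) (X τ s) (a τ s))) volume 0 t :=
    ⟨h2.1.prodMk h3.1, h2.2.prodMk h3.2⟩
  ext1
  · rw [Prod.fst_add, intervalIntegral_fst h4]
    exact hXs.2.2 t ht
  · rw [Prod.snd_add, intervalIntegral_snd h4]
    exact has.2.2 t ht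

theorem IsState.exists_bound (hX : IsState Ω T γ₀ (streamFunction h u) X a) :
    ∃ A, ∀ t ∈ Icc 0 T, ∀ s ∈ Icc (0 : ℝ) 1, ‖a t s‖ ≤ A := by
  obtain ⟨A, hA⟩ := (isCompact_Icc.prod isCompact_Icc).exists_bound_of_continuousOn
    hX.continuousOn_a
  exact ⟨A, fun t ht s hs => hA (t, s) ⟨ht, hs⟩⟩

theorem exists_contDiffBump_rIn_ge (A : ℝ) : ∃ b : ContDiffBump (0 : Plane), A ≤ b.rIn :=
  ⟨⟨max A 1, max A 1 + 1, by positivity, by linarith⟩, le_max_left _ _⟩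

/-- Solutions of the cut-off system which stay in the range where the cut-off is inactive are
solutions of the state system. -/
theorem isState_of_solvesAffine (hΩ : IsBoundedC2Domain Ω) (hT : 0 ≤ T)
    (hg : ∀ k, IsSmoothExtension Ω (h k) (g k)) (hgc : ∀ k, HasCompactSupport (g k))
    (hh : ∀ k, MemH10 Ω (h k)) (hγ : ContinuousOn γ₀ (Icc 0 1))
    (hγ' : ContinuousOn (derivWithin γ₀ (Icc 0 1)) (Icc 0 1))
    (hγΩ : MapsTo γ₀ (Icc 0 1) (closure Ω)) {b : ContDiffBump (0 : Plane)}
    {Y : ℝ → ℝ → Plane × Plane}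
    (hY : ∀ s ∈ Icc (0 : ℝ) 1, SolvesAffine T u (stateField g b)
      (γ₀ s, derivWithin γ₀ (Icc 0 1) s) (fun t => Y t s))
    (hb : ∀ t ∈ Icc 0 T, ∀ s ∈ Icc (0 : ℝ) 1, ‖(Y t s).2‖ ≤ b.rIn) :
    IsState Ω T γ₀ (streamFunction h u) (fun t s => (Y t s).1) (fun t s => (Y t s).2) := by
  obtain ⟨K, hK⟩ := exists_lipschitzWith_stateField (fun k => (hg k).1) hgc b
  obtain ⟨K', hK'⟩ := exists_lipschitzWith_velocity (fun k => (hg k).1) hgc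
  have hu := intervalIntegrable_of_lp hT u
  have hcont := SolvesAffine.continuousOn_prod hY hT hu hK (hγ.prodMk hγ')
  have hb1 : ∀ t ∈ Icc 0 T, ∀ s ∈ Icc (0 : ℝ) 1, b (Y t s).2 = 1 := fun t ht s hs =>
    b.one_of_mem_closedBall (by rw [mem_closedBall_zero_iff]; exact hb t ht s hs)
  have hint := fun s hs => (hY s hs).intervalIntegrable hT hu hK.continuous
  have hXs : ∀ s ∈ Icc (0 : ℝ) 1,
      SolvesAffine T u (velocity g) (γ₀ s) (fun t => (Y t s).1) := fun s hs => by
    refine ⟨continuous_fst.comp_continuousOn (hY s hs).continuousOn, fun t ht => ?_⟩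
    rw [(hY s hs).eq_integral t ht, Prod.fst_add, intervalIntegral_fst ((hint s hs).mono_Icc ht)]
    congr 1
    refine intervalIntegral.integral_congr fun τ hτ => ?_
    rw [uIcc_of_le ht.1] at hτ
    simp only [stateField_apply_fst, hb1 τ ⟨hτ.1, hτ.2.trans ht.2⟩ s hs, one_smul]
  have hmem : ∀ t ∈ Icc 0 T, ∀ s ∈ Icc (0 : ℝ) 1, (Y t s).1 ∈ closure Ω := fun t ht s hs =>
    solvesAffine_velocity_mem_closure hΩ hg hgc hh hu (hγΩ hs) (hXs s hs) t ht
  have heq : ∀ t ∈ Icc 0 T, ∀ s ∈ Icc (0 : ℝ) 1, (stateField g b (Y t s) (u t)).2 =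
      perpHess (closure Ω) (streamFunction h u t) (Y t s).1 (Y t s).2 := fun t ht s hs => by
    rw [stateField_apply_snd, hb1 t ht s hs, one_smul,
      perpHess_streamFunction hΩ hg u t (hmem t ht s hs)]
  refine ⟨continuous_fst.comp_continuousOn hcont, continuous_snd.comp_continuousOn hcont, hmem,
    fun s hs => (hXs s hs).solvesIVP hT hu hK'.continuous fun t ht =>
      perpGrad_streamFunction hΩ hg u t (hmem t ht s hs), fun s hs => ⟨?_, ?_, fun t ht => ?_⟩⟩
  · exact continuous_snd.comp_continuousOn (hY s hs).continuousOn
  · have h1 : IntervalIntegrable (fun t => (stateField g b (Y t s) (u t)).2) volume 0 T :=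
      ⟨(hint s hs).1.snd, (hint s hs).2.snd⟩
    refine IntervalIntegrable.congr (fun t ht => ?_) h1
    rw [uIoc_of_le hT] at ht
    exact heq t (Ioc_subset_Icc_self ht) s hs
  · beta_reduce
    rw [(hY s hs).eq_integral t ht, Prod.snd_add, intervalIntegral_snd ((hint s hs).mono_Icc ht)]
    congr 1
    refine intervalIntegral.integral_congr fun τ hτ => ?_
    rw [uIcc_of_le ht.1] at hτ
    exact heq τ ⟨hτ.1, hτ.2.trans ht.2⟩ s hs

/-- The state system has a solution. -/
theorem exists_isState (hΩ : IsBoundedC2Domain Ω) (hT : 0 ≤ T)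
    (hs : ∀ k, SmoothUpToBoundary Ω (h k)) (hh : ∀ k, MemH10 Ω (h k))
    (hγ : ContinuousOn γ₀ (Icc 0 1))
    (hγ' : ContinuousOn (derivWithin γ₀ (Icc 0 1)) (Icc 0 1))
    (hγΩ : MapsTo γ₀ (Icc 0 1) (closure Ω)) (u : Control T N) :
    ∃ X a : ℝ → ℝ → Plane, IsState Ω T γ₀ (streamFunction h u) X a := by
  obtain ⟨g, hg, hgc⟩ := exists_compactSupport_extension hΩ hs
  have hgs := fun k => (hg k).1
  obtain ⟨C, hC0, hC⟩ := exists_norm_stateField_snd_le hgs hgc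
  obtain ⟨A, hA⟩ := isCompact_Icc.exists_bound_of_continuousOn hγ'
  -- The inner radius dominates the a priori bound for `a`, so the solution of the cut-off system
  -- never meets the cut-off.
  obtain ⟨b, hb⟩ := exists_contDiffBump_rIn_ge (A * Real.exp (C * ∫ τ in (0 : ℝ)..T, ‖u τ‖))
  obtain ⟨K, hK⟩ := exists_lipschitzWith_stateField hgs hgc b
  have hu := intervalIntegrable_of_lp hT u
  choose Y hY using fun s => exists_solvesAffine hT hu hK (γ₀ s, derivWithin γ₀ (Icc 0 1) s)
  refine ⟨_, _, isState_of_solvesAffine (Y := fun t s => Y s t) hΩ hT hg hgc hh hγ hγ' hγΩ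
    (fun s _ => hY s) fun t ht s hs => ?_⟩
  refine (norm_snd_le_of_solvesAffine hK.continuous hC0 (hC b) hT hu (hY s) t ht).trans
    (le_trans ?_ hb)
  gcongr
  exact hA s hs

/-- The solution of the state system is unique. -/
theorem IsState.unique (hΩ : IsBoundedC2Domain Ω) (hT : 0 ≤ T)
    (hs : ∀ k, SmoothUpToBoundary Ω (h k)) (hX : IsState Ω T γ₀ (streamFunction h u) X a)
    {X' a' : ℝ → ℝ → Plane} (hX' : IsState Ω T γ₀ (streamFunction h u) X' a') :
    ∀ t ∈ Icc 0 T, ∀ s ∈ Icc (0 : ℝ) 1, X' t s = X t s ∧ a' t s = a t s := by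
  obtain ⟨g, hg, hgc⟩ := exists_compactSupport_extension hΩ hs
  obtain ⟨A, hA⟩ := hX.exists_bound
  obtain ⟨A', hA'⟩ := hX'.exists_bound
  -- One cut-off inactive along both states makes them solutions of the same Lipschitz system.
  obtain ⟨b, hb⟩ := exists_contDiffBump_rIn_ge (max A A')
  obtain ⟨K, hK⟩ := exists_lipschitzWith_stateField (fun k => (hg k).1) hgc b
  intro t ht s hs
  have h1 := hX.solvesAffine hΩ hg
    (fun t ht s hs => (hA t ht s hs).trans ((le_max_left _ _).trans hb)) s hs
  have h2 := hX'.solvesAffine hΩ hg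
    (fun t ht s hs => (hA' t ht s hs).trans ((le_max_right _ _).trans hb)) s hs
  exact Prod.mk.inj (h2.eqOn h1 hT (intervalIntegrable_of_lp hT u) hK ht)

/-- The tangent component is bounded in terms of the norm of the control. -/
theorem exists_bound_tangent (hΩ : IsBoundedC2Domain Ω) (hT : 0 ≤ T)
    (hs : ∀ k, SmoothUpToBoundary Ω (h k))
    (hγ' : ContinuousOn (derivWithin γ₀ (Icc 0 1)) (Icc 0 1)) (R : ℝ) :
    ∃ A, ∀ (u : Control T N) (X a : ℝ → ℝ → Plane), ‖u‖ ≤ R →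
      IsState Ω T γ₀ (streamFunction h u) X a →
      ∀ t ∈ Icc 0 T, ∀ s ∈ Icc (0 : ℝ) 1, ‖a t s‖ ≤ A := by
  obtain ⟨g, hg, hgc⟩ := exists_compactSupport_extension hΩ hs
  have hgs := fun k => (hg k).1
  obtain ⟨C, hC0, hC⟩ := exists_norm_stateField_snd_le hgs hgc
  obtain ⟨A, hA⟩ := isCompact_Icc.exists_bound_of_continuousOn hγ'
  refine ⟨A * Real.exp (C * (√T * R)), fun u X a huR hX t ht s hs => ?_⟩
  -- The cut-off may depend on the particular state: only `C` enters the final bound, and `C` is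
  -- independent of it.
  obtain ⟨A', hA'⟩ := hX.exists_bound
  obtain ⟨b, hb⟩ := exists_contDiffBump_rIn_ge A'
  obtain ⟨K, hK⟩ := exists_lipschitzWith_stateField hgs hgc b
  have h1 := hX.solvesAffine hΩ hg (fun t ht s hs => (hA' t ht s hs).trans hb) s hs
  refine (norm_snd_le_of_solvesAffine hK.continuous hC0 (hC b) hT (intervalIntegrable_of_lp hT u)
    h1 t ht).trans ?_
  have hA0 : 0 ≤ A := (norm_nonneg _).trans (hA s hs)
  gcongr
  · exact hA s hs
  · exact (integral_norm_le_of_lp hT u).trans (by gcongr)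

/-- The state depends continuously on the control in the weak topology. -/
theorem tendsto_tangent_of_weak (hΩ : IsBoundedC2Domain Ω) (hT : 0 ≤ T)
    (hs : ∀ k, SmoothUpToBoundary Ω (h k))
    (hγ' : ContinuousOn (derivWithin γ₀ (Icc 0 1)) (Icc 0 1)) {w : ℕ → Control T N} {R : ℝ}
    (hR : ∀ n, ‖w n‖ ≤ R)
    (hweak : ∀ ℓ : Control T N →L[ℝ] ℝ, Tendsto (fun n => ℓ (w n)) atTop (𝓝 (ℓ u)))
    (hX : IsState Ω T γ₀ (streamFunction h u) X a) {Xs as : ℕ → ℝ → ℝ → Plane}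
    (hXs : ∀ n, IsState Ω T γ₀ (streamFunction h (w n)) (Xs n) (as n)) :
    ∀ t ∈ Icc 0 T, ∀ s ∈ Icc (0 : ℝ) 1, Tendsto (fun n => as n t s) atTop (𝓝 (a t s)) := by
  intro t ht s hs'
  obtain ⟨g, hg, hgc⟩ := exists_compactSupport_extension hΩ hs
  -- A bound uniform in `n`, so that a single cut-off serves the whole sequence and its limit.
  obtain ⟨A, hA⟩ := exists_bound_tangent (N := N) hΩ hT hs hγ' (max R ‖u‖)
  obtain ⟨b, hb⟩ := exists_contDiffBump_rIn_ge A
  obtain ⟨K, hK⟩ := exists_lipschitzWith_stateField (fun k => (hg k).1) hgc b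
  have h1 := hX.solvesAffine hΩ hg
    (fun t ht s hs => (hA u X a (le_max_right _ _) hX t ht s hs).trans hb) s hs'
  have h2 := fun n => (hXs n).solvesAffine hΩ hg (fun t ht s hs =>
    (hA (w n) _ _ ((hR n).trans (le_max_left _ _)) (hXs n) t ht s hs).trans hb) s hs'
  exact (continuous_snd.tendsto _).comp (SolvesAffine.tendsto_of_weak hT hK hR hweak h1 h2 t ht)

end State

/-! ### Minimization of weakly lower semicontinuous functionals -/

section Minimization

variable {V W : Type*} [NormedAddCommGroup V] [InnerProductSpace ℝ V]
  [NormedAddCommGroup W] [InnerProductSpace ℝ W]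

/-- Bounded sequences in a separable Hilbert space have weakly convergent subsequences. -/
theorem exists_weak_subseq [CompleteSpace V] [TopologicalSpace.SeparableSpace V] {R : ℝ} {w : ℕ → V}
    (hw : ∀ n, ‖w n‖ ≤ R) : ∃ u : V, ‖u‖ ≤ R ∧ ∃ φ : ℕ → ℕ, StrictMono φ ∧
      ∀ ℓ : V →L[ℝ] ℝ, Tendsto (fun n => ℓ (w (φ n))) atTop (𝓝 (ℓ u)) := by
  -- The Riesz isomorphism turns weak convergence in `V` into weak-* convergence in its dual, where
  -- sequential Banach–Alaoglu applies.
  obtain ⟨p, hp, φ, hφ, hlim⟩ := WeakDual.isSeqCompact_closedBall ℝ V 0 R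
    (x := fun n => StrongDual.toWeakDual (InnerProductSpace.toDual ℝ V (w n)))
    (fun n => by simpa using hw n)
  refine ⟨(InnerProductSpace.toDual ℝ V).symm (WeakDual.toStrongDual p), by simpa using hp,
    φ, hφ, fun ℓ => ?_⟩
  have h1 := (WeakDual.eval_continuous ((InnerProductSpace.toDual ℝ V).symm ℓ)).tendsto p |>.comp
    hlim
  have h2 : ∀ v : V, ℓ v = inner ℝ v ((InnerProductSpace.toDual ℝ V).symm ℓ) := fun v => by
    rw [real_inner_comm, InnerProductSpace.toDual_symm_apply]
  simp only [h2, InnerProductSpace.toDual_symm_apply]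
  exact h1

/-- `A` is sequentially continuous on bounded sets for the weak topology. -/
def WeakSeqContinuous (A : V → ℝ) : Prop :=
  ∀ (R : ℝ) (u : V) (w : ℕ → V), (∀ n, ‖w n‖ ≤ R) →
    (∀ ℓ : V →L[ℝ] ℝ, Tendsto (fun n => ℓ (w n)) atTop (𝓝 (ℓ u))) →
    Tendsto (fun n => A (w n)) atTop (𝓝 (A u))

/-- A norm-convergent sequence is bounded and converges weakly. -/
theorem WeakSeqContinuous.continuous {A : V → ℝ} (hA : WeakSeqContinuous A) : Continuous A := by
  rw [continuous_iff_seqContinuous]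
  intro w u hw
  obtain ⟨R, hR⟩ := hw.norm.bddAbove_range
  exact hA R u w (fun n => hR (mem_range_self n)) fun ℓ => (ℓ.continuous.tendsto u).comp hw

theorem WeakSeqContinuous.continuous_add {A : V → ℝ} (hA : WeakSeqContinuous A) (L : V →L[ℝ] W)
    (c : ℝ) : Continuous fun v => A v + c * ‖L v‖ ^ 2 :=
  hA.continuous.add ((L.continuous.norm.pow 2).const_mul c)

/-- Direct method. The quadratic term is handled by `‖L v‖² ≥ ‖L u‖² + 2⟨L u, L v - L u⟩`, whose
right side is weakly continuous in `v`. -/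
theorem WeakSeqContinuous.exists_minimizer [CompleteSpace V] [TopologicalSpace.SeparableSpace V]
    {A : V → ℝ} (hA : WeakSeqContinuous A) (L : V →L[ℝ] W) {c R : ℝ} (hc : 0 ≤ c) (hR : 0 ≤ R) :
    ∃ u : V, ‖u‖ ≤ R ∧ ∀ v : V, ‖v‖ ≤ R → A u + c * ‖L u‖ ^ 2 ≤ A v + c * ‖L v‖ ^ 2 := by
  set f : V → ℝ := fun v => A v + c * ‖L v‖ ^ 2
  -- In `EReal` the infimum exists and has a minimizing sequence without a prior lower bound for
  -- `f`; finiteness comes out of the argument.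
  set S : Set EReal := (fun v => (f v : EReal)) '' Metric.closedBall 0 R
  have hS : S.Nonempty := ⟨_, 0, by simpa using hR, rfl⟩
  obtain ⟨x, -, hx, hxS⟩ := exists_seq_tendsto_sInf hS (OrderBot.bddBelow S)
  choose w hw hwx using hxS
  obtain ⟨u, hu, φ, hφ, hweak⟩ := exists_weak_subseq fun n => mem_closedBall_zero_iff.1 (hw n)
  refine ⟨u, hu, fun v hv => ?_⟩
  have hlow : ∀ n, A (w (φ n)) + c * (‖L u‖ ^ 2 + 2 * (inner ℝ (L u) (L (w (φ n))) -
      inner ℝ (L u) (L u))) ≤ f (w (φ n)) := fun n => by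
    have h1 := norm_sub_sq_real (L (w (φ n))) (L u)
    have h2 : 0 ≤ ‖L (w (φ n)) - L u‖ ^ 2 := by positivity
    rw [real_inner_comm] at h1
    simp only [f, real_inner_self_eq_norm_sq]
    gcongr
    linarith
  have hlim : Tendsto (fun n => A (w (φ n)) + c * (‖L u‖ ^ 2 +
      2 * (inner ℝ (L u) (L (w (φ n))) - inner ℝ (L u) (L u)))) atTop (𝓝 (f u)) := by
    have h1 := hA R u _ (fun n => mem_closedBall_zero_iff.1 (hw (φ n))) hweak
    have h2 := hweak ((innerSL ℝ (L u)).comp L)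
    simp only [ContinuousLinearMap.comp_apply, innerSL_apply_apply] at h2
    have h3 := h1.add ((((h2.sub_const (inner ℝ (L u) (L u))).const_mul 2).const_add
      (‖L u‖ ^ 2)).const_mul c)
    simpa [f] using h3
  have hle : (f u : EReal) ≤ sInf S := by
    refine le_of_tendsto_of_tendsto' ((continuous_coe_real_ereal.tendsto _).comp hlim)
      (hx.comp hφ.tendsto_atTop) fun n => ?_
    simp only [Function.comp_apply, ← hwx]
    exact_mod_cast hlow n
  have := hle.trans (sInf_le ⟨v, mem_closedBall_zero_iff.2 hv, rfl⟩)
  exact EReal.coe_le_coe_iff.1 this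

end Minimization

/-! ### The kinetic part of the cost -/

section StreamOperator

variable {Ω : Set Plane} {N : ℕ} {h : Fin N → Plane → ℝ} {T : ℝ}

theorem SmoothUpToBoundary.continuousOn {f : Plane → ℝ} (hf : SmoothUpToBoundary Ω f) :
    ContinuousOn f (closure Ω) := by
  obtain ⟨g, hg, hgf⟩ := hf
  exact hg.continuous.continuousOn.congr hgf.symm

theorem SmoothUpToBoundary.memLp (hΩ : IsBoundedC2Domain Ω) {f : Plane → ℝ}
    (hf : SmoothUpToBoundary Ω f) : MemLp f 2 (volume.restrict Ω) := by
  have hK : IsCompact (closure Ω) := hΩ.isBounded.isCompact_closure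
  obtain ⟨C, hC⟩ := hK.exists_bound_of_continuousOn hf.continuousOn
  have : IsFiniteMeasure (volume.restrict Ω) := ⟨by simpa using hΩ.isBounded.measure_lt_top⟩
  refine MemLp.of_bound ((hf.continuousOn.mono subset_closure).aestronglyMeasurable
    hΩ.isOpen.measurableSet) C ?_
  filter_upwards [ae_restrict_mem hΩ.isOpen.measurableSet] with x hx
  exact hC x (subset_closure hx)

/-- Acting pointwise in time, `H` gives the bounded operator `L` for which the kinetic term is a
multiple of `‖L u‖²`. -/
theorem exists_streamOperator (hΩ : IsBoundedC2Domain Ω)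
    (hs : ∀ k, SmoothUpToBoundary Ω (h k)) :
    ∃ H : EuclideanSpace ℝ (Fin N) →L[ℝ] Lp ℝ 2 (volume.restrict Ω),
      ∀ c, H c =ᵐ[volume.restrict Ω] fun x => ∑ k, c k * h k x := by
  refine ⟨∑ k, (EuclideanSpace.proj k : EuclideanSpace ℝ (Fin N) →L[ℝ] ℝ).smulRight
    (((hs k).memLp hΩ).toLp (h k)), fun c => ?_⟩
  have h1 : ∀ᵐ x ∂volume.restrict Ω, ∀ k,
      (c k • ((hs k).memLp hΩ).toLp (h k) : Lp ℝ 2 (volume.restrict Ω)) x = c k * h k x := by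
    rw [ae_all_iff]
    intro k
    filter_upwards [Lp.coeFn_smul (c k) (((hs k).memLp hΩ).toLp (h k)),
      ((hs k).memLp hΩ).coeFn_toLp] with x h2 h3
    rw [h2, Pi.smul_apply, h3, smul_eq_mul]
  have h4 := Lp.coeFn_finsetSum (p := 2) (μ := volume.restrict Ω) Finset.univ
    (fun k => c k • ((hs k).memLp hΩ).toLp (h k))
  filter_upwards [h1, h4] with x h1 h4
  simpa [sum_apply, h1] using h4

/-- A combination that vanishes almost everywhere on the open set `Ω` vanishes everywhere there by
continuity, so independence as functions gives independence in `L²(Ω)`. -/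
theorem ker_eq_bot_of_linearIndependent (hΩ : IsBoundedC2Domain Ω)
    (hs : ∀ k, SmoothUpToBoundary Ω (h k))
    (hi : LinearIndependent ℝ (fun k => Ω.domRestrict (h k)))
    {H : EuclideanSpace ℝ (Fin N) →L[ℝ] Lp ℝ 2 (volume.restrict Ω)}
    (hH : ∀ c, H c =ᵐ[volume.restrict Ω] fun x => ∑ k, c k * h k x) :
    (H : EuclideanSpace ℝ (Fin N) →ₗ[ℝ] Lp ℝ 2 (volume.restrict Ω)).ker = ⊥ := by
  rw [LinearMap.ker_eq_bot']
  intro c hc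
  have h1 : (fun x => ∑ k, c k * h k x) =ᵐ[volume.restrict Ω] fun _ => (0 : ℝ) := by
    refine (hH c).symm.trans ?_
    rw [show H c = 0 from hc]
    exact Lp.coeFn_zero _ _ _
  have h2 := Measure.eqOn_open_of_ae_eq h1 hΩ.isOpen (continuousOn_finsetSum _ fun k _ =>
    continuousOn_const.mul ((hs k).continuousOn.mono subset_closure)) continuousOn_const
  have h3 := Fintype.linearIndependent_iff.1 hi c (by
    ext x
    simpa [Finset.sum_apply] using h2 x.2)
  ext k
  exact h3 k

theorem integral_sq_eq_norm_sq {H : EuclideanSpace ℝ (Fin N) →L[ℝ] Lp ℝ 2 (volume.restrict Ω)}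
    (hH : ∀ c, H c =ᵐ[volume.restrict Ω] fun x => ∑ k, c k * h k x)
    (c : EuclideanSpace ℝ (Fin N)) :
    ∫ x in Ω, (∑ k, c k * h k x) ^ 2 = ‖H c‖ ^ 2 := by
  rw [norm_sq_eq_integral]
  refine integral_congr_ae ?_
  filter_upwards [hH c] with x hx
  rw [hx, Real.norm_eq_abs, sq_abs]

theorem intervalIntegral_integral_sq_sub (hT : 0 ≤ T)
    {H : EuclideanSpace ℝ (Fin N) →L[ℝ] Lp ℝ 2 (volume.restrict Ω)}
    (hH : ∀ c, H c =ᵐ[volume.restrict Ω] fun x => ∑ k, c k * h k x) (w u : Control T N) :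
    ∫ t in (0 : ℝ)..T, ∫ x in Ω, (streamFunction h w t x - streamFunction h u t x) ^ 2 =
      ‖H.compLpL 2 (volume.restrict (Ioo 0 T)) (w - u)‖ ^ 2 := by
  rw [intervalIntegral_eq_setIntegral_Ioo hT, norm_sq_eq_integral]
  refine integral_congr_ae ?_
  filter_upwards [H.coeFn_compLpL (p := 2) (w - u), Lp.coeFn_sub w u] with t h1 h2
  rw [h1, h2, ← integral_sq_eq_norm_sq hH]
  simp [streamFunction, sub_mul]

theorem intervalIntegral_integral_sq (hT : 0 ≤ T)
    {H : EuclideanSpace ℝ (Fin N) →L[ℝ] Lp ℝ 2 (volume.restrict Ω)}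
    (hH : ∀ c, H c =ᵐ[volume.restrict Ω] fun x => ∑ k, c k * h k x) (u : Control T N) :
    ∫ t in (0 : ℝ)..T, ∫ x in Ω, streamFunction h u t x ^ 2 =
      ‖H.compLpL 2 (volume.restrict (Ioo 0 T)) u‖ ^ 2 := by
  rw [intervalIntegral_eq_setIntegral_Ioo hT, norm_sq_eq_integral]
  refine integral_congr_ae ?_
  filter_upwards [H.coeFn_compLpL (p := 2) u] with t h1
  rw [h1, ← integral_sq_eq_norm_sq hH]
  rfl

theorem memLp_streamFunction (hΩ : IsBoundedC2Domain Ω)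
    (hs : ∀ k, SmoothUpToBoundary Ω (h k)) (u : Control T N) (t : ℝ) :
    MemLp (streamFunction h u t) 2 (volume.restrict Ω) :=
  memLp_finsetSum _ fun k _ => ((hs k).memLp hΩ).const_mul (u t k)

theorem intervalIntegrable_integral_sq (hΩ : IsBoundedC2Domain Ω) (hT : 0 ≤ T)
    (hs : ∀ k, SmoothUpToBoundary Ω (h k)) (u : Control T N) :
    IntervalIntegrable (fun t => ∫ x in Ω, streamFunction h u t x ^ 2) volume 0 T := by
  obtain ⟨H, hH⟩ := exists_streamOperator hΩ hs
  rw [intervalIntegrable_iff_integrableOn_Ioo_of_le hT]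
  refine ((H.comp_memLp' (Lp.memLp u)).norm.integrable_sq).congr (Eventually.of_forall fun t => ?_)
  exact (integral_sq_eq_norm_sq hH (u t)).symm

theorem norm_le_mul_norm_compLpL {V W α : Type*} [NormedAddCommGroup V] [NormedSpace ℝ V]
    [NormedAddCommGroup W] [NormedSpace ℝ W] [MeasurableSpace α] {μ : Measure α} (L : V →L[ℝ] W)
    {K : ℝ} (hK : ∀ c, ‖c‖ ≤ K * ‖L c‖) (u : Lp V 2 μ) :
    ‖u‖ ≤ K * ‖L.compLpL 2 μ u‖ := by
  refine Lp.norm_le_mul_norm_of_ae_le_mul ?_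
  filter_upwards [L.coeFn_compLpL (p := 2) u] with t ht
  rw [ht]
  exact hK (u t)

theorem exists_norm_le_mul_norm (hΩ : IsBoundedC2Domain Ω)
    (hs : ∀ k, SmoothUpToBoundary Ω (h k))
    (hi : LinearIndependent ℝ (fun k => Ω.domRestrict (h k)))
    {H : EuclideanSpace ℝ (Fin N) →L[ℝ] Lp ℝ 2 (volume.restrict Ω)}
    (hH : ∀ c, H c =ᵐ[volume.restrict Ω] fun x => ∑ k, c k * h k x) :
    ∃ K : ℝ, ∀ c, ‖c‖ ≤ K * ‖H c‖ := by
  obtain ⟨K, -, hK⟩ := LinearMap.exists_antilipschitzWith _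
    (ker_eq_bot_of_linearIndependent hΩ hs hi hH)
  exact ⟨K, fun c => by simpa using hK.le_mul_dist c 0⟩

/-- Convergence of the stream functions in `L²(0,T;L²(Ω))` implies convergence of the controls. -/
theorem tendsto_of_tendsto_streamFunction (hΩ : IsBoundedC2Domain Ω) (hT : 0 ≤ T)
    (hs : ∀ k, SmoothUpToBoundary Ω (h k))
    (hi : LinearIndependent ℝ (fun k => Ω.domRestrict (h k))) {u : Control T N}
    {w : ℕ → Control T N}
    (hw : Tendsto (fun n => ∫ t in (0 : ℝ)..T, ∫ x in Ω,
        (streamFunction h (w n) t x - streamFunction h u t x) ^ 2) atTop (𝓝 0)) :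
    Tendsto w atTop (𝓝 u) := by
  obtain ⟨H, hH⟩ := exists_streamOperator hΩ hs
  obtain ⟨K, hK⟩ := exists_norm_le_mul_norm hΩ hs hi hH
  have hw' := hw.sqrt.const_mul K
  rw [Real.sqrt_zero, mul_zero] at hw'
  rw [tendsto_iff_norm_sub_tendsto_zero]
  refine squeeze_zero (fun _ => norm_nonneg _) (fun n => ?_) hw'
  rw [intervalIntegral_integral_sq_sub hT hH, Real.sqrt_sq (norm_nonneg _)]
  exact norm_le_mul_norm_compLpL H hK (w n - u)

end StreamOperator

/-! ### The length part of the cost -/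

section Length

variable {Ω : Set Plane} {N : ℕ} {h : Fin N → Plane → ℝ} {T : ℝ} {γ₀ : ℝ → Plane}

theorem continuous_ell (ε : ℝ) : Continuous (ell ε) := by
  unfold ell
  fun_prop

theorem IsState.continuousOn_ell {ψ : ℝ → Plane → ℝ} {X a : ℝ → ℝ → Plane}
    (hX : IsState Ω T γ₀ ψ X a) (hT : 0 ≤ T) (ε : ℝ) :
    ContinuousOn (fun s => ell ε (a T s)) (Icc 0 1) := by
  have h1 : ContinuousOn (fun s : ℝ => (T, s)) (Icc 0 1) := by fun_prop
  exact (continuous_ell ε).comp_continuousOn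
    (hX.continuousOn_a.comp h1 fun s hs => ⟨⟨hT, le_rfl⟩, hs⟩)

theorem exists_isState_tangent {ψ : ℝ → Plane → ℝ}
    (H : ∃ X a : ℝ → ℝ → Plane, IsState Ω T γ₀ ψ X a) :
    ∃ X, IsState Ω T γ₀ ψ X (tangent Ω T γ₀ ψ) := by
  obtain ⟨X, a, hX⟩ := H
  have H : ∃ p : (ℝ → ℝ → Plane) × (ℝ → ℝ → Plane), IsState Ω T γ₀ ψ p.1 p.2 := ⟨(X, a), hX⟩
  rw [tangent, dif_pos H]
  exact ⟨_, H.choose_spec⟩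

/-- `tangent` is picked by choice; uniqueness of the state makes the cost independent of the pick.
-/
theorem cost_eq_costOfState (hΩ : IsBoundedC2Domain Ω) (hT : 0 ≤ T)
    (hs : ∀ k, SmoothUpToBoundary Ω (h k)) {u : Control T N} {X a : ℝ → ℝ → Plane}
    (hX : IsState Ω T γ₀ (streamFunction h u) X a) (lam ε : ℝ) :
    cost Ω T γ₀ lam ε (streamFunction h u) = costOfState Ω T lam ε (streamFunction h u) a := by
  obtain ⟨X', hX'⟩ := exists_isState_tangent ⟨X, a, hX⟩
  unfold cost costOfState
  congr 2
  refine intervalIntegral.integral_congr fun s hs' => ?_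
  rw [uIcc_of_le zero_le_one] at hs'
  simp only [(hX.unique hΩ hT hs hX' T ⟨hT, le_rfl⟩ s hs').2]

/-- The tangents at time `T` converge for each `s` and are bounded in terms of `R` alone, so
dominated convergence applies in `s`. -/
theorem weakSeqContinuous_length (hΩ : IsBoundedC2Domain Ω) (hT : 0 ≤ T)
    (hs : ∀ k, SmoothUpToBoundary Ω (h k))
    (hγ' : ContinuousOn (derivWithin γ₀ (Icc 0 1)) (Icc 0 1))
    (hex : ∀ u : Control T N, ∃ X a : ℝ → ℝ → Plane, IsState Ω T γ₀ (streamFunction h u) X a)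
    (ε : ℝ) :
    WeakSeqContinuous fun u : Control T N =>
      -∫ s in (0 : ℝ)..1, ell ε (tangent Ω T γ₀ (streamFunction h u) T s) := by
  intro R u w hR hweak
  choose X hX using fun v => exists_isState_tangent (hex v)
  obtain ⟨A, hA⟩ := exists_bound_tangent (N := N) hΩ hT hs hγ' R
  have hTT : T ∈ Icc 0 T := ⟨hT, le_rfl⟩
  refine (intervalIntegral.tendsto_integral_filter_of_dominated_convergence
    (fun _ => √(A ^ 2 + ε ^ 2)) (Eventually.of_forall fun n => ?_) (Eventually.of_forall fun n =>
      Eventually.of_forall fun s hs' => ?_) intervalIntegrable_const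
    (Eventually.of_forall fun s hs' => ?_)).neg
  · rw [uIoc_of_le zero_le_one]
    exact (((hX (w n)).continuousOn_ell hT ε).mono Ioc_subset_Icc_self).aestronglyMeasurable
      measurableSet_Ioc
  · rw [uIoc_of_le zero_le_one] at hs'
    have h1 := hA (w n) _ _ (hR n) (hX (w n)) T hTT s (Ioc_subset_Icc_self hs')
    rw [Real.norm_of_nonneg (by unfold ell; positivity), ell]
    gcongr
  · rw [uIoc_of_le zero_le_one] at hs'
    exact ((continuous_ell ε).tendsto _).comp (tendsto_tangent_of_weak hΩ hT hs hγ' hR hweak (hX u)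
      (fun n => hX (w n)) T hTT s (Ioc_subset_Icc_self hs'))

end Length

/-! ### Regularity, continuity of the cost, and existence of minimizers. -/

section Main

variable {Ω : Set Plane} {N : ℕ} {h : Fin N → Plane → ℝ} {T : ℝ} {γ₀ : ℝ → Plane}

theorem memL2Sobolev_streamFunction (hΩ : IsBoundedC2Domain Ω)
    (hs : ∀ k, SmoothUpToBoundary Ω (h k)) (m : ℕ) (u : Control T N) :
    MemL2Sobolev T Ω m (streamFunction h u) := by
  choose g hg using hs
  refine memL2Sobolev_sum hΩ.isOpen hΩ.isBounded (fun k => (hg k).1) m u fun t x hx => ?_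
  simp only [streamFunction, smul_eq_mul]
  exact Finset.sum_congr rfl fun k _ => by rw [(hg k).2 (subset_closure hx)]

theorem memL2Sobolev_perpGrad_streamFunction (hΩ : IsBoundedC2Domain Ω)
    (hs : ∀ k, SmoothUpToBoundary Ω (h k)) (m : ℕ) (u : Control T N) :
    MemL2Sobolev T Ω m (fun t => perpGrad (closure Ω) (streamFunction h u t)) := by
  choose g hg using hs
  refine memL2Sobolev_sum hΩ.isOpen hΩ.isBounded
    (fun k => J.contDiff.comp (ContDiff.gradient (hg k).1)) m u fun t x hx => ?_
  rw [perpGrad_streamFunction hΩ hg u t (subset_closure hx), velocity_apply]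
  rfl

theorem cost_eq (hT : 0 ≤ T) {H : EuclideanSpace ℝ (Fin N) →L[ℝ] Lp ℝ 2 (volume.restrict Ω)}
    (hH : ∀ c, H c =ᵐ[volume.restrict Ω] fun x => ∑ k, c k * h k x) (lam ε : ℝ)
    (u : Control T N) :
    cost Ω T γ₀ lam ε (streamFunction h u) =
      -(∫ s in (0 : ℝ)..1, ell ε (tangent Ω T γ₀ (streamFunction h u) T s)) +
        lam / 2 * ‖H.compLpL 2 (volume.restrict (Ioo 0 T)) u‖ ^ 2 := by
  rw [← intervalIntegral_integral_sq hT hH]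
  rfl

theorem continuous_cost (hΩ : IsBoundedC2Domain Ω) (hT : 0 ≤ T)
    (hs : ∀ k, SmoothUpToBoundary Ω (h k))
    (hγ' : ContinuousOn (derivWithin γ₀ (Icc 0 1)) (Icc 0 1))
    (hex : ∀ u : Control T N, ∃ X a : ℝ → ℝ → Plane, IsState Ω T γ₀ (streamFunction h u) X a)
    (lam ε : ℝ) : Continuous fun u : Control T N => cost Ω T γ₀ lam ε (streamFunction h u) := by
  obtain ⟨H, hH⟩ := exists_streamOperator hΩ hs
  have hA := weakSeqContinuous_length hΩ hT hs hγ' hex ε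
  exact (hA.continuous_add _ (lam / 2)).congr fun u => (cost_eq hT hH lam ε u).symm

theorem exists_minimizer_cost (hΩ : IsBoundedC2Domain Ω) (hT : 0 ≤ T)
    (hs : ∀ k, SmoothUpToBoundary Ω (h k))
    (hγ' : ContinuousOn (derivWithin γ₀ (Icc 0 1)) (Icc 0 1))
    (hex : ∀ u : Control T N, ∃ X a : ℝ → ℝ → Plane, IsState Ω T γ₀ (streamFunction h u) X a)
    {lam : ℝ} (hlam : 0 ≤ lam) (ε : ℝ) {R : ℝ} (hR : 0 ≤ R) :
    ∃ ψ ∈ Uad T h R, ∀ φ ∈ Uad T h R, cost Ω T γ₀ lam ε ψ ≤ cost Ω T γ₀ lam ε φ := by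
  obtain ⟨H, hH⟩ := exists_streamOperator hΩ hs
  have hA := weakSeqContinuous_length hΩ hT hs hγ' hex ε
  -- Separability of `L²` asks for a finite exponent.
  have : Fact ((2 : ℝ≥0∞) ≠ ⊤) := ⟨ENNReal.ofNat_ne_top⟩
  obtain ⟨u, hu, hmin⟩ := hA.exists_minimizer (H.compLpL 2 (volume.restrict (Ioo 0 T)))
    (div_nonneg hlam zero_le_two) hR
  refine ⟨streamFunction h u, ⟨u, hu, rfl⟩, ?_⟩
  rintro - ⟨v, hv, rfl⟩
  rw [cost_eq hT hH, cost_eq hT hH]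
  exact hmin v hv

end Main

end InterfaceControl

end

open InterfaceControl in
theorem mainTheorem1
    (Ω : Set Plane) (hΩ : IsBoundedC2Domain Ω)
    (T : ℝ) (hT : 0 < T)
    (N : ℕ) (h : Fin N → Plane → ℝ)
    (hh_indep : LinearIndependent ℝ (fun k => Ω.domRestrict (h k)))
    (hh_smooth : ∀ k, SmoothUpToBoundary Ω (h k))
    (hh_zero : ∀ k, MemH10 Ω (h k))
    (γ₀ : ℝ → Plane) (hγ_cont : ContinuousOn γ₀ (Icc 0 1))
    (hγ_sobolev : MemSobolev (Ioo (0 : ℝ) 1) 2 ⊤ γ₀)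
    (hγ_maps : MapsTo γ₀ (Icc 0 1) (closure Ω))
    (ε : ℝ) (hε : 0 < ε) (lam : ℝ) (hlam : 0 < lam) :
    -- (i) for every control `u` with stream function `ψ = ∑ uₖ hₖ`:
    (∀ u : Control T N,
      -- regularity of the stream function and of the velocity field
      MemL2Sobolev T Ω 3 (streamFunction h u) ∧
      MemL2Sobolev T Ω 2 (fun t => perpGrad (closure Ω) (streamFunction h u t)) ∧
      -- the flow exists, is unique, and maps the closure of `Ω` into itself
      (∃ Φ : ℝ → Plane → Plane,
        (∀ x ∈ closure Ω,
          SolvesIVP T (fun t => perpGrad (closure Ω) (streamFunction h u t)) x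
            (fun t => Φ t x)) ∧
        (∀ t ∈ Icc 0 T, MapsTo (Φ t) (closure Ω) (closure Ω)) ∧
        (∀ x ∈ closure Ω, ∀ y : ℝ → Plane,
          SolvesIVP T (fun t => perpGrad (closure Ω) (streamFunction h u t)) x y →
          (∀ t ∈ Icc 0 T, y t ∈ closure Ω) → ∀ t ∈ Icc 0 T, y t = Φ t x)) ∧
      -- trajectories of smooth extensions of the velocity field do not leave the closure of `Ω`
      (∀ g : Fin N → Plane → ℝ, (∀ k, IsSmoothExtension Ω (h k) (g k)) →
        ∀ T' ∈ Icc 0 T, ∀ x ∈ closure Ω, ∀ y : ℝ → Plane,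
          SolvesIVP T' (fun t => perpGrad univ (streamFunction g u t)) x y →
          ∀ t ∈ Icc 0 T', y t ∈ closure Ω) ∧
      -- the state system has a unique solution
      (∃ X a : ℝ → ℝ → Plane, IsState Ω T γ₀ (streamFunction h u) X a ∧
        ∀ X' a' : ℝ → ℝ → Plane, IsState Ω T γ₀ (streamFunction h u) X' a' →
          ∀ t ∈ Icc 0 T, ∀ s ∈ Icc (0 : ℝ) 1, X' t s = X t s ∧ a' t s = a t s) ∧
      -- the cost is well defined: all integrals exist, and its value is that of any solution
      (∀ t, MemLp (streamFunction h u t) 2 (volume.restrict Ω)) ∧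
      IntervalIntegrable (fun t => ∫ x in Ω, streamFunction h u t x ^ 2) volume 0 T ∧
      (∀ X a : ℝ → ℝ → Plane, IsState Ω T γ₀ (streamFunction h u) X a →
        IntervalIntegrable (fun s => ell ε (a T s)) volume 0 1 ∧
        cost Ω T γ₀ lam ε (streamFunction h u) =
          costOfState Ω T lam ε (streamFunction h u) a)) ∧
    -- the cost depends continuously on `u`, in `L²(0,T;ℝ^N)` ...
    Continuous (fun u : Control T N => cost Ω T γ₀ lam ε (streamFunction h u)) ∧
    -- ... and on `ψ`, in `L²(0,T;L²(Ω))`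
    (∀ (u : Control T N) (w : ℕ → Control T N),
      Tendsto (fun n => ∫ t in (0 : ℝ)..T, ∫ x in Ω,
        (streamFunction h (w n) t x - streamFunction h u t x) ^ 2) atTop (𝓝 0) →
      Tendsto (fun n => cost Ω T γ₀ lam ε (streamFunction h (w n))) atTop
        (𝓝 (cost Ω T γ₀ lam ε (streamFunction h u)))) ∧
    -- (ii) existence of a minimizer over the admissible set
    (∀ R : ℝ, 0 < R →
      ∃ ψ ∈ Uad T h R, ∀ φ ∈ Uad T h R, cost Ω T γ₀ lam ε ψ ≤ cost Ω T γ₀ lam ε φ) := by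
  have hT' := hT.le
  have hγ' := hγ_sobolev.continuousOn_derivWithin hγ_cont
  have hex : ∀ u : Control T N, ∃ X a : ℝ → ℝ → Plane,
      IsState Ω T γ₀ (streamFunction h u) X a :=
    exists_isState hΩ hT' hh_smooth hh_zero hγ_cont hγ' hγ_maps
  have hcont := continuous_cost hΩ hT' hh_smooth hγ' hex lam ε
  refine ⟨fun u => ⟨memL2Sobolev_streamFunction hΩ hh_smooth 3 u,
    memL2Sobolev_perpGrad_streamFunction hΩ hh_smooth 2 u,
    exists_flow hΩ hh_smooth hh_zero hT' u,
    fun g hg T' hT'' x hx y hy => solvesIVP_univ_mem_closure hΩ hg hh_zero hT'' u hx hy, ?_,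
    memLp_streamFunction hΩ hh_smooth u, intervalIntegrable_integral_sq hΩ hT' hh_smooth u,
    fun X a hX => ⟨?_, cost_eq_costOfState hΩ hT' hh_smooth hX lam ε⟩⟩, hcont,
    fun u w hw => (hcont.tendsto u).comp
      (tendsto_of_tendsto_streamFunction hΩ hT' hh_smooth hh_indep hw),
    fun R hR => exists_minimizer_cost hΩ hT' hh_smooth hγ' hex hlam.le ε hR.le⟩
  · obtain ⟨X, a, hX⟩ := hex u
    exact ⟨X, a, hX, fun X' a' hX' => hX.unique hΩ hT' hh_smooth hX'⟩
  · refine ContinuousOn.intervalIntegrable ?_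
    rw [uIcc_of_le zero_le_one]
    exact hX.continuousOn_ell hT' ε
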